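/- Let $T$ be an infinite spherically symmetric tree with root $\rho$: every vertex at distance $j$ from $\rho$ has exactly $d_j\ge 1$ children. Let each edge joining level $n-1$ to level $n$ have probability $p_n$, where $0<\inf_{n\ge1} p_n\le\sup_{n\ge1} p_n<1$. In dynamical percolation on $T$ the edges evolve as independent stationary two-state continuous-time Markov chains; an edge between levels $n-1$ and $n$ switches from closed to open at rate $p_n$ and from open to closed at rate $1-p_n$ (so at each fixed time it is open with probability $p_n$). By convention an edge counts as open at the times at which it switches. Say that $\rho$ percolates at time $t$ if its cluster of edges open at time $t$ is infinite. A time $t$ is a flip time for $\{\rho\leftrightarrow\infty\}$ if $\rho$ percolates at time $t$ and there is an edge $e$ which switches at time $t$ and which is pivotal at time $t$ for the event that $\rho$ percolates (i.e. changing the status of $e$ changes whether the event occurs). Let $w_n$ be the expected number of vertices at level $n$ that are connected to $\rho$ by open edges at a fixed time. Theorem. Suppose that $\sup_j d_j<\infty$, that $\sum_n 1/w_n<\infty$, and that $$\sum_{m=1}^n\frac1m\le C\sum_{m=1}^n\sum_{k=m}^\infty\frac1{w_k}\quad\text{for all } n\ge1 \text{ and some constant } C<\infty,$$ $$\sum_{n=0}^\infty\Bigl(\sum_{m=n+1}^\infty\frac{w_n}{w_m}\Bigr)^{-2}<\infty,$$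 $$\sum_{k=0}^\infty\Bigl((k+1)\,w_k\Bigl(\sum_{j=k}^\infty w_j^{-1}\Bigr)^2\Bigr)^{-1}<\infty.$$ Then with positive probability there are infinitely many flip times for $\{\rho\leftrightarrow\infty\}$ in the time interval $[0,1]$. -/

import Mathlib

open MeasureTheory ProbabilityTheory Filter Topology
open scoped NNReal

namespace DynPerc

section Static

variable {V : Type*} (G : SimpleGraph V)

/-- The random subgraph of `G` formed by all vertices and the open edges; a percolation
configuration is the set `S` of open edges of `G`. -/
def openGraph (S : Set G.edgeSet) : SimpleGraph V :=
  SimpleGraph.fromEdgeSet (Subtype.val '' S)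

/-- The set of configurations in which the vertex `x` percolates: its open cluster is infinite. -/
def percolates (x : V) : Set (Set G.edgeSet) :=
  {S | {y | (openGraph G S).Reachable x y}.Infinite}

/-- The edge `e` is pivotal for the event `A` in the configuration `S`: changing the status of
`e` changes whether or not `A` occurs. -/
def IsPivotal (e : G.edgeSet) (A : Set (Set G.edgeSet)) (S : Set G.edgeSet) : Prop :=
  ¬ (insert e S ∈ A ↔ S \ {e} ∈ A)

/-- `W_n`: the number of vertices at distance `n` from the root `ρ` that are connected to `ρ`
by open edges in the configuration `S`. -/
noncomputable def levelCount (ρ : V) (S : Set G.edgeSet) (n : ℕ) : ℕ :=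
  {y | G.dist ρ y = n ∧ (openGraph G S).Reachable ρ y}.ncard

/-- The level of an edge: an edge joining level `n - 1` to level `n` has level `n`. -/
noncomputable def edgeLevel (ρ : V) (e : G.edgeSet) : ℕ :=
  (Sym2.map (G.dist ρ) e.1).sup

/-- `G` is a tree in which every vertex at distance `j` from the root `ρ` has exactly
`d j` children. -/
structure IsSphericallySymmetricTree (ρ : V) (d : ℕ → ℕ) : Prop where
  isTree : G.IsTree
  children : ∀ v : V, {u | G.Adj v u ∧ G.dist ρ u = G.dist ρ v + 1}.encard = d (G.dist ρ v)

end Static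

section Chain

/-- Generator of the two-state chain (`true` = open, `false` = closed) in which closed switches
to open at rate `p` and open switches to closed at rate `1 - p`. -/
def generator (p : ℝ) : Matrix Bool Bool ℝ := fun a b =>
  match a, b with
  | false, true => p
  | false, false => -p
  | true, false => 1 - p
  | true, true => -(1 - p)

/-- Transition probabilities after time `t` of the chain with generator `generator p`
(see `transition_zero` and `hasDerivAt_transition`). -/
noncomputable def transition (p t : ℝ) : Matrix Bool Bool ℝ :=
  1 + (1 - Real.exp (-t)) • generator p

/-- The stationary distribution: open with probability `p`, closed with probability `1 - p`. -/
def stationary (p : ℝ) (a : Bool) : ℝ := if a = true then p else 1 - p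

lemma transition_zero (p : ℝ) : transition p 0 = 1 := by
  simp [transition]

/-- Kolmogorov's forward equation: `transition p` is the semigroup generated by
`generator p`. -/
lemma hasDerivAt_transition (p t : ℝ) (a b : Bool) :
    HasDerivAt (fun s => transition p s a b) ((transition p t * generator p) a b) t := by
  have h : HasDerivAt (fun s : ℝ => Real.exp (-s)) (-Real.exp (-t)) t := by
    simpa using (hasDerivAt_neg t).exp
  have h2 := ((h.const_sub 1).mul_const (generator p a b)).const_add ((1 : Matrix Bool Bool ℝ) a b)
  have e1 : (fun s => transition p s a b) = fun s =>
      (1 : Matrix Bool Bool ℝ) a b + (1 - Real.exp (-s)) * generator p a b := by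
    funext s
    simp [transition, Matrix.add_apply, Matrix.smul_apply]
  rw [e1]
  refine h2.congr_deriv ?_
  cases a <;> cases b <;>
    simp [transition, generator, Matrix.mul_apply, Matrix.add_apply, Matrix.smul_apply] <;> ring

end Chain

section Dynamics

variable {E Ω : Type*} [MeasurableSpace Ω]

/-- Dynamical percolation on the edge set `E` with edge probabilities `q`: the edges evolve as
independent stationary continuous-time two-state Markov chains with càdlàg paths, a closed edge
`e` switching to open at rate `q e` and an open one switching to closed at rate `1 - q e`.
The status of `e` at time `t` is `X e t ω` (with `true` for open). -/
structure IsDynamicalPercolation (q : E → ℝ) (X : E → ℝ≥0 → Ω → Bool) (P : Measure Ω) :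
    Prop where
  measurable : ∀ e t, Measurable (X e t)
  indep : iIndepFun (fun (e : E) (ω : Ω) (t : ℝ≥0) => X e t ω) P
  /-- Each edge is a stationary Markov chain: its finite-dimensional distributions. -/
  markov : ∀ (e : E) (n : ℕ) (t : Fin (n + 1) → ℝ≥0) (a : Fin (n + 1) → Bool), Monotone t →
    P.real {ω | ∀ i, X e (t i) ω = a i} =
      stationary (q e) (a 0) *
        ∏ i : Fin n, transition (q e) ((t i.succ : ℝ) - t i.castSucc) (a i.castSucc) (a i.succ)
  rightCont : ∀ᵐ ω ∂P, ∀ e t, ∀ᶠ s in 𝓝[>] t, X e s ω = X e t ω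
  leftLim : ∀ᵐ ω ∂P, ∀ e t, ∃ b, ∀ᶠ s in 𝓝[<] t, X e s ω = b

/-- The path `x` of the status of an edge switches at time `t`: the left limit
differs from the value at `t`. -/
def Switches (x : ℝ≥0 → Bool) (t : ℝ≥0) : Prop := ∃ᶠ s in 𝓝[<] t, x s ≠ x t

/-- The set of open edges at time `t`, with the convention that an edge is open at the
times at which it switches. -/
def openAt (x : E → ℝ≥0 → Bool) (t : ℝ≥0) : Set E :=
  {e | x e t = true ∨ Switches (x e) t}

end Dynamics

/-- `t` is a flip time for the vertex `v`: `v` percolates at time `t`, and some edge which is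
pivotal at time `t` for the event that `v` percolates switches at time `t`. -/
def flipTimes {V : Type*} (G : SimpleGraph V) (v : V) (x : G.edgeSet → ℝ≥0 → Bool) : Set ℝ≥0 :=
  {t | openAt x t ∈ percolates G v ∧
    ∃ e, IsPivotal G e (percolates G v) (openAt x t) ∧ Switches (x e) t}

/-- `w_n = E[W_n]`, the expected number of vertices at level `n` connected to the root
at a fixed time (here time `0`; the process is stationary). -/
noncomputable def expectedCount {V Ω : Type*} [MeasurableSpace Ω] (G : SimpleGraph V) (ρ : V)
    (X : G.edgeSet → ℝ≥0 → Ω → Bool) (P : Measure Ω) (n : ℕ) : ℝ :=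
  ∫ ω, (levelCount G ρ (openAt (fun e t => X e t ω) 0) n : ℝ) ∂P

end DynPerc

/-! The proof is a second moment argument over edges, each edge being labelled by its lower endpoint
v. The event `flipEvent` at v says that the first switch of the edge above v occurs by time 1 and
that this edge is then pivotal: the edges above it on the path from the root are open, nothing
hanging off that path reaches infinity, and v percolates downwards. Pivotality of an edge ignores
the state of that edge, so it is independent of the switching time, and the event has probability
comparable to `pivotProb` at the level of v.

Write S_n = ∑_{j ≥ n} 1/w_j, q_n = `survLim` and a_n = `linkProb`. The recursion q = 1 - (1 - a)^d
gives q_n ≍ 1/(w_n S_n). The probability `isoProb` that nothing hangs off a path of length n is at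
least of order S_n^2: each factor (1 - a)^(d-1) is bounded below by the square of a telescoping
ratio times exp(-O(a^2)), and ∑ a^2 converges by the second condition. Hence the expected number of
flip events at level n is at least of order S_n. The first condition enters only through the
divergence of ∑ S_n, which forces the total M_N (`totalPivot`) up to level N to infinity.

For the second moment, let two edges have first switches at s and t, which are independent. An edge
is open at both times with probability at most p exp(-ε|s - t|/2), so k shared edges give the k-th
power of this exponential, whose integral over the switching times is O(1/(k+1)). Pairs of paths
separating after level k then contribute at most a constant times M_N^2 ∑ 1/((k+1) w_k S_k^2), which
the third condition controls. If u is an ancestor of v, the infinite path below u at time s either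
follows the path to v all the way or leaves it at some level r, which costs a factor a_r, while
about r edges are open at both times, a factor 1/r. Summed over the ancestors u of v this gives at
most 2 + ∑ a_r, and the third condition again yields ∑_{r<N} a_r = O(1 + M_N).

So the second moment is O((1 + M_N)^2), and a Kochen–Stone argument produces infinitely many flip
events with positive probability. First switching times of distinct edges almost surely differ,
hence there are infinitely many flip times. -/

namespace DynPerc

/-! ### Survival probabilities of the static percolation and their lower bound. -/

section Survival

/-- `1 - (1 - a)^D ≥ D a / (1 + D a)`. -/
lemma one_sub_pow_le_inv {a : ℝ} (h0 : 0 ≤ a) (h1 : a ≤ 1) (D : ℕ) :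
    (1 - a) ^ D * (1 + D * a) ≤ 1 := by
  have hb : 1 + (D : ℝ) * a ≤ (1 + a) ^ D := one_add_mul_le_pow (by linarith) D
  calc (1 - a) ^ D * (1 + D * a) ≤ (1 - a) ^ D * (1 + a) ^ D := by
        gcongr
    _ = (1 - a ^ 2) ^ D := by rw [← mul_pow]; ring_nf
    _ ≤ 1 := pow_le_one₀ (by nlinarith) (by nlinarith)

/-- Rearranged, this is 1 - (1 - a)^(D+1) ≤ (D+1) a / (1 + D a / 2), the counterpart of
`one_sub_pow_le_inv`; it gives the upper bound on the survival probability. -/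
lemma one_sub_pow_lower {a : ℝ} (h0 : 0 ≤ a) (h1 : a ≤ 1) (D : ℕ) :
    1 - (D + 1 + 1) * a / 2 ≤ (1 - a) ^ (D + 1) * (1 + D * a / 2) := by
  induction D with
  | zero => simp; linarith
  | succ D ih =>
    have hpos : 0 < 1 + (D : ℝ) * a / 2 := by positivity
    have h2 : (1 - (D + 1 + 1) * a / 2) / (1 + D * a / 2) ≤ (1 - a) ^ (D + 1) := by
      rwa [div_le_iff₀ hpos]
    have h3 : (1 - a) * ((1 - (D + 1 + 1) * a / 2) / (1 + D * a / 2)) * (1 + (D + 1) * a / 2) ≤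
        (1 - a) ^ (D + 1 + 1) * (1 + (D + 1) * a / 2) := by
      rw [pow_succ (1 - a) (D + 1), mul_comm ((1 - a) ^ (D + 1))]
      gcongr
    push_cast
    refine le_trans ?_ h3
    rw [mul_div_assoc', div_mul_eq_mul_div, le_div_iff₀ hpos]
    have : 0 ≤ (D + 1) * ((D : ℝ) + 2) * a ^ 3 := by positivity
    nlinarith

/-- Probability that a vertex at level `k` is connected to some vertex `n` levels below it. -/
noncomputable def surv (d : ℕ → ℕ) (p : ℕ → ℝ) : ℕ → ℕ → ℝ
  | 0, _ => 1
  | n + 1, k => 1 - (1 - p (k + 1) * surv d p n (k + 1)) ^ d k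

/-- Probability that a vertex at level `k` percolates downwards. -/
noncomputable def survLim (d : ℕ → ℕ) (p : ℕ → ℝ) (k : ℕ) : ℝ := ⨅ n, surv d p n k

/-- Probability that a given child of a vertex at level `k` is joined to it and percolates. -/
noncomputable def linkProb (d : ℕ → ℕ) (p : ℕ → ℝ) (k : ℕ) : ℝ := p (k + 1) * survLim d p (k + 1)

/-- Probability that no vertex off a given path of length `n` from the root percolates. -/
noncomputable def isoProb (d : ℕ → ℕ) (p : ℕ → ℝ) (n : ℕ) : ℝ :=
  ∏ j ∈ Finset.range n, (1 - linkProb d p j) ^ (d j - 1)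

/-- Mean number of vertices at level `n` connected to the root. -/
noncomputable def meanCount (d : ℕ → ℕ) (p : ℕ → ℝ) (n : ℕ) : ℝ :=
  ∏ j ∈ Finset.range n, (d j * p (j + 1))

/-- `∑_{j ≥ k} 1 / w j`. -/
noncomputable def invTail (w : ℕ → ℝ) (k : ℕ) : ℝ := ∑' j, (w (k + j))⁻¹

variable {d : ℕ → ℕ} {p : ℕ → ℝ} {ε : ℝ}

lemma surv_mem (hp : ∀ n ≥ 1, 0 ≤ p n ∧ p n ≤ 1) (n k : ℕ) :
    0 ≤ surv d p n k ∧ surv d p n k ≤ 1 := by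
  induction n generalizing k with
  | zero => simp [surv]
  | succ n ih =>
    obtain ⟨h0, h1⟩ := ih (k + 1)
    obtain ⟨g0, g1⟩ := hp (k + 1) (by omega)
    have hm : p (k + 1) * surv d p n (k + 1) ≤ 1 := mul_le_one₀ g1 h0 h1
    have hm0 : 0 ≤ p (k + 1) * surv d p n (k + 1) := mul_nonneg g0 h0
    simp only [surv]
    constructor
    · linarith [pow_le_one₀ (n := d k) (sub_nonneg.2 hm) (by linarith)]
    · linarith [pow_nonneg (sub_nonneg.2 hm) (d k)]

lemma surv_anti (hp : ∀ n ≥ 1, 0 ≤ p n ∧ p n ≤ 1) (k : ℕ) : Antitone fun n => surv d p n k := by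
  refine antitone_nat_of_succ_le fun n => ?_
  induction n generalizing k with
  | zero => simpa [surv] using (surv_mem hp 1 k).2
  | succ n ih =>
    obtain ⟨g0, g1⟩ := hp (k + 1) (by omega)
    obtain ⟨h0, h1⟩ := surv_mem (d := d) hp n (k + 1)
    have := ih (k + 1)
    have hm : p (k + 1) * surv d p n (k + 1) ≤ 1 := mul_le_one₀ g1 h0 h1
    refine sub_le_sub_left (pow_le_pow_left₀ (by linarith) ?_ _) _
    exact sub_le_sub_left (mul_le_mul_of_nonneg_left this g0) _

lemma tendsto_surv (hp : ∀ n ≥ 1, 0 ≤ p n ∧ p n ≤ 1) (k : ℕ) :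
    Tendsto (fun n => surv d p n k) atTop (𝓝 (survLim d p k)) :=
  tendsto_atTop_ciInf (surv_anti hp k) ⟨0, by rintro _ ⟨n, rfl⟩; exact (surv_mem hp n k).1⟩

lemma survLim_rec (hp : ∀ n ≥ 1, 0 ≤ p n ∧ p n ≤ 1) (k : ℕ) :
    survLim d p k = 1 - (1 - linkProb d p k) ^ d k := by
  have h1 := (tendsto_add_atTop_iff_nat 1).2 (tendsto_surv (d := d) hp k)
  have h2 : Tendsto (fun n => surv d p (n + 1) k) atTop
      (𝓝 (1 - (1 - linkProb d p k) ^ d k)) := by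
    simp only [surv, linkProb]
    exact (((tendsto_surv hp (k + 1)).const_mul _).const_sub _ |>.pow _).const_sub _
  exact tendsto_nhds_unique h1 h2

lemma survLim_mem (hp : ∀ n ≥ 1, 0 ≤ p n ∧ p n ≤ 1) (k : ℕ) :
    0 ≤ survLim d p k ∧ survLim d p k ≤ 1 :=
  ⟨ge_of_tendsto' (tendsto_surv hp k) fun n => (surv_mem hp n k).1,
    le_of_tendsto' (tendsto_surv hp k) fun n => (surv_mem hp n k).2⟩

lemma meanCount_succ (n : ℕ) :
    meanCount d p (n + 1) = meanCount d p n * (d n * p (n + 1)) := by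
  simp [meanCount, Finset.prod_range_succ]

lemma meanCount_pos (hd : ∀ j, 1 ≤ d j) (hp : ∀ n ≥ 1, 0 < p n) (n : ℕ) :
    0 < meanCount d p n := by
  refine Finset.prod_pos fun j _ => mul_pos ?_ (hp _ (by omega))
  exact_mod_cast hd j

/-- The inequality 1 - (1 - a)^d ≥ da/(1 + da) reads 1/q_k ≤ 1 + 1/(d a). Since w_k d a = w_{k+1}
q_{k+1}, dividing by w_k turns it into 1/(w_k q_k) ≤ 1/w_k + 1/(w_{k+1} q_{k+1}), which is summed
along the n levels. -/
lemma surv_lower (hd : ∀ j, 1 ≤ d j) (hp : ∀ n ≥ 1, 0 < p n ∧ p n ≤ 1) (n k : ℕ) :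
    1 ≤ surv d p n k *
      (meanCount d p k * ∑ j ∈ Finset.range (n + 1), (meanCount d p (k + j))⁻¹) := by
  have hp' : ∀ n ≥ 1, 0 ≤ p n ∧ p n ≤ 1 := fun n h => ⟨(hp n h).1.le, (hp n h).2⟩
  have hw := meanCount_pos hd (fun n h => (hp n h).1)
  induction n generalizing k with
  | zero => simp [surv, (hw k).ne']
  | succ n ih =>
    obtain ⟨g0, g1⟩ := hp (k + 1) (by omega)
    obtain ⟨h0, h1⟩ := surv_mem (d := d) hp' n (k + 1)
    have hD : (1 : ℝ) ≤ d k := by exact_mod_cast hd k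
    set a := p (k + 1) * surv d p n (k + 1) with ha
    have ha1 : a ≤ 1 := mul_le_one₀ g1 h0 h1
    have ha0 : 0 ≤ a := mul_nonneg g0.le h0
    set s := ∑ j ∈ Finset.range (n + 1), (meanCount d p (k + 1 + j))⁻¹ with hs
    have h2 := ih (k + 1)
    rw [meanCount_succ] at h2
    have h3 : ∑ j ∈ Finset.range (n + 1 + 1), (meanCount d p (k + j))⁻¹ =
        s + (meanCount d p k)⁻¹ := by
      rw [Finset.sum_range_succ', hs]
      simp [add_assoc, add_comm 1]
    rw [h3, mul_add, mul_inv_cancel₀ (hw k).ne', surv, ← ha]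
    have h4 : 1 ≤ d k * a * (meanCount d p k * s) := by
      rw [ha]; linarith
    have h5 := one_sub_pow_le_inv ha0 ha1 (d k)
    have hW : 0 ≤ meanCount d p k * s := mul_nonneg (hw k).le
      (Finset.sum_nonneg fun j _ => (inv_pos.2 (hw _)).le)
    set y := (1 - a) ^ d k
    set W := meanCount d p k * s
    set A := (d k : ℝ) * a
    have hA : 0 ≤ A := by positivity
    have hy : y ≤ 1 / (1 + A) := by rw [le_div_iff₀ (by positivity)]; exact h5
    have h6 : A / (1 + A) ≤ 1 - y := by
      have : A / (1 + A) = 1 - 1 / (1 + A) := by field_simp; ring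
      linarith
    calc 1 ≤ A / (1 + A) * (W + 1) := by
          rw [div_mul_eq_mul_div, le_div_iff₀ (by positivity)]; linarith
      _ ≤ _ := by gcongr

lemma survLim_lower (hd : ∀ j, 1 ≤ d j) (hp : ∀ n ≥ 1, 0 < p n ∧ p n ≤ 1)
    (hs : Summable fun n => (meanCount d p n)⁻¹) (k : ℕ) :
    1 ≤ survLim d p k * (meanCount d p k * invTail (meanCount d p) k) := by
  have hp' : ∀ n ≥ 1, 0 ≤ p n ∧ p n ≤ 1 := fun n h => ⟨(hp n h).1.le, (hp n h).2⟩
  have h1 : Summable fun j => (meanCount d p (k + j))⁻¹ := by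
    simpa [add_comm] using (summable_nat_add_iff k).2 hs
  have h2 := (tendsto_add_atTop_iff_nat 1).2 h1.hasSum.tendsto_sum_nat
  exact ge_of_tendsto' ((tendsto_surv hp' k).mul (h2.const_mul _)) fun n => surv_lower hd hp n k

end Survival

/-! ### Consequences of the summability conditions: orders of `survLim`, `isoProb` and `linkProb`.
-/

section Asymptotics

variable {d : ℕ → ℕ} {p : ℕ → ℝ} {ε : ℝ} {D : ℕ}

lemma meanCount_mul_survLim_succ (k : ℕ) :
    meanCount d p (k + 1) * survLim d p (k + 1) = meanCount d p k * (d k * linkProb d p k) := by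
  rw [meanCount_succ, linkProb]; ring

/-- Degrees between `1` and `D`, edge probabilities in `[ε, 1 - ε]`, and `∑ 1 / w n < ∞`. -/
structure GoodParams (d : ℕ → ℕ) (p : ℕ → ℝ) (ε : ℝ) (D : ℕ) : Prop where
  one_le_deg : ∀ j, 1 ≤ d j
  deg_le : ∀ j, d j ≤ D
  eps_pos : 0 < ε
  prob : ∀ n ≥ 1, ε ≤ p n ∧ p n ≤ 1 - ε
  summable : Summable fun n => (meanCount d p n)⁻¹

namespace GoodParams

variable (h : GoodParams d p ε D)
include h

lemma prob_pos : ∀ n ≥ 1, 0 < p n ∧ p n ≤ 1 := fun n hn =>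
  ⟨h.eps_pos.trans_le (h.prob n hn).1, (h.prob n hn).2.trans (by linarith [h.eps_pos])⟩

lemma prob_nonneg : ∀ n ≥ 1, 0 ≤ p n ∧ p n ≤ 1 := fun n hn =>
  ⟨(h.prob_pos n hn).1.le, (h.prob_pos n hn).2⟩

lemma eps_lt_one : ε < 1 := by
  have := h.prob 1 le_rfl
  linarith [h.eps_pos]

lemma count_pos (n : ℕ) : 0 < meanCount d p n :=
  meanCount_pos h.one_le_deg (fun n hn => (h.prob_pos n hn).1) n

lemma summable_shift (k : ℕ) : Summable fun j => (meanCount d p (k + j))⁻¹ := by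
  simpa [add_comm] using (summable_nat_add_iff k).2 h.summable

lemma invTail_succ (k : ℕ) :
    invTail (meanCount d p) k = (meanCount d p k)⁻¹ + invTail (meanCount d p) (k + 1) := by
  rw [invTail, (h.summable_shift k).tsum_eq_zero_add, invTail]
  simp [add_assoc, add_comm 1]

lemma invTail_nonneg (k : ℕ) : 0 ≤ invTail (meanCount d p) k :=
  tsum_nonneg fun _ => (inv_pos.2 (h.count_pos _)).le

lemma invTail_pos (k : ℕ) : 0 < invTail (meanCount d p) k := by
  rw [h.invTail_succ]
  linarith [inv_pos.2 (h.count_pos k), h.invTail_nonneg (k + 1)]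

lemma survLim_pos (k : ℕ) : 0 < survLim d p k := by
  by_contra hneg
  have h1 := survLim_lower h.one_le_deg h.prob_pos h.summable k
  have : survLim d p k * (meanCount d p k * invTail (meanCount d p) k) ≤ 0 :=
    mul_nonpos_of_nonpos_of_nonneg (not_lt.1 hneg)
      (mul_nonneg (h.count_pos k).le (h.invTail_nonneg k))
  linarith

lemma linkProb_pos (k : ℕ) : 0 < linkProb d p k :=
  mul_pos (h.prob_pos _ (by omega)).1 (h.survLim_pos _)

lemma linkProb_le (k : ℕ) : linkProb d p k ≤ 1 - ε := by
  have h1 := h.prob (k + 1) (by omega)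
  have h2 := survLim_mem (d := d) h.prob_nonneg (k + 1)
  rw [linkProb]
  nlinarith [h.eps_pos]

lemma survLim_mul_le (k : ℕ) :
    survLim d p k * (1 + ((d k : ℝ) - 1) * linkProb d p k / 2) ≤ d k * linkProb d p k := by
  obtain ⟨E, hE⟩ : ∃ E, d k = E + 1 := ⟨d k - 1, by have := h.one_le_deg k; omega⟩
  have h1 := one_sub_pow_lower (h.linkProb_pos k).le
    ((h.linkProb_le k).trans (by linarith [h.eps_pos])) E
  rw [survLim_rec h.prob_nonneg, hE]
  push_cast
  nlinarith

/-- Reverse of the step in `surv_lower`: by `survLim_mul_le` the increment of 1/(w q) is at least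
(d_k - 1)/(2 d_k w_k), and 1/(d_k w_k) = p_{k+1}/w_{k+1}. -/
lemma inv_count_step (k : ℕ) :
    (meanCount d p (k + 1) * survLim d p (k + 1))⁻¹ +
      ((meanCount d p k)⁻¹ - p (k + 1) * (meanCount d p (k + 1))⁻¹) / 2 ≤
    (meanCount d p k * survLim d p k)⁻¹ := by
  have hw := h.count_pos k
  have hq := h.survLim_pos k
  have ha := h.linkProb_pos k
  have hp := (h.prob_pos (k + 1) (by omega)).1
  have hd : (1 : ℝ) ≤ d k := by exact_mod_cast h.one_le_deg k
  have h1 := h.survLim_mul_le k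
  rw [meanCount_mul_survLim_succ, meanCount_succ]
  set a := linkProb d p k
  set q := survLim d p k
  set W := meanCount d p k
  set δ := (d k : ℝ)
  have e : (W * (δ * a))⁻¹ + (W⁻¹ - p (k + 1) * (W * (δ * p (k + 1)))⁻¹) / 2 =
      (1 + (δ - 1) * a / 2) / (W * (δ * a)) := by
    field_simp
  rw [e, ← one_div, div_le_div_iff₀ (by positivity) (by positivity)]
  nlinarith

/-- Summing `inv_count_step`, each inner term 1/w_j keeps the coefficient 1 - p_j ≥ ε. This is where
edge probabilities bounded away from 1 matter: levels with d_k = 1 have zero increment on their own,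
and only the regrouping yields a positive share of every 1/w_j. -/
lemma count_survLim_upper_aux (n k : ℕ) :
    (ε * ∑ j ∈ Finset.range n, (meanCount d p (k + j))⁻¹ + (1 - ε) * (meanCount d p k)⁻¹ -
      (1 - ε) * (meanCount d p (k + n))⁻¹) / 2 ≤ (meanCount d p k * survLim d p k)⁻¹ := by
  induction n generalizing k with
  | zero =>
    have := (inv_pos.2 (mul_pos (h.count_pos k) (h.survLim_pos k))).le
    rw [Finset.sum_range_zero, add_zero]
    linarith
  | succ n ih =>
    have h1 := ih (k + 1)
    have h2 := h.inv_count_step k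
    have h3 := h.prob (k + 1) (by omega)
    have h4 := inv_pos.2 (h.count_pos (k + 1))
    have e1 : ∀ j, k + (j + 1) = k + 1 + j := fun j => by omega
    rw [Finset.sum_range_succ', e1 n, add_zero, Finset.sum_congr rfl fun j _ => by rw [e1 j]]
    nlinarith

/-- The probability of percolating from level `k` is at most of order `1 / (w k * S k)`. -/
lemma survLim_upper (k : ℕ) :
    survLim d p k * (meanCount d p k * invTail (meanCount d p) k) ≤ 2 / ε := by
  have h1 := (h.summable_shift k).hasSum.tendsto_sum_nat
  have h2 := (h.summable_shift k).tendsto_atTop_zero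
  have h3 := (((h1.const_mul ε).add_const ((1 - ε) * (meanCount d p k)⁻¹)).sub
    (h2.const_mul (1 - ε))).div_const 2
  have h4 := le_of_tendsto' h3 fun n => h.count_survLim_upper_aux n k
  have hw := h.count_pos k
  have hq := h.survLim_pos k
  -- In the limit the boundary term 1/w_{k+n} vanishes by summability, and the term (1 - ε)/w_k is
  -- positive and can be dropped.
  have h5 : ε * invTail (meanCount d p) k / 2 ≤ (meanCount d p k * survLim d p k)⁻¹ := by
    refine le_trans ?_ h4
    have := mul_pos (sub_pos.2 h.eps_lt_one) (inv_pos.2 hw)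
    rw [← invTail]
    linarith
  rw [← one_div, le_div_iff₀ (by positivity)] at h5
  rw [le_div_iff₀ h.eps_pos]
  linarith

/-- Bounded degree gives 1/w_k = d_k p_{k+1}/w_{k+1} ≤ D/w_{k+1}. This lets S_{k+1} be replaced by
S_k in the bound on `linkProb`. -/
lemma invTail_le_succ (k : ℕ) :
    invTail (meanCount d p) k ≤ (1 + D) * invTail (meanCount d p) (k + 1) := by
  have h1 := h.invTail_succ (k + 1)
  have h2 := h.invTail_nonneg (k + 1 + 1)
  have hw := h.count_pos k
  have hp := h.prob_pos (k + 1) (by omega)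
  have hd : (1 : ℝ) ≤ d k := by exact_mod_cast h.one_le_deg k
  have hD : (d k : ℝ) ≤ D := by exact_mod_cast h.deg_le k
  have h3 : (meanCount d p k)⁻¹ ≤ D * (meanCount d p (k + 1))⁻¹ := by
    rw [meanCount_succ, mul_inv, mul_left_comm]
    refine le_mul_of_one_le_right (inv_pos.2 hw).le ?_
    rw [← div_eq_mul_inv, one_le_div (by nlinarith)]
    nlinarith
  rw [h.invTail_succ k]
  have hD0 : (0 : ℝ) ≤ D := by positivity
  have := mul_le_mul_of_nonneg_left (a := (D : ℝ)) (b := (meanCount d p (k + 1))⁻¹)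
    (c := invTail (meanCount d p) (k + 1)) (by linarith) hD0
  linarith

/-- From w_k a_k ≤ w_k d_k a_k = w_{k+1} q_{k+1} and the upper bound on q_{k+1}. The form with
S_{k+1} is the one matching the second condition of the theorem. -/
lemma linkProb_upper_succ (k : ℕ) :
    linkProb d p k ≤ 2 / ε * (meanCount d p k * invTail (meanCount d p) (k + 1))⁻¹ := by
  have h1 := h.survLim_upper (k + 1)
  have hS := h.invTail_pos (k + 1)
  have hw := h.count_pos k
  have ha := h.linkProb_pos k
  have hd : (1 : ℝ) ≤ d k := by exact_mod_cast h.one_le_deg k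
  rw [← div_eq_mul_inv, le_div_iff₀ (by positivity)]
  calc linkProb d p k * (meanCount d p k * invTail (meanCount d p) (k + 1))
      ≤ (d k * linkProb d p k) * (meanCount d p k * invTail (meanCount d p) (k + 1)) := by
        gcongr; exact le_mul_of_one_le_left ha.le hd
    _ = meanCount d p k * (d k * linkProb d p k) * invTail (meanCount d p) (k + 1) := by ring
    _ = _ := by rw [← meanCount_mul_survLim_succ]
    _ ≤ 2 / ε := by linarith

lemma linkProb_upper (k : ℕ) :
    linkProb d p k ≤ 2 * (1 + D) / ε * (meanCount d p k * invTail (meanCount d p) k)⁻¹ := by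
  refine (h.linkProb_upper_succ k).trans ?_
  have hS := h.invTail_pos (k + 1)
  have hS' := h.invTail_pos k
  have hw := h.count_pos k
  have := h.invTail_le_succ k
  have hε := h.eps_pos
  rw [← div_eq_mul_inv, ← div_eq_mul_inv, div_le_div_iff₀ (by positivity) (by positivity)]
  have e : 2 * (1 + D) / ε * (meanCount d p k * invTail (meanCount d p) (k + 1)) =
    2 / ε * (meanCount d p k * ((1 + D) * invTail (meanCount d p) (k + 1))) := by ring
  rw [e]
  gcongr

/-- With E = d_k - 1, the ratio q/(d a) is at most 1/(1 + E a/2), whose square is at most 1/(1 + E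
a); and (1 - a)^E (1 + E a) = exp(O(a^2)) because the first order terms of the logarithms cancel.
The square is what makes `isoProb` of order S^2. -/
lemma iso_step (k : ℕ) :
    (survLim d p k / (d k * linkProb d p k)) ^ 2 *
      Real.exp (-((D / ε + D ^ 2) * linkProb d p k ^ 2)) ≤ (1 - linkProb d p k) ^ (d k - 1) := by
  obtain ⟨E, hE⟩ : ∃ E, d k = E + 1 := ⟨d k - 1, by have := h.one_le_deg k; omega⟩
  have h1 := h.survLim_mul_le k
  have hq := h.survLim_pos k
  have ha := h.linkProb_pos k
  have ha' := h.linkProb_le k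
  have hε := h.eps_pos
  have hED : (E : ℝ) ≤ D := by
    have := h.deg_le k
    exact_mod_cast (by omega : E ≤ D)
  rw [hE] at h1 ⊢
  push_cast at h1 ⊢
  set a := linkProb d p k
  set q := survLim d p k
  have hE0 : (0 : ℝ) ≤ E := by positivity
  have g1 : q / ((E + 1) * a) ≤ 1 / (1 + E * a / 2) := by
    rw [div_le_div_iff₀ (by positivity) (by positivity)]
    linarith
  have g2 : (q / ((E + 1) * a)) ^ 2 ≤ 1 / (1 + E * a) := by
    calc (q / ((E + 1) * a)) ^ 2 ≤ (1 / (1 + E * a / 2)) ^ 2 := by gcongr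
      _ = 1 / (1 + E * a / 2) ^ 2 := by rw [div_pow, one_pow]
      _ ≤ 1 / (1 + E * a) := by
        apply one_div_le_one_div_of_le (by positivity)
        nlinarith [sq_nonneg (E * a)]
  have h1a : 0 < 1 - a := by linarith
  have l1 : -a - a ^ 2 / ε ≤ Real.log (1 - a) := by
    refine le_trans ?_ (Real.one_sub_inv_le_log_of_pos h1a)
    have : (1 - a)⁻¹ = 1 + a + a ^ 2 / (1 - a) := by field_simp; ring
    rw [this]
    have : a ^ 2 / (1 - a) ≤ a ^ 2 / ε := by gcongr; linarith
    linarith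
  have hpos : 0 < 1 + E * a := by positivity
  have l2 : E * a - (E * a) ^ 2 ≤ Real.log (1 + E * a) := by
    refine le_trans ?_ (Real.one_sub_inv_le_log_of_pos hpos)
    have : (1 + E * a)⁻¹ ≤ 1 - E * a + (E * a) ^ 2 := by
      rw [inv_le_iff_one_le_mul₀ hpos]
      nlinarith [pow_nonneg (mul_nonneg hE0 ha.le) 3]
    linarith
  have l3 : Real.exp (-((D / ε + D ^ 2) * a ^ 2)) ≤ (1 - a) ^ E * (1 + E * a) := by
    rw [← Real.exp_log (pow_pos h1a E), ← Real.exp_log hpos, ← Real.exp_add, Real.log_pow]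
    apply Real.exp_le_exp.2
    have m1 := mul_le_mul_of_nonneg_left l1 hE0
    have m2 : (E : ℝ) * (a ^ 2 / ε) ≤ D * (a ^ 2 / ε) := by gcongr
    have m3 : (E : ℝ) ^ 2 * a ^ 2 ≤ D ^ 2 * a ^ 2 := by gcongr
    have e1 : (D / ε + D ^ 2) * a ^ 2 = D * (a ^ 2 / ε) + D ^ 2 * a ^ 2 := by ring
    rw [e1]
    nlinarith
  calc (q / ((E + 1) * a)) ^ 2 * Real.exp (-((D / ε + D ^ 2) * a ^ 2))
      ≤ 1 / (1 + E * a) * ((1 - a) ^ E * (1 + E * a)) := by gcongr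
    _ = (1 - a) ^ E := by field_simp

/-- The ratios in `iso_step` telescope, since q_k/(d_k a_k) = w_k q_k/(w_{k+1} q_{k+1}). -/
lemma isoProb_lower_aux (n : ℕ) :
    ((meanCount d p n * survLim d p n)⁻¹ * (meanCount d p 0 * survLim d p 0)) ^ 2 *
      Real.exp (-((D / ε + D ^ 2) * ∑ j ∈ Finset.range n, linkProb d p j ^ 2)) ≤ isoProb d p n := by
  induction n with
  | zero =>
    have := (mul_pos (h.count_pos 0) (h.survLim_pos 0)).ne'
    simp [isoProb, -mul_inv_rev, inv_mul_cancel₀ this]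
  | succ n ih =>
    have hs := h.iso_step n
    rw [isoProb, Finset.prod_range_succ, ← isoProb, Finset.sum_range_succ, mul_add, neg_add,
      Real.exp_add, meanCount_mul_survLim_succ]
    have hw := h.count_pos n
    have hq := h.survLim_pos n
    have ha := h.linkProb_pos n
    have hd : (0 : ℝ) < d n := by exact_mod_cast h.one_le_deg n
    refine le_trans (le_of_eq ?_) (mul_le_mul ih hs (by positivity) ?_)
    · field_simp
    · refine Finset.prod_nonneg fun j _ => pow_nonneg ?_ _
      linarith [h.linkProb_le j, h.eps_pos]

/-- `isoProb` is at least of order `S n ^ 2`. -/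
lemma exists_isoProb_lower
    (hbb : Summable fun n => ((meanCount d p n * invTail (meanCount d p) (n + 1)) ^ 2)⁻¹) :
    ∃ c > 0, ∀ n, c * (meanCount d p n * survLim d p n)⁻¹ ^ 2 ≤ isoProb d p n := by
  have hs : Summable fun n => linkProb d p n ^ 2 := by
    refine (hbb.mul_left ((2 / ε) ^ 2)).of_nonneg_of_le (fun n => sq_nonneg _) fun n => ?_
    rw [← inv_pow, ← mul_pow]
    exact pow_le_pow_left₀ (h.linkProb_pos n).le (h.linkProb_upper_succ n) 2
  have hε := h.eps_pos
  have h0 := mul_pos (h.count_pos 0) (h.survLim_pos 0)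
  refine ⟨(meanCount d p 0 * survLim d p 0) ^ 2 *
    Real.exp (-((D / ε + D ^ 2) * ∑' j, linkProb d p j ^ 2)), by positivity, fun n => ?_⟩
  refine le_trans ?_ (h.isoProb_lower_aux n)
  rw [mul_pow _ (_ * _), mul_right_comm, mul_comm (_ ^ 2) (_⁻¹ ^ 2)]
  gcongr
  exact hs.sum_le_tsum _ fun j _ => sq_nonneg _

/-- Converts the denominators w_k `isoProb` of the separating pairs into the w_k S_k^2 of the third
condition. -/
lemma exists_isoProb_ge_sq_invTail
    (hbb : Summable fun n => ((meanCount d p n * invTail (meanCount d p) (n + 1)) ^ 2)⁻¹) :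
    ∃ c > 0, ∀ n, c * invTail (meanCount d p) n ^ 2 ≤ isoProb d p n := by
  obtain ⟨c, hc, h1⟩ := h.exists_isoProb_lower hbb
  have hε := h.eps_pos
  refine ⟨c * (ε / 2) ^ 2, by positivity, fun n => le_trans ?_ (h1 n)⟩
  rw [mul_assoc, ← mul_pow]
  have h2 := h.survLim_upper n
  have hS := h.invTail_pos n
  have hw := h.count_pos n
  have hq := h.survLim_pos n
  gcongr
  rw [← one_div, le_div_iff₀ (by positivity)]
  rw [le_div_iff₀ hε] at h2
  linarith

/-- One factor 1/(w q) survives: w · (w q)^(-2) · q = 1/(w q), which is of order S_n. This is the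
first moment per level. -/
lemma exists_expected_lower
    (hbb : Summable fun n => ((meanCount d p n * invTail (meanCount d p) (n + 1)) ^ 2)⁻¹) :
    ∃ c > 0, ∀ n, c * invTail (meanCount d p) n ≤
      meanCount d p n * (isoProb d p n * survLim d p n) := by
  obtain ⟨c, hc, h1⟩ := h.exists_isoProb_lower hbb
  have hε := h.eps_pos
  refine ⟨c * (ε / 2), by positivity, fun n => ?_⟩
  have h2 := h.survLim_upper n
  have hS := h.invTail_pos n
  have hw := h.count_pos n
  have hq := h.survLim_pos n
  have h3 := h1 n
  rw [le_div_iff₀ hε] at h2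
  have h4 : c * (meanCount d p n * survLim d p n)⁻¹ ≤
      meanCount d p n * (isoProb d p n * survLim d p n) := by
    calc c * (meanCount d p n * survLim d p n)⁻¹
        = meanCount d p n * (c * (meanCount d p n * survLim d p n)⁻¹ ^ 2 * survLim d p n) := by
          field_simp
      _ ≤ _ := by gcongr
  refine le_trans ?_ h4
  rw [mul_assoc]
  gcongr
  rw [← one_div, le_div_iff₀ (by positivity)]
  linarith

/-- Double counting: for k < N the term 1/w_k occurs in S_0, …, S_k. -/
lemma sum_mul_inv_le_sum_invTail (N : ℕ) :
    ∑ k ∈ Finset.range N, ((k : ℝ) + 1) * (meanCount d p k)⁻¹ ≤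
      ∑ m ∈ Finset.range N, invTail (meanCount d p) m := by
  -- With the boundary term N S_N added the two sides are equal, because (N+1)/w_N + (N+1) S_{N+1} =
  -- (N+1) S_N; this is what the induction uses.
  suffices H : ∑ k ∈ Finset.range N, ((k : ℝ) + 1) * (meanCount d p k)⁻¹ +
      N * invTail (meanCount d p) N ≤ ∑ m ∈ Finset.range N, invTail (meanCount d p) m by
    have := mul_nonneg (Nat.cast_nonneg (α := ℝ) N) (h.invTail_nonneg N)
    linarith
  induction N with
  | zero => simp
  | succ N ih =>
    have h1 := h.invTail_succ N
    rw [Finset.sum_range_succ, Finset.sum_range_succ]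
    push_cast
    rw [h1] at ih ⊢
    linarith

/-- The bound a_k = O(1/(w_k S_k)) is split as 1/(w S) ≤ 1/((k+1) w S^2) + (k+1)/w. The first part
is summable by the third condition and the second is controlled by `sum_mul_inv_le_sum_invTail`. -/
lemma exists_sum_linkProb_le
    (hf : Summable fun k : ℕ =>
      (((k : ℝ) + 1) * meanCount d p k * invTail (meanCount d p) k ^ 2)⁻¹) :
    ∃ K > 0, ∀ N, ∑ k ∈ Finset.range N, linkProb d p k ≤
      K * (1 + ∑ m ∈ Finset.range N, invTail (meanCount d p) m) := by
  set T := ∑' k : ℕ, (((k : ℝ) + 1) * meanCount d p k * invTail (meanCount d p) k ^ 2)⁻¹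
  have hnn : ∀ k : ℕ, 0 ≤ (((k : ℝ) + 1) * meanCount d p k * invTail (meanCount d p) k ^ 2)⁻¹ :=
    fun k => by have := h.count_pos k; positivity
  have hT : 0 ≤ T := tsum_nonneg hnn
  have hε := h.eps_pos
  refine ⟨2 * (1 + D) / ε * (T + 1), by positivity, fun N => ?_⟩
  calc ∑ k ∈ Finset.range N, linkProb d p k
      ≤ ∑ k ∈ Finset.range N, 2 * (1 + D) / ε *
        ((((k : ℝ) + 1) * meanCount d p k * invTail (meanCount d p) k ^ 2)⁻¹ +
          ((k : ℝ) + 1) * (meanCount d p k)⁻¹) := by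
        refine Finset.sum_le_sum fun k _ => (h.linkProb_upper k).trans ?_
        gcongr
        have hS := h.invTail_pos k
        have hw := h.count_pos k
        -- With y = (k+1) S_k the difference is a positive multiple of 1 - y + y^2.
        have e : (((k : ℝ) + 1) * meanCount d p k * invTail (meanCount d p) k ^ 2)⁻¹ +
            ((k : ℝ) + 1) * (meanCount d p k)⁻¹ -
            (meanCount d p k * invTail (meanCount d p) k)⁻¹ =
            (1 - (k + 1) * invTail (meanCount d p) k + ((k + 1) * invTail (meanCount d p) k) ^ 2) /
            (((k : ℝ) + 1) * meanCount d p k * invTail (meanCount d p) k ^ 2) := by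
          field_simp
          ring
        have : 0 ≤ (1 - (k + 1) * invTail (meanCount d p) k +
            ((k + 1) * invTail (meanCount d p) k) ^ 2) /
            (((k : ℝ) + 1) * meanCount d p k * invTail (meanCount d p) k ^ 2) := by
          refine div_nonneg ?_ (by positivity)
          nlinarith [sq_nonneg ((k + 1) * invTail (meanCount d p) k - 1)]
        linarith
    _ ≤ 2 * (1 + D) / ε * (T + ∑ m ∈ Finset.range N, invTail (meanCount d p) m) := by
        rw [← Finset.mul_sum, Finset.sum_add_distrib]
        exact mul_le_mul_of_nonneg_left (add_le_add (hf.sum_le_tsum _ fun k _ => hnn k)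
          (h.sum_mul_inv_le_sum_invTail N)) (by positivity)
    _ ≤ _ := by
        rw [mul_assoc]
        gcongr
        have := Finset.sum_nonneg fun m (_ : m ∈ Finset.range N) => h.invTail_nonneg m
        nlinarith

end GoodParams

end Asymptotics

/-! ### Rooted trees, percolation events on them, and pivotality; a vertex stands for the edge above
it. -/

/-- A rooted tree in which every vertex at level `j` has `d j` children, given by its parent map
(the root is its own parent by convention). -/
structure RootedTree (V : Type*) (d : ℕ → ℕ) where
  root : V
  par : V → V
  lev : V → ℕ
  ch : V → Finset V
  mem_ch : ∀ {u v}, u ∈ ch v ↔ u ≠ root ∧ par u = v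
  par_root : par root = root
  lev_root : lev root = 0
  lev_par : ∀ {u}, u ≠ root → lev u = lev (par u) + 1
  card_ch : ∀ v, (ch v).card = d (lev v)

namespace RootedTree

variable {V : Type*} {d : ℕ → ℕ} (T : RootedTree V d)

lemma lev_eq_zero {u : V} : T.lev u = 0 ↔ u = T.root := by
  refine ⟨fun h => ?_, fun h => h ▸ T.lev_root⟩
  by_contra hu
  have := T.lev_par hu
  omega

lemma lev_of_mem_ch {u v : V} (h : u ∈ T.ch v) : T.lev u = T.lev v + 1 := by
  obtain ⟨h1, rfl⟩ := T.mem_ch.1 h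
  exact T.lev_par h1

lemma lev_iterate {u : V} {i : ℕ} (hi : i ≤ T.lev u) : T.lev (T.par^[i] u) = T.lev u - i := by
  induction i with
  | zero => rfl
  | succ i ih =>
    have h1 := ih (by omega)
    rw [Function.iterate_succ_apply']
    have h2 : T.par^[i] u ≠ T.root := fun h => by
      rw [h, T.lev_root] at h1; omega
    have := T.lev_par h2
    omega

/-- The ancestor of `v` at level `j` (for `j ≤ lev v`). -/
def anc (v : V) (j : ℕ) : V := T.par^[T.lev v - j] v

lemma lev_anc {v : V} {j : ℕ} (hj : j ≤ T.lev v) : T.lev (T.anc v j) = j := by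
  rw [anc, T.lev_iterate (by omega)]; omega

@[simp] lemma anc_lev (v : V) : T.anc v (T.lev v) = v := by simp [anc]

@[simp] lemma anc_zero (v : V) : T.anc v 0 = T.root := T.lev_eq_zero.1 (T.lev_anc (Nat.zero_le _))

lemma par_anc_succ {v : V} {j : ℕ} (hj : j < T.lev v) : T.par (T.anc v (j + 1)) = T.anc v j := by
  rw [anc, anc, ← Function.iterate_succ_apply' T.par]
  congr 2
  omega

lemma anc_ne_root {v : V} {j : ℕ} (hj : j ≤ T.lev v) (h0 : j ≠ 0) : T.anc v j ≠ T.root :=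
  fun h => by have := T.lev_anc hj; rw [h, T.lev_root] at this; omega

lemma anc_mem_ch {v : V} {j : ℕ} (hj : j < T.lev v) : T.anc v (j + 1) ∈ T.ch (T.anc v j) :=
  T.mem_ch.2 ⟨T.anc_ne_root hj (by omega), T.par_anc_succ hj⟩

lemma anc_par {v : V} {j : ℕ} (hj : j < T.lev v) : T.anc (T.par v) j = T.anc v j := by
  have h1 : v ≠ T.root := fun h => by rw [h, T.lev_root] at hj; omega
  have h2 := T.lev_par h1
  rw [anc, anc, ← Function.iterate_succ_apply T.par]
  congr 2
  omega

lemma anc_anc {v : V} {i j : ℕ} (hij : i ≤ j) (hj : j ≤ T.lev v) :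
    T.anc (T.anc v j) i = T.anc v i := by
  rw [anc, T.lev_anc hj, anc, anc, ← Function.iterate_add_apply]
  congr 2
  omega

/-- Descendants of `v`, including `v`. -/
def desc (v : V) : Set V := {y | T.lev v ≤ T.lev y ∧ T.anc y (T.lev v) = v}

/-- Strict descendants of `v`. -/
def sdesc (v : V) : Set V := T.desc v \ {v}

/-- Descendants of the siblings of `w`. -/
def sibDesc (w : V) : Set V := {y | ∃ c ∈ T.ch (T.par w), c ≠ w ∧ y ∈ T.desc c}

lemma self_mem_desc (v : V) : v ∈ T.desc v := ⟨le_rfl, by simp⟩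

lemma mem_desc_anc {v : V} {j : ℕ} (hj : j ≤ T.lev v) : v ∈ T.desc (T.anc v j) := by
  refine ⟨by rw [T.lev_anc hj]; exact hj, by rw [T.lev_anc hj]⟩

lemma desc_trans {u v y : V} (h1 : y ∈ T.desc v) (h2 : v ∈ T.desc u) : y ∈ T.desc u := by
  refine ⟨h2.1.trans h1.1, ?_⟩
  rw [← T.anc_anc h2.1 h1.1, h1.2, h2.2]

lemma desc_subset_par {w : V} : T.desc w ⊆ T.desc (T.par w) := by
  intro y hy
  by_cases hw : w = T.root
  · rw [hw, T.par_root, ← hw]; exact hy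
  · refine T.desc_trans hy ?_
    have := T.lev_par hw
    refine ⟨by omega, ?_⟩
    rw [anc, this, Nat.add_sub_cancel_left]
    rfl

lemma lev_lt_of_mem_sdesc {v y : V} (h : y ∈ T.sdesc v) : T.lev v < T.lev y := by
  rcases h.1.1.lt_or_eq with h1 | h1
  · exact h1
  · exact absurd (by have := h.1.2; rw [h1, T.anc_lev] at this; exact this) h.2

lemma eq_of_mem_desc {u v y : V} (hlev : T.lev u = T.lev v) (hu : y ∈ T.desc u)
    (hv : y ∈ T.desc v) : u = v := by
  rw [← hu.2, ← hv.2, hlev]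

lemma mem_sdesc_iff {v y : V} : y ∈ T.sdesc v ↔ ∃ c ∈ T.ch v, y ∈ T.desc c := by
  constructor
  · intro h
    have h1 := T.lev_lt_of_mem_sdesc h
    refine ⟨T.anc y (T.lev v + 1), ?_, T.mem_desc_anc h1⟩
    have := T.anc_mem_ch h1
    rwa [h.1.2] at this
  · rintro ⟨c, hc, hy⟩
    obtain ⟨h1, rfl⟩ := T.mem_ch.1 hc
    refine ⟨T.desc_subset_par hy, fun h => ?_⟩
    have h2 := hy.1
    rw [h, T.lev_par h1] at h2
    omega

lemma sibDesc_subset {w : V} (hw : w ≠ T.root) : T.sibDesc w ⊆ T.sdesc (T.par w) \ T.desc w := by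
  rintro y ⟨c, hc, hcw, hy⟩
  refine ⟨T.mem_sdesc_iff.2 ⟨c, hc, hy⟩, fun h => hcw ?_⟩
  refine T.eq_of_mem_desc ?_ hy h
  rw [T.lev_of_mem_ch hc, T.lev_par hw]

lemma disjoint_desc {u v : V} (hlev : T.lev u = T.lev v) (h : u ≠ v) :
    Disjoint (T.desc u) (T.desc v) :=
  Set.disjoint_left.2 fun _ hu hv => h (T.eq_of_mem_desc hlev hu hv)

/-- `w` is connected by a path of vertices of `S` to a vertex `n` levels below it. -/
def conn : ℕ → V → Set (Set V)
  | 0, _ => Set.univ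
  | n + 1, v => {S | ∃ c ∈ T.ch v, c ∈ S ∧ S ∈ conn n c}

/-- `v` percolates downwards in `S`. -/
def perc (v : V) : Set (Set V) := {S | ∀ n, S ∈ T.conn n v}

/-- `v` is in `S` and percolates downwards. -/
def link (v : V) : Set (Set V) := {S | v ∈ S ∧ S ∈ T.perc v}

/-- No sibling of `w` is in `S` and percolates. -/
def noSib (w : V) : Set (Set V) := {S | ∀ c ∈ T.ch (T.par w), c ≠ w → S ∉ T.link c}

/-- The event that the edge above `v` decides whether the root percolates: all proper ancestors of
`v` are in `S`, no vertex hanging off the path to `v` is linked to infinity, and `v`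
percolates downwards. -/
def pivot (v : V) : Set (Set V) :=
  {S | S ∈ T.perc v ∧ ∀ j < T.lev v, S ∈ T.noSib (T.anc v (j + 1)) ∧ T.anc v j ∈ S}

lemma conn_anti {n : ℕ} {v : V} : T.conn (n + 1) v ⊆ T.conn n v := by
  induction n generalizing v with
  | zero => exact fun _ _ => trivial
  | succ n ih => exact fun S ⟨c, hc, h1, h2⟩ => ⟨c, hc, h1, ih h2⟩

lemma conn_antitone (v : V) : Antitone fun n => T.conn n v :=
  antitone_nat_of_succ_le fun _ => T.conn_anti

/-- König's lemma. If each of the finitely many children is closed or fails at some depth, then v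
fails at one more than the largest of these depths, because connection to depth n is antitone in n.
-/
lemma perc_iff {v : V} {S : Set V} : S ∈ T.perc v ↔ ∃ c ∈ T.ch v, S ∈ T.link c := by
  constructor
  · intro h
    by_contra! hc
    have : ∀ c ∈ T.ch v, ∃ n, c ∈ S → S ∉ T.conn n c := fun c hcv => by
      by_contra! h'
      exact hc c hcv ⟨(h' 0).1, fun n => (h' n).2⟩
    choose! f hf using this
    obtain ⟨c, hcv, h1, h2⟩ := h ((T.ch v).sup f + 1)
    exact hf c hcv h1 (T.conn_antitone c (Finset.le_sup hcv) h2)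
  · rintro ⟨c, hc, h1, h2⟩ n
    exact T.conn_anti ⟨c, hc, h1, h2 n⟩

lemma conn_mono {n : ℕ} {v : V} {S S' : Set V} (hS : S ⊆ S') (h : S ∈ T.conn n v) :
    S' ∈ T.conn n v := by
  induction n generalizing v with
  | zero => trivial
  | succ n ih => obtain ⟨c, hc, h1, h2⟩ := h; exact ⟨c, hc, hS h1, ih h2⟩

lemma perc_mono {v : V} {S S' : Set V} (hS : S ⊆ S') (h : S ∈ T.perc v) : S' ∈ T.perc v :=
  fun n => T.conn_mono hS (h n)

lemma link_mono {v : V} {S S' : Set V} (hS : S ⊆ S') (h : S ∈ T.link v) : S' ∈ T.link v :=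
  ⟨hS h.1, T.perc_mono hS h.2⟩

/-- In a configuration of `pivot v`, the root percolates iff the edge above `v` is open. -/
lemma perc_root_insert_of_pivot {v : V} {S : Set V} (h : S ∈ T.pivot v) :
    insert v S ∈ T.perc T.root := by
  have key : ∀ i ≤ T.lev v, insert v S ∈ T.perc (T.anc v (T.lev v - i)) := by
    intro i
    induction i with
    | zero => intro _; rw [Nat.sub_zero, anc_lev]; exact T.perc_mono (Set.subset_insert _ _) h.1
    | succ i ih =>
      intro hi
      have hj : T.lev v - (i + 1) < T.lev v := by omega
      have e : T.lev v - (i + 1) + 1 = T.lev v - i := by omega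
      refine T.perc_iff.2 ⟨_, T.anc_mem_ch hj, ?_⟩
      rw [e]
      refine ⟨?_, ih (by omega)⟩
      rcases Nat.eq_zero_or_pos i with rfl | hi0
      · simp
      · exact Set.mem_insert_of_mem _ (h.2 (T.lev v - i) (by omega)).2
  simpa using key _ le_rfl

/-- Since no sibling off the path is linked to infinity, any infinite path from the root is forced
down the path to v one vertex at a time, and must therefore use v itself. -/
lemma not_perc_root_diff_of_pivot {v : V} {S : Set V} (h : S ∈ T.pivot v) (hv : v ≠ T.root) :
    S \ {v} ∉ T.perc T.root := by
  intro hp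
  have key : ∀ i ≤ T.lev v, S \ {v} ∈ T.perc (T.anc v i) ∧ (i ≠ 0 → T.anc v i ∈ S \ {v}) := by
    intro i
    induction i with
    | zero => intro _; simpa using hp
    | succ i ih =>
      intro hi
      obtain ⟨c, hc, hl⟩ := T.perc_iff.1 (ih (by omega)).1
      have : c = T.anc v (i + 1) := by
        by_contra hne
        refine (h.2 i hi).1 c ?_ hne (T.link_mono Set.sdiff_subset hl)
        rwa [T.par_anc_succ hi]
      subst this
      exact ⟨hl.2, fun _ => hl.1⟩
  have h1 := (key _ le_rfl).2 (fun h => hv (T.lev_eq_zero.1 h))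
  rw [anc_lev] at h1
  exact h1.2 rfl

end RootedTree

/-! ### Measurability of these events and the coordinates on which they depend. -/

section Measurability

variable {V : Type*} {d : ℕ → ℕ} (T : RootedTree V d)

namespace RootedTree

lemma measurableSet_conn (n : ℕ) (v : V) : MeasurableSet (T.conn n v) := by
  induction n generalizing v with
  | zero => exact MeasurableSet.univ
  | succ n ih =>
    have : T.conn (n + 1) v = ⋃ c ∈ T.ch v, {S | c ∈ S} ∩ T.conn n c := by
      ext S; simp only [conn, Set.mem_ofPred_eq, Set.mem_iUnion, Set.mem_inter_iff, exists_prop]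
    rw [this]
    exact Finset.measurableSet_biUnion _ fun c _ =>
      (measurableSet_setOfPred.2 (measurable_set_mem c)).inter (ih c)

lemma measurableSet_perc (v : V) : MeasurableSet (T.perc v) := by
  have : T.perc v = ⋂ n, T.conn n v := by ext; simp [perc]
  rw [this]
  exact MeasurableSet.iInter fun n => T.measurableSet_conn n v

lemma measurableSet_link (v : V) : MeasurableSet (T.link v) :=
  (measurableSet_setOfPred.2 (measurable_set_mem v)).inter (T.measurableSet_perc v)

lemma measurableSet_noSib (w : V) : MeasurableSet (T.noSib w) := by
  classical
  have : T.noSib w = ⋂ c ∈ (T.ch (T.par w)).erase w, (T.link c)ᶜ := by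
    ext S; simp [noSib]; tauto
  rw [this]
  exact Finset.measurableSet_biInter _ fun c _ => (T.measurableSet_link c).compl

lemma measurableSet_pivot (v : V) : MeasurableSet (T.pivot v) := by
  have : T.pivot v = T.perc v ∩ ⋂ j ∈ Finset.range (T.lev v),
      (T.noSib (T.anc v (j + 1)) ∩ {S | T.anc v j ∈ S}) := by
    ext S; simp [pivot]
  rw [this]
  exact (T.measurableSet_perc v).inter (Finset.measurableSet_biInter _ fun j _ =>
    (T.measurableSet_noSib _).inter (measurableSet_setOfPred.2 (measurable_set_mem _)))

lemma conn_congr {n : ℕ} {v : V} {S S' : Set V} (h : ∀ y ∈ T.sdesc v, y ∈ S ↔ y ∈ S') :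
    S ∈ T.conn n v ↔ S' ∈ T.conn n v := by
  induction n generalizing v with
  | zero => simp [conn]
  | succ n ih =>
    refine exists_congr fun c => and_congr_right fun hc => ?_
    have hs : T.desc c ⊆ T.sdesc v := fun y hy => T.mem_sdesc_iff.2 ⟨c, hc, hy⟩
    exact and_congr (h c (hs (T.self_mem_desc c))) (ih fun y hy => h y (hs hy.1))

lemma perc_congr {v : V} {S S' : Set V} (h : ∀ y ∈ T.sdesc v, y ∈ S ↔ y ∈ S') :
    S ∈ T.perc v ↔ S' ∈ T.perc v := forall_congr' fun _ => T.conn_congr h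

lemma link_congr {v : V} {S S' : Set V} (h : ∀ y ∈ T.desc v, y ∈ S ↔ y ∈ S') :
    S ∈ T.link v ↔ S' ∈ T.link v :=
  and_congr (h v (T.self_mem_desc v)) (T.perc_congr fun y hy => h y hy.1)

lemma noSib_congr {w : V} {S S' : Set V} (h : ∀ y ∈ T.sibDesc w, y ∈ S ↔ y ∈ S') :
    S ∈ T.noSib w ↔ S' ∈ T.noSib w :=
  forall_congr' fun c => forall_congr' fun hc => forall_congr' fun hcw =>
    not_congr (T.link_congr fun y hy => h y ⟨c, hc, hcw, hy⟩)

/-- The state of v itself plays no role: this is the source of the independence between being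
pivotal at a switch and the time of that switch. -/
lemma pivot_congr {v : V} {S S' : Set V} (h : ∀ y ≠ v, y ∈ S ↔ y ∈ S') :
    S ∈ T.pivot v ↔ S' ∈ T.pivot v := by
  refine and_congr (T.perc_congr fun y hy => h y hy.2) (forall_congr' fun j =>
    forall_congr' fun hj => and_congr (T.noSib_congr fun y hy => h y ?_) (h _ ?_))
  · rintro rfl
    exact (T.sibDesc_subset (T.anc_ne_root hj (by omega)) hy).2 (T.mem_desc_anc hj)
  · intro he
    have := T.lev_anc hj.le
    rw [he] at this
    omega

end RootedTree

end Measurability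

/-! ### Independence of events that depend on disjoint sets of vertices. -/

section Blocks

variable {V Ω : Type*} {mΩ : MeasurableSpace Ω} {P : Measure Ω}
  {m : V → MeasurableSpace Ω}

/-- The σ-algebra generated by the coordinates in `A`. -/
abbrev blk (m : V → MeasurableSpace Ω) (A : Set V) : MeasurableSpace Ω := ⨆ v ∈ A, m v

lemma blk_mono {A B : Set V} (h : A ⊆ B) : blk m A ≤ blk m B :=
  biSup_mono fun _ hv => h hv

lemma le_blk {A : Set V} {v : V} (h : v ∈ A) : m v ≤ blk m A := le_biSup m h

lemma blk_le (hle : ∀ v, m v ≤ mΩ) (A : Set V) : blk m A ≤ mΩ := iSup₂_le fun v _ => hle v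

lemma real_inter_of_disjoint (hle : ∀ v, m v ≤ mΩ) (hm : iIndep m P) {A B : Set V}
    (hAB : Disjoint A B) {E F : Set Ω} (hE : MeasurableSet[blk m A] E)
    (hF : MeasurableSet[blk m B] F) : P.real (E ∩ F) = P.real E * P.real F := by
  have := (Indep_iff _ _ _).1 (indep_iSup_of_disjoint hle hm hAB) E F hE hF
  simp [measureReal_def, this]

lemma real_biInter_of_disjoint (hle : ∀ v, m v ≤ mΩ) (hm : iIndep m P) {ι : Type*}
    (s : Finset ι) (A : ι → Set V) (hA : (s : Set ι).PairwiseDisjoint A) (E : ι → Set Ω)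
    (hE : ∀ i ∈ s, MeasurableSet[blk m (A i)] (E i)) :
    P.real (⋂ i ∈ s, E i) = ∏ i ∈ s, P.real (E i) := by
  classical
  have := hm.isProbabilityMeasure
  induction s using Finset.induction_on with
  | empty => simp
  | insert i s hi ih =>
    rw [Finset.set_biInter_insert, Finset.prod_insert hi, ← ih
      (hA.subset (by simp)) fun j hj => hE j (Finset.mem_insert_of_mem hj)]
    refine real_inter_of_disjoint (A := A i) (B := ⋃ j ∈ s, A j) hle hm ?_
      (hE i (Finset.mem_insert_self i s)) ?_
    · rw [Set.disjoint_iUnion₂_right]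
      intro j hj
      exact hA (Finset.mem_insert_self i s) (Finset.mem_insert_of_mem hj) (by rintro rfl; exact hi hj)
    · refine Finset.measurableSet_biInter _ fun j hj => ?_
      exact blk_mono (Set.subset_biUnion_of_mem (u := A) (Finset.mem_coe.2 hj)) _ (hE j (Finset.mem_insert_of_mem hj))

/-- `S` is a random set of vertices whose restriction to each vertex `v` is `m v`-measurable. -/
def Adapted (m : V → MeasurableSpace Ω) (S : Ω → Set V) : Prop :=
  ∀ v, MeasurableSet[m v] {ω | v ∈ S ω}

lemma Adapted.measurableSet_blk {S : Ω → Set V} (hS : Adapted m S) {E : Set (Set V)} {A : Set V}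
    (hE : MeasurableSet E) (hEA : ∀ S S' : Set V, (∀ y ∈ A, y ∈ S ↔ y ∈ S') → (S ∈ E ↔ S' ∈ E)) :
    MeasurableSet[blk m A] {ω | S ω ∈ E} := by
  -- An event insensitive to the coordinates outside A can be tested on the truncated configuration,
  -- which is measurable for the block of A.
  have h1 : Measurable[blk m A] fun ω => S ω ∩ A := by
    refine @measurable_set_iff _ _ (blk m A) _ |>.2 fun a => ?_
    by_cases ha : a ∈ A
    · have : (fun ω => a ∈ S ω ∩ A) = fun ω => a ∈ S ω := by ext; simp [ha]
      rw [this]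
      exact (@measurableSet_setOfPred _ (blk m A) _).1 (le_blk ha _ (hS a))
    · have : (fun ω => a ∈ S ω ∩ A) = fun _ => False := by ext; simp [ha]
      rw [this]
      exact measurable_const
  have h2 : {ω | S ω ∈ E} = (fun ω => S ω ∩ A) ⁻¹' E := by
    ext ω
    exact hEA _ _ fun y hy => by simp [hy]
  rw [h2]
  exact h1 hE

end Blocks

/-! ### Exact probabilities of the static events. -/

section Static

variable {V Ω : Type*} {mΩ : MeasurableSpace Ω} {P : Measure Ω} {m : V → MeasurableSpace Ω}
  {d : ℕ → ℕ} {p : ℕ → ℝ} (T : RootedTree V d) {S : Ω → Set V}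

namespace RootedTree

lemma measurableSet_blk_conn (hS : Adapted m S) (n : ℕ) (v : V) :
    MeasurableSet[blk m (T.sdesc v)] {ω | S ω ∈ T.conn n v} :=
  hS.measurableSet_blk (T.measurableSet_conn n v) fun _ _ h => T.conn_congr h

lemma measurableSet_blk_perc (hS : Adapted m S) (v : V) :
    MeasurableSet[blk m (T.sdesc v)] {ω | S ω ∈ T.perc v} :=
  hS.measurableSet_blk (T.measurableSet_perc v) fun _ _ h => T.perc_congr h

lemma measurableSet_blk_link (hS : Adapted m S) (v : V) :
    MeasurableSet[blk m (T.desc v)] {ω | S ω ∈ T.link v} :=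
  hS.measurableSet_blk (T.measurableSet_link v) fun _ _ h => T.link_congr h

lemma measurableSet_blk_noSib (hS : Adapted m S) (w : V) :
    MeasurableSet[blk m (T.sibDesc w)] {ω | S ω ∈ T.noSib w} :=
  hS.measurableSet_blk (T.measurableSet_noSib w) fun _ _ h => T.noSib_congr h

lemma disjoint_singleton_sdesc (v : V) : Disjoint {v} (T.sdesc v) := by
  simp [sdesc]

lemma pairwiseDisjoint_desc (v : V) : (T.ch v : Set V).PairwiseDisjoint T.desc := by
  intro a ha b hb hab
  exact T.disjoint_desc (by rw [T.lev_of_mem_ch ha, T.lev_of_mem_ch hb]) hab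

variable (hle : ∀ v, m v ≤ mΩ) (hm : iIndep m P) (hS : Adapted m S)
  (hp : ∀ v, P.real {ω | v ∈ S ω} = p (T.lev v))
include hle hm hS

include hp

/-- The subtrees of the children are disjoint, so the failures of the children are independent and
the recursion defining `surv` appears. -/
lemma real_conn (n : ℕ) (v : V) : P.real {ω | S ω ∈ T.conn n v} = surv d p n (T.lev v) := by
  have := hm.isProbabilityMeasure
  induction n generalizing v with
  | zero => simp [conn, surv]
  | succ n ih =>
    have e : {ω | S ω ∈ T.conn (n + 1) v} =
        (⋂ c ∈ T.ch v, ({ω | c ∈ S ω} ∩ {ω | S ω ∈ T.conn n c})ᶜ)ᶜ := by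
      ext ω
      simp only [conn, Set.mem_ofPred_eq, Set.mem_compl_iff, Set.mem_iInter, Set.mem_inter_iff,
        not_forall, not_not, exists_prop]
    have hmeas : ∀ c, MeasurableSet[blk m (T.desc c)] ({ω | c ∈ S ω} ∩ {ω | S ω ∈ T.conn n c}) :=
      fun c => MeasurableSet.inter (le_blk (T.self_mem_desc c) _ (hS c))
        (blk_mono Set.sdiff_subset _ (T.measurableSet_blk_conn hS n c))
    rw [e, probReal_compl_eq_one_sub (Finset.measurableSet_biInter _ fun c _ =>
        (blk_le hle _ _ (hmeas c)).compl),
      real_biInter_of_disjoint hle hm _ T.desc (T.pairwiseDisjoint_desc v) _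
        (fun c _ => (hmeas c).compl), Finset.prod_congr rfl (g := fun _ => 1 - p (T.lev v + 1) *
          surv d p n (T.lev v + 1)), Finset.prod_const, T.card_ch, surv]
    intro c hc
    rw [probReal_compl_eq_one_sub (blk_le hle _ _ (hmeas c)),
      real_inter_of_disjoint hle hm (T.disjoint_singleton_sdesc c)
        (le_blk (Set.mem_singleton c) _ (hS c)) (T.measurableSet_blk_conn hS n c), hp, ih,
      T.lev_of_mem_ch hc]

lemma real_perc (hp01 : ∀ n ≥ 1, 0 ≤ p n ∧ p n ≤ 1) (v : V) :
    P.real {ω | S ω ∈ T.perc v} = survLim d p (T.lev v) := by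
  have := hm.isProbabilityMeasure
  have h1 := tendsto_measure_iInter_atTop (μ := P) (s := fun n => {ω | S ω ∈ T.conn n v})
    (fun n => (blk_le hle _ _ (T.measurableSet_blk_conn hS n v)).nullMeasurableSet)
    (fun i j hij ω hω => T.conn_antitone v hij hω) ⟨0, measure_ne_top _ _⟩
  have h2 := (ENNReal.tendsto_toReal (measure_ne_top P _)).comp h1
  have e : ⋂ n, {ω | S ω ∈ T.conn n v} = {ω | S ω ∈ T.perc v} := by ext; simp [perc]
  rw [e] at h2
  refine tendsto_nhds_unique h2 ((tendsto_surv hp01 _).congr fun n => ?_)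
  exact (T.real_conn hle hm hS hp n v).symm

lemma real_link (hp01 : ∀ n ≥ 1, 0 ≤ p n ∧ p n ≤ 1) {v : V} (hv : v ≠ T.root) :
    P.real {ω | S ω ∈ T.link v} = linkProb d p (T.lev (T.par v)) := by
  have e : {ω | S ω ∈ T.link v} = {ω | v ∈ S ω} ∩ {ω | S ω ∈ T.perc v} := rfl
  rw [e, real_inter_of_disjoint hle hm (T.disjoint_singleton_sdesc v)
    (le_blk (Set.mem_singleton v) _ (hS v)) (T.measurableSet_blk_perc hS v), hp,
    T.real_perc hle hm hS hp hp01, linkProb, T.lev_par hv]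

lemma real_noSib (hp01 : ∀ n ≥ 1, 0 ≤ p n ∧ p n ≤ 1) {w : V} (hw : w ≠ T.root) :
    P.real {ω | S ω ∈ T.noSib w} =
      (1 - linkProb d p (T.lev (T.par w))) ^ (d (T.lev (T.par w)) - 1) := by
  classical
  have := hm.isProbabilityMeasure
  have e : {ω | S ω ∈ T.noSib w} = ⋂ c ∈ (T.ch (T.par w)).erase w, {ω | S ω ∈ T.link c}ᶜ := by
    ext ω; simp [noSib]; tauto
  have hmem : w ∈ T.ch (T.par w) := T.mem_ch.2 ⟨hw, rfl⟩
  rw [e, real_biInter_of_disjoint hle hm _ T.desc ((T.pairwiseDisjoint_desc (T.par w)).subset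
        (Finset.coe_subset.2 (Finset.erase_subset _ _))) _
        (fun c _ => (T.measurableSet_blk_link hS c).compl),
      Finset.prod_congr rfl (g := fun _ => 1 - linkProb d p (T.lev (T.par w))), Finset.prod_const,
      Finset.card_erase_of_mem hmem, T.card_ch]
  intro c hc
  obtain ⟨h1, h2⟩ := T.mem_ch.1 (Finset.mem_of_mem_erase hc)
  rw [probReal_compl_eq_one_sub (blk_le hle _ _ (T.measurableSet_blk_link hS c)),
    T.real_link hle hm hS hp hp01 h1, h2]

/-- The probability that some sibling of `w` is linked to infinity. -/
lemma real_noSib_compl_le (hp01 : ∀ n ≥ 1, 0 ≤ p n ∧ p n ≤ 1) (w : V) :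
    P.real {ω | S ω ∈ T.noSib w}ᶜ ≤ d (T.lev (T.par w)) * linkProb d p (T.lev (T.par w)) := by
  have := hm.isProbabilityMeasure
  have h1 : {ω | S ω ∈ T.noSib w}ᶜ ⊆ ⋃ c ∈ T.ch (T.par w), {ω | S ω ∈ T.link c} := by
    intro ω hω
    simp only [noSib, Set.mem_compl_iff, Set.mem_ofPred_eq, not_forall, not_not] at hω
    obtain ⟨c, hc, _, hl⟩ := hω
    exact Set.mem_biUnion hc hl
  refine (measureReal_mono h1 (measure_ne_top _ _)).trans ((measureReal_biUnion_finset_le _ _).trans (le_of_eq ?_))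
  rw [Finset.sum_congr rfl (g := fun _ => linkProb d p (T.lev (T.par w))), Finset.sum_const,
    T.card_ch, nsmul_eq_mul]
  intro c hc
  obtain ⟨h2, h3⟩ := T.mem_ch.1 hc
  rw [T.real_link hle hm hS hp hp01 h2, h3]

omit hS hp in
/-- Independence along the path to `v`: events attached to the subtrees hanging off the path, to the
vertices of the path, and to the subtree below `v`. -/
lemma spine {v : V} {N O : ℕ → Set Ω} {C : Set Ω} {k : ℕ} (hk : k ≤ T.lev v)
    (hN : ∀ j, k ≤ j → j < T.lev v → MeasurableSet[blk m (T.sibDesc (T.anc v (j + 1)))] (N j))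
    (hO : ∀ j, k ≤ j → j < T.lev v → MeasurableSet[m (T.anc v j)] (O j))
    (hC : MeasurableSet[blk m (T.sdesc v)] C) :
    MeasurableSet[blk m (T.desc (T.anc v k))] (C ∩ ⋂ j ∈ Finset.Ico k (T.lev v), (N j ∩ O j)) ∧
    P.real (C ∩ ⋂ j ∈ Finset.Ico k (T.lev v), (N j ∩ O j)) =
      P.real C * ∏ j ∈ Finset.Ico k (T.lev v), (P.real (N j) * P.real (O j)) := by
  classical
  have := hm.isProbabilityMeasure
  suffices H : MeasurableSet[blk m (T.desc (T.anc v k) \ {v})]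
      (C ∩ ⋂ j ∈ Finset.Ico k (T.lev v), (N j ∩ O j)) ∧
    P.real (C ∩ ⋂ j ∈ Finset.Ico k (T.lev v), (N j ∩ O j)) =
      P.real C * ∏ j ∈ Finset.Ico k (T.lev v), (P.real (N j) * P.real (O j)) from
    ⟨blk_mono Set.sdiff_subset _ H.1, H.2⟩
  obtain ⟨i, hi⟩ : ∃ i, T.lev v - k = i := ⟨_, rfl⟩
  induction i generalizing k with
  | zero =>
    have : k = T.lev v := by omega
    subst this
    rw [Finset.Ico_self, Finset.prod_empty, mul_one, T.anc_lev]
    simp only [Finset.notMem_empty, Set.iInter_of_empty, Set.iInter_univ, Set.inter_univ, and_true]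
    exact hC
  | succ i ih =>
    have hk' : k < T.lev v := by omega
    obtain ⟨h1, h2⟩ := ih (k := k + 1) hk' (fun j hj => hN j (by omega))
      (fun j hj => hO j (by omega)) (by omega)
    have e : Finset.Ico k (T.lev v) = insert k (Finset.Ico (k + 1) (T.lev v)) := by
      ext j; simp; omega
    have hkn : k ∉ Finset.Ico (k + 1) (T.lev v) := by simp
    rw [e, Finset.set_biInter_insert, Finset.prod_insert hkn]
    have hne := T.anc_ne_root (v := v) (j := k + 1) hk' (by omega)
    have hsib : T.sibDesc (T.anc v (k + 1)) ⊆
        T.sdesc (T.anc v k) \ T.desc (T.anc v (k + 1)) := by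
      have := T.sibDesc_subset hne
      rwa [T.par_anc_succ hk'] at this
    have hdd : T.desc (T.anc v (k + 1)) ⊆ T.sdesc (T.anc v k) := fun y hy =>
      T.mem_sdesc_iff.2 ⟨_, T.anc_mem_ch hk', hy⟩
    have hvd : v ∈ T.desc (T.anc v (k + 1)) := T.mem_desc_anc hk'
    have hkv : T.anc v k ≠ v := fun h => by
      have := T.lev_anc hk'.le
      rw [h] at this; omega
    have hNk := hN k le_rfl hk'
    have hOk := hO k le_rfl hk'
    have hOk' : MeasurableSet[blk m {T.anc v k}] (O k) := le_blk (Set.mem_singleton _) _ hOk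
    set R := C ∩ ⋂ j ∈ Finset.Ico (k + 1) (T.lev v), (N j ∩ O j)
    have er : C ∩ (N k ∩ O k ∩ ⋂ j ∈ Finset.Ico (k + 1) (T.lev v), (N j ∩ O j)) =
        (N k ∩ O k) ∩ R := by
      ext ω; simp only [R, Set.mem_inter_iff]; tauto
    -- The new factors live on the subtrees hanging off at level k + 1 and on the ancestor at level
    -- k. These are disjoint from each other and from the block already treated, which lies below
    -- the ancestor at level k + 1.
    have hsub : T.sibDesc (T.anc v (k + 1)) ∪ {T.anc v k} ⊆ T.desc (T.anc v k) \ {v} := by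
      rintro y (hy | rfl)
      · refine ⟨(hsib hy).1.1, ?_⟩
        rintro rfl
        exact (hsib hy).2 hvd
      · exact ⟨T.self_mem_desc _, hkv⟩
    have hNO : MeasurableSet[blk m (T.sibDesc (T.anc v (k + 1)) ∪ {T.anc v k})] (N k ∩ O k) :=
      MeasurableSet.inter (blk_mono Set.subset_union_left _ hNk)
        (blk_mono Set.subset_union_right _ hOk')
    rw [er]
    constructor
    · refine MeasurableSet.inter (blk_mono hsub _ hNO) (blk_mono ?_ _ h1)
      exact Set.sdiff_subset_sdiff_left (hdd.trans Set.sdiff_subset)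
    · rw [real_inter_of_disjoint hle hm ?_ hNO h1, h2,
        real_inter_of_disjoint hle hm ?_ hNk hOk']
      · ring
      · rw [Set.disjoint_singleton_right]
        exact fun h => (hsib h).1.2 rfl
      · refine Set.disjoint_left.2 ?_
        rintro y (hy | rfl) hy'
        · exact (hsib hy).2 hy'.1
        · exact (hdd hy'.1).2 rfl

/-- Probability that all vertices of levels `1, …, n - 1` on a given path are open. -/
lemma real_pivot (hp01 : ∀ n ≥ 1, 0 ≤ p n ∧ p n ≤ 1) (v : V) :
    P.real {ω | S ω ∈ T.pivot v} =
      survLim d p (T.lev v) * (isoProb d p (T.lev v) * ∏ j ∈ Finset.range (T.lev v), p j) := by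
  have h := (T.spine hle hm (v := v) (k := 0) (Nat.zero_le _)
    (N := fun j => {ω | S ω ∈ T.noSib (T.anc v (j + 1))}) (O := fun j => {ω | T.anc v j ∈ S ω})
    (fun j _ _ => T.measurableSet_blk_noSib hS _) (fun j _ _ => hS _)
    (T.measurableSet_blk_perc hS v)).2
  have e : {ω | S ω ∈ T.pivot v} = {ω | S ω ∈ T.perc v} ∩ ⋂ j ∈ Finset.Ico 0 (T.lev v),
      ({ω | S ω ∈ T.noSib (T.anc v (j + 1))} ∩ {ω | T.anc v j ∈ S ω}) := by
    ext ω; simp [pivot]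
  rw [e, h, T.real_perc hle hm hS hp hp01, isoProb, ← Finset.prod_mul_distrib,
    Finset.range_eq_Ico]
  congr 1
  refine Finset.prod_congr rfl fun j hj => ?_
  have hj' : j < T.lev v := (Finset.mem_Ico.1 hj).2
  rw [T.real_noSib hle hm hS hp hp01 (T.anc_ne_root hj' (by omega)), hp, T.par_anc_succ hj',
    T.lev_anc hj'.le]

end RootedTree

end Static

/-- Probability of `RootedTree.pivot v` for a vertex `v` at level `n`. -/
noncomputable def pivotProb (d : ℕ → ℕ) (p : ℕ → ℝ) (n : ℕ) : ℝ :=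
  survLim d p n * (isoProb d p n * ∏ j ∈ Finset.range n, p j)

/-! ### Two edges pivotal in two configurations: structural events and probability bounds. -/

section PairBounds

namespace RootedTree

variable {V : Type*} {d : ℕ → ℕ} (T : RootedTree V d)

/-- An event containing the event that `anc v i` is pivotal in the first configuration, `v` is
pivotal in the second one, and the path to infinity in the first configuration leaves the path to
`v` at level `r`. It does not depend on the status of `anc v i` and `v`. -/
def leaveEvent (v : V) (i r : ℕ) : Set (Set V × Set V) :=
  {z | z.2 ∈ T.perc v ∧ ∀ j < T.lev v,
    (if j = r then z.1 ∉ T.noSib (T.anc v (j + 1)) else z.2 ∈ T.noSib (T.anc v (j + 1))) ∧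
    (j ≠ i → T.anc v j ∈ z.2 ∧ (j ≤ r → T.anc v j ∈ z.1))}

/-- An event containing the event that `u` is pivotal in the first configuration and `v` in the
second one, when the paths to `u` and `v` separate after level `k`. It does not depend on the
status of `u` and `v`. -/
def meetEvent (u v : V) (k : ℕ) : Set (Set V × Set V) :=
  {z | (z.1 ∈ T.perc u ∧ ∀ j < T.lev u, k < j → z.1 ∈ T.noSib (T.anc u (j + 1)) ∧ T.anc u j ∈ z.1) ∧
    z.2 ∈ T.perc v ∧ ∀ j < T.lev v, (j ≠ k → z.2 ∈ T.noSib (T.anc v (j + 1))) ∧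
      T.anc v j ∈ z.2 ∧ (j ≤ k → T.anc v j ∈ z.1)}

lemma measurableSet_leaveEvent (v : V) (i r : ℕ) : MeasurableSet (T.leaveEvent v i r) := by
  have h1 := fun w => measurableSet_setOfPred.1 (T.measurableSet_noSib w)
  have h2 : ∀ w, Measurable fun z : Set V × Set V => w ∈ z.1 := fun w =>
    (measurable_set_mem w).comp measurable_fst
  have h3 : ∀ w, Measurable fun z : Set V × Set V => w ∈ z.2 := fun w =>
    (measurable_set_mem w).comp measurable_snd
  refine (measurable_snd (T.measurableSet_perc v)).inter (measurableSet_setOfPred.2 ?_)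
  refine Measurable.forall fun j => Measurable.forall fun _ => Measurable.and ?_
    (Measurable.forall fun _ => (h3 _).and (Measurable.forall fun _ => h2 _))
  split_ifs
  · exact ((h1 _).comp measurable_fst).not
  · exact (h1 _).comp measurable_snd

lemma measurableSet_meetEvent (u v : V) (k : ℕ) : MeasurableSet (T.meetEvent u v k) := by
  have h1 := fun w => measurableSet_setOfPred.1 (T.measurableSet_noSib w)
  have h2 : ∀ w, Measurable fun z : Set V × Set V => w ∈ z.1 := fun w =>
    (measurable_set_mem w).comp measurable_fst
  have h3 : ∀ w, Measurable fun z : Set V × Set V => w ∈ z.2 := fun w =>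
    (measurable_set_mem w).comp measurable_snd
  refine ((measurable_fst (T.measurableSet_perc u)).inter (measurableSet_setOfPred.2 ?_)).inter
    ((measurable_snd (T.measurableSet_perc v)).inter (measurableSet_setOfPred.2 ?_))
  · exact Measurable.forall fun j => Measurable.forall fun _ => Measurable.forall fun _ =>
      ((h1 _).comp measurable_fst).and (h2 _)
  · exact Measurable.forall fun j => Measurable.forall fun _ =>
      (Measurable.forall fun _ => (h1 _).comp measurable_snd).and
        ((h3 _).and (Measurable.forall fun _ => h2 _))

lemma anc_ne_of_lt {v : V} {i j : ℕ} (hj : j < T.lev v) (hi : i ≤ T.lev v) (hij : j ≠ i) :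
    T.anc v j ≠ T.anc v i := fun h => hij (by rw [← T.lev_anc hj.le, h, T.lev_anc hi])

lemma not_mem_sibDesc_of_anc {v : V} {j i : ℕ} (hj : j < T.lev v) (hi : i ≤ T.lev v) :
    T.anc v i ∉ T.sibDesc (T.anc v (j + 1)) := by
  intro h
  have h1 := T.sibDesc_subset (T.anc_ne_root hj (by omega)) h
  rw [T.par_anc_succ hj] at h1
  have h2 := T.lev_lt_of_mem_sdesc h1.1
  rw [T.lev_anc hj.le, T.lev_anc hi] at h2
  refine h1.2 ⟨?_, ?_⟩
  · rw [T.lev_anc hi, T.lev_anc hj]; exact h2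
  · rw [T.lev_anc hj, T.anc_anc h2 hi]

/-- Needed to condition on the switching times of both edges: the enlarged event must not see either
of their states. This is why the requirement at level i was dropped from `leaveEvent`. -/
lemma leaveEvent_congr {v : V} {i r : ℕ} (hi : i < T.lev v) {z z' : Set V × Set V}
    (h1 : ∀ y, y ≠ T.anc v i → y ≠ v → (y ∈ z.1 ↔ y ∈ z'.1))
    (h2 : ∀ y, y ≠ T.anc v i → y ≠ v → (y ∈ z.2 ↔ y ∈ z'.2)) :
    z ∈ T.leaveEvent v i r ↔ z' ∈ T.leaveEvent v i r := by
  have hsib : ∀ j < T.lev v, ∀ y ∈ T.sibDesc (T.anc v (j + 1)), y ≠ T.anc v i ∧ y ≠ v := by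
    intro j hj y hy
    refine ⟨?_, ?_⟩
    · rintro rfl; exact T.not_mem_sibDesc_of_anc hj hi.le hy
    · rintro rfl
      have := T.not_mem_sibDesc_of_anc hj le_rfl
      rw [T.anc_lev] at this
      exact this hy
  have hanc : ∀ j < T.lev v, j ≠ i → T.anc v j ≠ T.anc v i ∧ T.anc v j ≠ v := by
    intro j hj hji
    refine ⟨T.anc_ne_of_lt hj hi.le hji, ?_⟩
    have := T.anc_ne_of_lt hj le_rfl hj.ne
    rwa [T.anc_lev] at this
  refine and_congr (T.perc_congr fun y hy => h2 y ?_ hy.2) (forall_congr' fun j =>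
    forall_congr' fun hj => and_congr ?_ (forall_congr' fun hji => and_congr
      (h2 _ (hanc j hj hji).1 (hanc j hj hji).2)
      (forall_congr' fun _ => h1 _ (hanc j hj hji).1 (hanc j hj hji).2)))
  · rintro rfl
    have := T.lev_lt_of_mem_sdesc hy
    rw [T.lev_anc hi.le] at this
    omega
  · split_ifs
    · exact not_congr (T.noSib_congr fun y hy => h1 y (hsib j hj y hy).1 (hsib j hj y hy).2)
    · exact T.noSib_congr fun y hy => h2 y (hsib j hj y hy).1 (hsib j hj y hy).2

/-- Same role as `leaveEvent_congr`. In the second configuration the condition on siblings at the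
branching level is omitted, as that subtree contains u; in the first one only the part strictly
below the branching is constrained, apart from the common path. -/
lemma meetEvent_congr {u v : V} {k : ℕ} (hku : k < T.lev u) (hkv : k < T.lev v)
    (hk : T.anc u k = T.anc v k) (hk1 : T.anc u (k + 1) ≠ T.anc v (k + 1)) {z z' : Set V × Set V}
    (h1 : ∀ y, y ≠ u → y ≠ v → (y ∈ z.1 ↔ y ∈ z'.1))
    (h2 : ∀ y, y ≠ u → y ≠ v → (y ∈ z.2 ↔ y ∈ z'.2)) :
    z ∈ T.meetEvent u v k ↔ z' ∈ T.meetEvent u v k := by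
  have hdis : ∀ {a b : V}, k < T.lev a → k < T.lev b → T.anc a (k + 1) ≠ T.anc b (k + 1) →
      ∀ y ∈ T.desc (T.anc a (k + 1)), y ≠ b := by
    rintro a b hka hkb hab y hy rfl
    refine hab (T.eq_of_mem_desc ?_ hy (T.mem_desc_anc hkb))
    rw [T.lev_anc hka, T.lev_anc hkb]
  have hself : ∀ {a : V} {j : ℕ}, j < T.lev a → T.anc a j ≠ a := fun {a j} hj => by
    have := T.anc_ne_of_lt hj le_rfl hj.ne
    rwa [T.anc_lev] at this
  have hsibself : ∀ {a : V} {j : ℕ}, j < T.lev a → ∀ y ∈ T.sibDesc (T.anc a (j + 1)), y ≠ a := by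
    rintro a j hj y hy rfl
    have := T.not_mem_sibDesc_of_anc hj le_rfl
    rw [T.anc_lev] at this
    exact this hy
  have hanc : ∀ {a : V} {j : ℕ}, k < j → j ≤ T.lev a → T.anc a j ∈ T.desc (T.anc a (k + 1)) := by
    intro a j hkj hj
    have := T.mem_desc_anc (v := T.anc a j) (j := k + 1) (by rw [T.lev_anc hj]; exact hkj)
    rwa [T.anc_anc hkj hj] at this
  have hsib : ∀ {a : V} {j : ℕ}, k < j → j < T.lev a → ∀ y ∈ T.sibDesc (T.anc a (j + 1)),
      y ∈ T.desc (T.anc a (k + 1)) := by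
    intro a j hkj hj y hy
    have h3 := (T.sibDesc_subset (T.anc_ne_root hj (by omega)) hy).1.1
    rw [T.par_anc_succ hj] at h3
    exact T.desc_trans h3 (hanc hkj hj.le)
  have hperc : ∀ {a : V}, k < T.lev a → ∀ y ∈ T.sdesc a, y ∈ T.desc (T.anc a (k + 1)) :=
    fun {a} ha y hy => T.desc_trans hy.1 (T.mem_desc_anc ha)
  refine and_congr (and_congr (T.perc_congr fun y hy => h1 y hy.2 (hdis hku hkv hk1 y
    (hperc hku y hy))) (forall_congr' fun j => forall_congr' fun hj => forall_congr' fun hkj =>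
      and_congr (T.noSib_congr fun y hy => h1 y (hsibself hj y hy)
        (hdis hku hkv hk1 y (hsib hkj hj y hy))) (h1 _ (hself hj)
          (hdis hku hkv hk1 _ (hanc hkj hj.le)))))
    (and_congr (T.perc_congr fun y hy => h2 y (hdis hkv hku hk1.symm y
    (hperc hkv y hy)) hy.2) (forall_congr' fun j => forall_congr' fun hj =>
      and_congr (forall_congr' fun hjk => T.noSib_congr fun y hy => h2 y ?_ (hsibself hj y hy)) ?_))
  · rcases lt_or_gt_of_ne hjk with h3 | h3
    · rintro rfl
      have h4 : T.anc v (j + 1) = T.anc y (j + 1) := by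
        rw [← T.anc_anc (show j + 1 ≤ k from h3) hkv.le, ← hk, T.anc_anc h3 hku.le]
      rw [h4] at hy
      exact hsibself (by omega) y hy rfl
    · exact hdis hkv hku hk1.symm y (hsib h3 hj y hy)
  · have h3 : T.anc v j ≠ u := by
      rcases le_or_gt j k with h3 | h3
      · rw [← T.anc_anc h3 hkv.le, ← hk, T.anc_anc h3 hku.le]
        exact hself (by omega)
      · exact hdis hkv hku hk1.symm _ (hanc h3 hj.le)
    exact and_congr (h2 _ h3 (hself hj)) (forall_congr' fun _ => h1 _ h3 (hself hj))

lemma mem_meetEvent {u v : V} {k : ℕ} (hku : k < T.lev u) (hkv : k < T.lev v)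
    (hk : T.anc u k = T.anc v k) {S S' : Set V} (h1 : S ∈ T.pivot u) (h2 : S' ∈ T.pivot v) :
    (S, S') ∈ T.meetEvent u v k := by
  refine ⟨⟨h1.1, fun j hj _ => h1.2 j hj⟩, h2.1, fun j hj => ⟨fun _ => (h2.2 j hj).1,
    (h2.2 j hj).2, fun hjk => ?_⟩⟩
  have h5 := (h1.2 j (by omega)).2
  rw [← T.anc_anc hjk hku.le, hk, T.anc_anc hjk hkv.le] at h5
  exact h5

/-- Follow an infinite path in the first configuration downwards from the ancestor at level i.
Either it leaves the path to v at some level r through a sibling linked to infinity, or it reaches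
v; the latter case is encoded by r = `T.lev v`, for which no sibling condition is imposed. -/
lemma exists_level_of_pivot_of_pivot {v : V} {i : ℕ} (hi : i < T.lev v) {S S' : Set V}
    (hu : S ∈ T.pivot (T.anc v i)) (hv : S' ∈ T.pivot v) :
    ∃ r ∈ Finset.Icc i (T.lev v), (S, S') ∈ T.leaveEvent v i r := by
  have hlow : ∀ j < i, T.anc v j ∈ S := fun j hj => by
    have := (hu.2 j (by rwa [T.lev_anc hi.le])).2
    rwa [T.anc_anc hj.le hi.le] at this
  -- Induction on the number s of levels followed below level i: either the path has already left,
  -- or it is still on the path to v with all intermediate vertices open.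
  have key : ∀ s, i + s ≤ T.lev v →
      (∃ r, i ≤ r ∧ r < i + s ∧ S ∉ T.noSib (T.anc v (r + 1)) ∧
        ∀ j, i < j → j ≤ r → T.anc v j ∈ S) ∨
      (S ∈ T.perc (T.anc v (i + s)) ∧ ∀ j, i < j → j ≤ i + s → T.anc v j ∈ S) := by
    intro s
    induction s with
    | zero => exact fun _ => Or.inr ⟨hu.1, fun j h1 h2 => by omega⟩
    | succ s ih =>
      intro hs
      rcases ih (by omega) with ⟨r, h1, h2, h3, h4⟩ | ⟨h1, h2⟩
      · exact Or.inl ⟨r, h1, by omega, h3, h4⟩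
      · obtain ⟨c, hc, hl⟩ := T.perc_iff.1 h1
        by_cases hcv : c = T.anc v (i + s + 1)
        · subst hcv
          refine Or.inr ⟨hl.2, fun j h3 h4 => ?_⟩
          rcases (show j ≤ i + s ∨ j = i + s + 1 by omega) with h5 | rfl
          · exact h2 j h3 h5
          · exact hl.1
        · refine Or.inl ⟨i + s, by omega, by omega, fun h => ?_, h2⟩
          refine h c ?_ hcv hl
          rwa [T.par_anc_succ (by omega)]
  have hfin : ∀ r, i ≤ r → r ≤ T.lev v → (∀ j < T.lev v, j = r → S ∉ T.noSib (T.anc v (j + 1))) →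
      (∀ j, i < j → j ≤ r → T.anc v j ∈ S) →
      ∃ r ∈ Finset.Icc i (T.lev v), (S, S') ∈ T.leaveEvent v i r := by
    intro r h1 h2 h3 h4
    refine ⟨r, Finset.mem_Icc.2 ⟨h1, h2⟩, hv.1, fun j hj => ⟨?_, fun hji => ⟨(hv.2 j hj).2,
      fun hjr => ?_⟩⟩⟩
    · split_ifs with h
      · exact h3 j hj h
      · exact (hv.2 j hj).1
    · rcases lt_or_gt_of_ne hji with h | h
      · exact hlow j h
      · exact h4 j h hjr
  rcases key (T.lev v - i) (by omega) with ⟨r, h1, h2, h3, h4⟩ | ⟨_, h2⟩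
  · exact hfin r h1 (by omega) (fun j _ hj => hj ▸ h3) h4
  · exact hfin (T.lev v) hi.le le_rfl (fun j h1 h2 => absurd h2 h1.ne) fun j h3 h4 =>
      h2 j h3 (by omega)

end RootedTree

namespace GoodParams

variable {d : ℕ → ℕ} {p : ℕ → ℝ} {ε : ℝ} {D : ℕ} (h : GoodParams d p ε D)
include h

lemma isoProb_pos (n : ℕ) : 0 < isoProb d p n :=
  Finset.prod_pos fun j _ => pow_pos (by linarith [h.linkProb_le j, h.eps_pos]) _

/-- A single factor of `isoProb` is bounded below, so the factor at a branching level can be removed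
or restored at the cost of a constant. -/
lemma pow_le_iso_factor (j : ℕ) : ε ^ D ≤ (1 - linkProb d p j) ^ (d j - 1) := by
  calc ε ^ D ≤ ε ^ (d j - 1) :=
        pow_le_pow_of_le_one h.eps_pos.le h.eps_lt_one.le (by have := h.deg_le j; omega)
    _ ≤ _ := pow_le_pow_left₀ h.eps_pos.le (by linarith [h.linkProb_le j]) _

end GoodParams

namespace RootedTree

variable {V Ω : Type*} {d : ℕ → ℕ} (T : RootedTree V d)
  {mΩ : MeasurableSpace Ω} {P : Measure Ω} {m : V → MeasurableSpace Ω}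
  {p : ℕ → ℝ} {ε : ℝ} {D : ℕ} {S S' : Ω → Set V} {ρ : ℝ}
  -- The σ-algebra attached to a vertex may carry its whole path in time. Both configurations are
  -- adapted to the same independent family, so events about two times factor over vertices just as
  -- static events do.
  (h : GoodParams d p ε D) (hp0 : p 0 = 1) (hle : ∀ v, m v ≤ mΩ) (hm : iIndep m P)
  (hS : Adapted m S) (hS' : Adapted m S')
  (hp : ∀ v, P.real {ω | v ∈ S ω} = p (T.lev v)) (hp' : ∀ v, P.real {ω | v ∈ S' ω} = p (T.lev v))
  (hρ : 0 ≤ ρ) (hρ1 : ρ ≤ 1)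
  (hpp : ∀ v ≠ T.root, P.real {ω | v ∈ S ω ∧ v ∈ S' ω} ≤ p (T.lev v) * ρ)
include h hp0 hle hm hS hS' hp hp' hρ hρ1 hpp

/-- Compared with the pivot probability of v alone, two things change: at level r the sibling
condition is replaced by its failure in the first configuration, costing a constant times
`linkProb`, and each vertex above or at level r must be open twice, costing a factor ρ. -/
lemma real_leaveEvent_le {v : V} {i r : ℕ} (hi0 : 1 ≤ i) (hr : i ≤ r) :
    P.real {ω | (S ω, S' ω) ∈ T.leaveEvent v i r} ≤
    pivotProb d p (T.lev v) * ((1 / ε) * (if r < T.lev v then D / ε ^ D * linkProb d p r else 1) *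
      ρ ^ (min r (T.lev v - 1) - 1)) := by
  classical
  have := hm.isProbabilityMeasure
  set n := T.lev v with hn
  set N : ℕ → Set Ω := fun j => if j = r then {ω | S ω ∈ T.noSib (T.anc v (j + 1))}ᶜ else
    {ω | S' ω ∈ T.noSib (T.anc v (j + 1))} with hN
  -- Nothing is required at level i, so the factor p_i present in `pivotProb` has to be restored at
  -- a cost of at most 1/ε.
  set O : ℕ → Set Ω := fun j => if j = i then Set.univ else if j ≤ r then
    {ω | T.anc v j ∈ S ω ∧ T.anc v j ∈ S' ω} else {ω | T.anc v j ∈ S' ω} with hO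
  have hspine := (T.spine hle hm (v := v) (k := 0) (Nat.zero_le _) (N := N) (O := O)
    (fun j _ _ => by
      simp only [hN]; split_ifs
      · exact (T.measurableSet_blk_noSib hS _).compl
      · exact T.measurableSet_blk_noSib hS' _)
    (fun j _ _ => by
      simp only [hO]; split_ifs
      · exact MeasurableSet.univ
      · exact MeasurableSet.inter (hS _) (hS' _)
      · exact hS' _)
    (T.measurableSet_blk_perc hS' v)).2
  have hsub : {ω | (S ω, S' ω) ∈ T.leaveEvent v i r} ⊆
      {ω | S' ω ∈ T.perc v} ∩ ⋂ j ∈ Finset.Ico 0 n, (N j ∩ O j) := by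
    rintro ω ⟨h1, h2⟩
    refine ⟨h1, Set.mem_iInter₂.2 fun j hj => ?_⟩
    obtain ⟨h3, h4⟩ := h2 j (Finset.mem_Ico.1 hj).2
    constructor
    · simp only [hN]
      split_ifs with hjr
      · simpa [hjr] using h3
      · simpa [hjr] using h3
    · simp only [hO]
      split_ifs with hji hjr
      · trivial
      · exact ⟨(h4 hji).2 hjr, (h4 hji).1⟩
      · exact (h4 hji).1
  refine (measureReal_mono hsub).trans ?_
  rw [hspine, T.real_perc hle hm hS' hp' h.prob_nonneg]
  have hε := h.eps_pos
  have hPN : ∀ j ∈ Finset.Ico 0 n, P.real (N j) ≤ (1 - linkProb d p j) ^ (d j - 1) *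
      (if j = r then D / ε ^ D * linkProb d p r else 1) := by
    intro j hj
    have hj' := (Finset.mem_Ico.1 hj).2
    simp only [hN]
    split_ifs with hjr
    · subst hjr
      refine (T.real_noSib_compl_le hle hm hS hp h.prob_nonneg _).trans ?_
      rw [T.par_anc_succ hj', T.lev_anc hj'.le]
      have h1 := h.pow_le_iso_factor j
      have h2 := h.linkProb_pos j
      have h3 : (d j : ℝ) ≤ D := by exact_mod_cast h.deg_le j
      calc (d j : ℝ) * linkProb d p j ≤ D * linkProb d p j := by gcongr
        _ = ε ^ D * (D / ε ^ D * linkProb d p j) := by field_simp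
        _ ≤ _ := by gcongr
    · rw [T.real_noSib hle hm hS' hp' h.prob_nonneg (T.anc_ne_root hj' (by omega)),
        T.par_anc_succ hj', T.lev_anc hj'.le, mul_one]
  have hpj : ∀ j, 0 < p j := fun j => by
    rcases Nat.eq_zero_or_pos j with rfl | hj
    · rw [hp0]; exact one_pos
    · exact (h.prob_pos j hj).1
  have hPO : ∀ j ∈ Finset.Ico 0 n, P.real (O j) ≤ p j *
      ((if j = i then 1 / ε else 1) * (if j ∈ (Finset.Icc 1 r).erase i then ρ else 1)) := by
    intro j hj
    have hj' := (Finset.mem_Ico.1 hj).2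
    simp only [hO]
    split_ifs with h1 h2 h3 h4 h5
    · simp [h1] at h2
    · subst h1
      rw [probReal_univ, mul_one, mul_one_div, one_le_div hε]
      exact (h.prob j hi0).1
    · rw [one_mul]
      have := hpp _ (T.anc_ne_root hj'.le (by simp at h4; omega))
      rwa [T.lev_anc hj'.le] at this
    · have : j = 0 := by simp at h4; omega
      refine measureReal_le_one.trans ?_
      rw [this, hp0]; simp
    · simp at h5; omega
    · rw [hp', T.lev_anc hj'.le]; simp
  have hmul : ∏ j ∈ Finset.Ico 0 n, (P.real (N j) * P.real (O j)) ≤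
      ∏ j ∈ Finset.Ico 0 n, (((1 - linkProb d p j) ^ (d j - 1) *
      (if j = r then D / ε ^ D * linkProb d p r else 1)) * (p j *
      ((if j = i then 1 / ε else 1) * (if j ∈ (Finset.Icc 1 r).erase i then ρ else 1)))) :=
    Finset.prod_le_prod (fun j _ => by positivity) fun j hj =>
      mul_le_mul (hPN j hj) (hPO j hj) measureReal_nonneg ((measureReal_nonneg).trans (hPN j hj))
  have hq := (survLim_mem (d := d) h.prob_nonneg n).1
  refine (mul_le_mul_of_nonneg_left hmul hq).trans ?_
  simp only [Finset.prod_mul_distrib]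
  rw [← Finset.range_eq_Ico, ← isoProb, pivotProb, Finset.prod_ite_eq', Finset.prod_ite_eq',
    Finset.prod_ite, Finset.prod_const, Finset.prod_const_one, mul_one]
  -- The factors ρ come from the levels 1, …, min(r, n - 1) with i removed: the root is always open
  -- and v itself, at level n, is not constrained.
  have hcard : min r (n - 1) - 1 ≤
      (Finset.filter (fun j => j ∈ (Finset.Icc 1 r).erase i) (Finset.range n)).card := by
    have h1 : (Finset.Icc 1 (min r (n - 1))).erase i ⊆
        Finset.filter (fun j => j ∈ (Finset.Icc 1 r).erase i) (Finset.range n) := by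
      intro j hj; simp at hj ⊢; omega
    refine le_trans ?_ (Finset.card_le_card h1)
    refine le_trans ?_ (Finset.pred_card_le_card_erase)
    simp
  have hpow := pow_le_pow_of_le_one hρ hρ1 hcard
  have h1ε : 1 ≤ 1 / ε := by rw [one_le_div hε]; exact h.eps_lt_one.le
  have hite : (if i ∈ Finset.range n then 1 / ε else 1) ≤ 1 / ε := by
    split_ifs <;> first | exact le_rfl | exact h1ε
  have hA : 0 ≤ (if r < n then D / ε ^ D * linkProb d p r else 1) := by
    have := h.linkProb_pos r
    split_ifs <;> positivity
  have hI := h.isoProb_pos n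
  have hPP : 0 ≤ ∏ j ∈ Finset.range n, p j := Finset.prod_nonneg fun j _ => (hpj j).le
  simp only [Finset.mem_range] at hite ⊢
  have hite0 : 0 ≤ (if i < n then 1 / ε else 1) := by split_ifs <;> positivity
  calc _ = survLim d p n * (isoProb d p n * ∏ j ∈ Finset.range n, p j) *
        ((if i < n then 1 / ε else 1) * (if r < n then D / ε ^ D * linkProb d p r else 1) *
        ρ ^ (Finset.filter (fun j => j ∈ (Finset.Icc 1 r).erase i) (Finset.range n)).card) := by
        ring
    _ ≤ _ := by gcongr

-- The part of the event concerning u lies in a sibling subtree of the path to v, so it can take the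
-- place of the sibling condition at level k in the factorisation along that path. The k common
-- non-root vertices are open twice, which gives ρ^k; the common path is counted once, hence the
-- division.
omit hρ1 in
lemma real_meetEvent_le {u v : V} {k : ℕ} (hku : k < T.lev u) (hkv : k < T.lev v)
    (hk : T.anc u k = T.anc v k) (hk1 : T.anc u (k + 1) ≠ T.anc v (k + 1)) :
    P.real {ω | (S ω, S' ω) ∈ T.meetEvent u v k} ≤
    (1 / ε ^ D) ^ 2 * pivotProb d p (T.lev u) * pivotProb d p (T.lev v) * ρ ^ k /
      (isoProb d p k * ∏ j ∈ Finset.range (k + 1), p j) := by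
  classical
  have := hm.isProbabilityMeasure
  have hε := h.eps_pos
  have hpj : ∀ j, 0 < p j := fun j => by
    rcases Nat.eq_zero_or_pos j with rfl | hj
    · rw [hp0]; exact one_pos
    · exact (h.prob_pos j hj).1
  set n := T.lev v with hn
  set B : Set Ω := {ω | S ω ∈ T.perc u} ∩ ⋂ j ∈ Finset.Ico (k + 1) (T.lev u),
      ({ω | S ω ∈ T.noSib (T.anc u (j + 1))} ∩ {ω | T.anc u j ∈ S ω}) with hB
  obtain ⟨hBm, hBp⟩ := T.spine hle hm (v := u) (k := k + 1) hku
    (N := fun j => {ω | S ω ∈ T.noSib (T.anc u (j + 1))}) (O := fun j => {ω | T.anc u j ∈ S ω})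
    (fun j _ _ => T.measurableSet_blk_noSib hS _) (fun j _ _ => hS _)
    (T.measurableSet_blk_perc hS u)
  rw [← hB] at hBm hBp
  have hBval : P.real B * (isoProb d p (k + 1) * ∏ j ∈ Finset.range (k + 1), p j) =
      pivotProb d p (T.lev u) := by
    rw [hBp, T.real_perc hle hm hS hp h.prob_nonneg, pivotProb, isoProb, isoProb,
      ← Finset.prod_mul_distrib, ← Finset.prod_mul_distrib,
      ← Finset.prod_range_mul_prod_Ico _ (show k + 1 ≤ T.lev u from hku)]
    have e : ∏ j ∈ Finset.Ico (k + 1) (T.lev u), (P.real {ω | S ω ∈ T.noSib (T.anc u (j + 1))} *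
        P.real {ω | T.anc u j ∈ S ω}) =
        ∏ j ∈ Finset.Ico (k + 1) (T.lev u), ((1 - linkProb d p j) ^ (d j - 1) * p j) := by
      refine Finset.prod_congr rfl fun j hj => ?_
      have hj' : j < T.lev u := (Finset.mem_Ico.1 hj).2
      rw [T.real_noSib hle hm hS hp h.prob_nonneg (T.anc_ne_root hj' (by omega)), hp,
        T.par_anc_succ hj', T.lev_anc hj'.le]
    rw [e]
    ring
  set N : ℕ → Set Ω := fun j => if j = k then B else
    {ω | S' ω ∈ T.noSib (T.anc v (j + 1))} with hN
  set O : ℕ → Set Ω := fun j => if j ≤ k then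
    {ω | T.anc v j ∈ S ω ∧ T.anc v j ∈ S' ω} else {ω | T.anc v j ∈ S' ω} with hO
  have hspine := (T.spine hle hm (v := v) (k := 0) (Nat.zero_le _) (N := N) (O := O)
    (fun j _ _ => by
      simp only [hN]; split_ifs with hjk
      · subst hjk
        -- The subtree containing u hangs off the path to v exactly at the branching level.
        have hss : T.desc (T.anc u (j + 1)) ⊆ T.sibDesc (T.anc v (j + 1)) := fun y hy =>
          ⟨T.anc u (j + 1), by rw [T.par_anc_succ hkv, ← hk]; exact T.anc_mem_ch hku, hk1, hy⟩
        exact blk_mono hss _ hBm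
      · exact T.measurableSet_blk_noSib hS' _)
    (fun j _ _ => by
      simp only [hO]; split_ifs
      · exact MeasurableSet.inter (hS _) (hS' _)
      · exact hS' _)
    (T.measurableSet_blk_perc hS' v)).2
  have hsub : {ω | (S ω, S' ω) ∈ T.meetEvent u v k} ⊆
      {ω | S' ω ∈ T.perc v} ∩ ⋂ j ∈ Finset.Ico 0 n, (N j ∩ O j) := by
    rintro ω ⟨h1, h2⟩
    refine ⟨h2.1, Set.mem_iInter₂.2 fun j hj => ?_⟩
    obtain ⟨h3, h4, h5⟩ := h2.2 j (Finset.mem_Ico.1 hj).2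
    constructor
    · simp only [hN]
      split_ifs with hjk
      · exact ⟨h1.1, Set.mem_iInter₂.2 fun i hi =>
          h1.2 i (Finset.mem_Ico.1 hi).2 (Finset.mem_Ico.1 hi).1⟩
      · exact h3 hjk
    · simp only [hO]
      split_ifs with hjk
      · exact ⟨h5 hjk, h4⟩
      · exact h4
  refine (measureReal_mono hsub).trans ?_
  rw [hspine, T.real_perc hle hm hS' hp' h.prob_nonneg]
  have hPN : ∀ j ∈ Finset.Ico 0 n, P.real (N j) ≤ (1 - linkProb d p j) ^ (d j - 1) *
      (if j = k then 1 / ε ^ D * P.real B else 1) := by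
    intro j hj
    have hj' := (Finset.mem_Ico.1 hj).2
    simp only [hN]
    split_ifs with hjk
    · have h1 := h.pow_le_iso_factor j
      calc P.real B = ε ^ D * (1 / ε ^ D * P.real B) := by field_simp
        _ ≤ _ := by gcongr
    · rw [T.real_noSib hle hm hS' hp' h.prob_nonneg (T.anc_ne_root hj' (by omega)),
        T.par_anc_succ hj', T.lev_anc hj'.le, mul_one]
  have hPO : ∀ j ∈ Finset.Ico 0 n, P.real (O j) ≤ p j *
      (if j ∈ Finset.Icc 1 k then ρ else 1) := by
    intro j hj
    have hj' := (Finset.mem_Ico.1 hj).2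
    simp only [hO]
    split_ifs with h1 h2 h3
    · have := hpp _ (T.anc_ne_root hj'.le (by simp at h2; omega))
      rwa [T.lev_anc hj'.le] at this
    · have : j = 0 := by simp at h2; omega
      refine measureReal_le_one.trans ?_
      rw [this, hp0]; simp
    · simp at h3; omega
    · rw [hp', T.lev_anc hj'.le]; simp
  have hmul : ∏ j ∈ Finset.Ico 0 n, (P.real (N j) * P.real (O j)) ≤
      ∏ j ∈ Finset.Ico 0 n, (((1 - linkProb d p j) ^ (d j - 1) *
      (if j = k then 1 / ε ^ D * P.real B else 1)) * (p j *
      (if j ∈ Finset.Icc 1 k then ρ else 1))) :=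
    Finset.prod_le_prod (fun j _ => by positivity) fun j hj =>
      mul_le_mul (hPN j hj) (hPO j hj) measureReal_nonneg ((measureReal_nonneg).trans (hPN j hj))
  have hq := (survLim_mem (d := d) h.prob_nonneg n).1
  refine (mul_le_mul_of_nonneg_left hmul hq).trans ?_
  simp only [Finset.prod_mul_distrib]
  have ecard : Finset.filter (fun j => j ∈ Finset.Icc 1 k) (Finset.range n) = Finset.Icc 1 k := by
    ext j; simp; omega
  rw [← Finset.range_eq_Ico, ← isoProb, Finset.prod_ite_eq', if_pos (Finset.mem_range.2 hkv),
    Finset.prod_ite, Finset.prod_const, Finset.prod_const_one, mul_one, ecard, Nat.card_Icc,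
    Nat.add_sub_cancel]
  have hPk : 0 < ∏ j ∈ Finset.range (k + 1), p j := Finset.prod_pos fun j _ => hpj j
  have hIk := h.isoProb_pos k
  have hIk1 := h.isoProb_pos (k + 1)
  have hBle : P.real B ≤ 1 / ε ^ D * pivotProb d p (T.lev u) /
      (isoProb d p k * ∏ j ∈ Finset.range (k + 1), p j) := by
    rw [le_div_iff₀ (by positivity), ← hBval]
    have h1 : isoProb d p k ≤ 1 / ε ^ D * isoProb d p (k + 1) := by
      rw [isoProb, isoProb, Finset.prod_range_succ, ← isoProb]
      have h2 := h.pow_le_iso_factor k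
      rw [one_div_mul_eq_div, le_div_iff₀ (by positivity)]
      gcongr
    calc P.real B * (isoProb d p k * ∏ j ∈ Finset.range (k + 1), p j)
        ≤ P.real B * ((1 / ε ^ D * isoProb d p (k + 1)) * ∏ j ∈ Finset.range (k + 1), p j) := by
          gcongr
      _ = _ := by ring
  have hf : 0 ≤ pivotProb d p n := mul_nonneg hq (mul_nonneg (h.isoProb_pos _).le
      (Finset.prod_nonneg fun j _ => (hpj j).le))
  calc _ = pivotProb d p n * (1 / ε ^ D * P.real B * ρ ^ k) := by rw [pivotProb]; ring
    _ ≤ pivotProb d p n * (1 / ε ^ D * (1 / ε ^ D * pivotProb d p (T.lev u) /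
      (isoProb d p k * ∏ j ∈ Finset.range (k + 1), p j)) * ρ ^ k) := by gcongr
    _ = _ := by ring

end RootedTree

end PairBounds

/-! ### Càdlàg two-valued paths: one-sided limits and switching times through countably many times.
-/

section Paths

open TopologicalSpace

/-- The path `x` is right-continuous and has left limits. -/
structure IsCadlag (x : ℝ≥0 → Bool) : Prop where
  right : ∀ t, ∀ᶠ s in 𝓝[>] t, x s = x t
  left : ∀ t, ∃ b, ∀ᶠ s in 𝓝[<] t, x s = b

/-- The right limit of `x` at `t`, computed along a countable dense set of times, is `true`. -/
def RightOpen (t : ℝ≥0) (x : ℝ≥0 → Bool) : Prop :=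
  ∃ n : ℕ, ∀ k, t < denseSeq ℝ≥0 k → denseSeq ℝ≥0 k < t + 1 / (n + 1) →
    x (denseSeq ℝ≥0 k) = true

/-- The left limit of `x` at `t > 0`, computed along a countable dense set of times, is `true`. -/
def LeftOpen (t : ℝ≥0) (x : ℝ≥0 → Bool) : Prop :=
  0 < t ∧ ∃ n : ℕ, ∀ k, denseSeq ℝ≥0 k < t → t < denseSeq ℝ≥0 k + 1 / (n + 1) →
    x (denseSeq ℝ≥0 k) = true

/-- The first time after `a` at which `x` changes, computed along a countable dense set. -/
noncomputable def jumpAfter (a : ℝ≥0) (x : ℝ≥0 → Bool) : ENNReal :=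
  ⨅ j, if a ≤ denseSeq ℝ≥0 j ∧ x (denseSeq ℝ≥0 j) ≠ x a then (denseSeq ℝ≥0 j : ENNReal) else ⊤

lemma exists_denseSeq_between {a b : ℝ≥0} (h : a < b) :
    ∃ k, a < denseSeq ℝ≥0 k ∧ denseSeq ℝ≥0 k < b := by
  obtain ⟨_, ⟨k, rfl⟩, h1⟩ := (denseRange_denseSeq ℝ≥0).exists_between h
  exact ⟨k, h1⟩

lemma exists_Ioo_right {Q : ℝ≥0 → Prop} {t : ℝ≥0} (h : ∀ᶠ s in 𝓝[>] t, Q s) :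
    ∃ u > t, ∀ s, t < s → s < u → Q s := by
  obtain ⟨u, hu, h1⟩ := mem_nhdsGT_iff_exists_Ioo_subset.1 h
  exact ⟨u, hu, fun s h2 h3 => h1 ⟨h2, h3⟩⟩

lemma exists_Ioo_left {Q : ℝ≥0 → Prop} {t : ℝ≥0} (ht : 0 < t) (h : ∀ᶠ s in 𝓝[<] t, Q s) :
    ∃ l < t, ∀ s, l < s → s < t → Q s := by
  obtain ⟨l, hl, h1⟩ := (mem_nhdsLT_iff_exists_Ioo_subset' ht).1 h
  exact ⟨l, hl, fun s h2 h3 => h1 ⟨h2, h3⟩⟩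

lemma not_switches_zero (x : ℝ≥0 → Bool) : ¬ Switches x 0 := by
  simp [Switches]

lemma exists_lt_add_inv {a b : ℝ≥0} (h : a < b) : ∃ n : ℕ, a + 1 / (n + 1) < b := by
  obtain ⟨n, hn⟩ := exists_nat_one_div_lt (tsub_pos_of_lt h)
  exact ⟨n, by rw [add_comm]; exact lt_tsub_iff_right.1 hn⟩

lemma lt_add_inv_pos (t : ℝ≥0) (n : ℕ) : t < t + 1 / (n + 1) :=
  lt_add_of_pos_right _ (by positivity)

variable {x : ℝ≥0 → Bool}

namespace IsCadlag

variable (hx : IsCadlag x)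
include hx

lemma rightOpen_iff (t : ℝ≥0) : RightOpen t x ↔ x t = true := by
  obtain ⟨u, hu, h1⟩ := exists_Ioo_right (hx.right t)
  constructor
  · rintro ⟨n, hn⟩
    obtain ⟨k, h2, h3⟩ := exists_denseSeq_between (lt_min hu (lt_add_inv_pos t n))
    rw [← h1 _ h2 (h3.trans_le (min_le_left _ _))]
    exact hn k h2 (h3.trans_le (min_le_right _ _))
  · intro ht
    obtain ⟨n, hn⟩ := exists_lt_add_inv hu
    exact ⟨n, fun k h2 h3 => by rw [h1 _ h2 (h3.trans hn), ht]⟩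

lemma leftOpen_iff (t : ℝ≥0) : LeftOpen t x ↔ ∃ᶠ s in 𝓝[<] t, x s = true := by
  rcases eq_or_lt_of_le (zero_le (a := t)) with rfl | ht
  · simp [LeftOpen]
  obtain ⟨b, hb⟩ := hx.left t
  obtain ⟨l, hl, h1⟩ := exists_Ioo_left ht hb
  have : (𝓝[<] t).NeBot := nhdsLT_neBot_of_exists_lt ⟨0, ht⟩
  have hfreq : (∃ᶠ s in 𝓝[<] t, x s = true) ↔ b = true := by
    rw [frequently_congr (hb.mono fun s hs => by rw [hs]), frequently_const]
  rw [hfreq]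
  constructor
  · rintro ⟨_, n, hn⟩
    have h0 : t - 1 / (n + 1) < t := tsub_lt_self ht (by positivity)
    obtain ⟨k, h2, h3⟩ := exists_denseSeq_between (max_lt hl h0)
    rw [← h1 _ ((le_max_left _ _).trans_lt h2) h3]
    exact hn k h3 (lt_add_of_tsub_lt_right ((le_max_right _ _).trans_lt h2))
  · intro hbt
    obtain ⟨n, hn⟩ := exists_lt_add_inv hl
    refine ⟨ht, n, fun k h2 h3 => ?_⟩
    rw [h1 _ ?_ h2, hbt]
    exact lt_of_add_lt_add_right (hn.trans h3)

/-- The convention that an edge is open when it switches. -/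
lemma open_iff (t : ℝ≥0) : (RightOpen t x ∨ LeftOpen t x) ↔ (x t = true ∨ Switches x t) := by
  rw [hx.rightOpen_iff, hx.leftOpen_iff]
  by_cases h : x t = true
  · simp [h]
  · simp only [Switches]
    simp at h
    simp [h]

/-- Right-continuity makes the infimum over dense times a genuine first switching time: the path is
constant on [a, t), and a value x t = x a would persist to the right of t and push the infimum up.
-/
lemma jumpAfter_spec {a t : ℝ≥0} (h : jumpAfter a x = t) :
    a < t ∧ Switches x t ∧ x t ≠ x a ∧ ∀ s, a ≤ s → s < t → x s = x a := by
  have hle : ∀ j, a ≤ denseSeq ℝ≥0 j → x (denseSeq ℝ≥0 j) ≠ x a → t ≤ denseSeq ℝ≥0 j := by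
    intro j h1 h2
    have := iInf_le (fun j => if a ≤ denseSeq ℝ≥0 j ∧ x (denseSeq ℝ≥0 j) ≠ x a then
      (denseSeq ℝ≥0 j : ENNReal) else ⊤) j
    rw [← jumpAfter, h] at this
    simpa [h1, h2] using this
  have hge : ∀ u : ℝ≥0, (∀ j, a ≤ denseSeq ℝ≥0 j → x (denseSeq ℝ≥0 j) ≠ x a →
      u ≤ denseSeq ℝ≥0 j) → u ≤ t := by
    intro u hu
    rw [← ENNReal.coe_le_coe, ← h]
    refine le_iInf fun j => ?_
    split_ifs with hj
    · exact ENNReal.coe_le_coe.2 (hu j hj.1 hj.2)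
    · exact le_top
  have hat : a ≤ t := hge a fun j h1 _ => h1
  have hconst : ∀ s, a ≤ s → s < t → x s = x a := by
    intro s h1 h2
    by_contra h3
    obtain ⟨u, hu, h4⟩ := exists_Ioo_right (hx.right s)
    obtain ⟨k, h5, h6⟩ := exists_denseSeq_between (lt_min hu h2)
    have h7 := hle k (h1.trans h5.le) (by rw [h4 _ h5 (h6.trans_le (min_le_left _ _))]; exact h3)
    exact absurd (h6.trans_le (min_le_right _ _)) (not_lt.2 h7)
  have hxt : x t ≠ x a := by
    intro he
    obtain ⟨u, hu, h4⟩ := exists_Ioo_right (hx.right t)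
    refine absurd (hge u fun j h1 h2 => ?_) (not_le.2 hu)
    by_contra! h3
    rcases (hle j h1 h2).eq_or_lt with h5 | h5
    · rw [← h5] at h2; exact h2 he
    · exact h2 ((h4 _ h5 h3).trans he)
  have hat' : a < t := lt_of_le_of_ne hat fun he => hxt (by rw [he])
  refine ⟨hat', ?_, hxt, hconst⟩
  have : (𝓝[<] t).NeBot := nhdsLT_neBot_of_exists_lt ⟨a, hat'⟩
  refine Eventually.frequently ?_
  filter_upwards [Ioo_mem_nhdsLT hat'] with s hs
  rw [hconst s hs.1.le hs.2]
  exact hxt.symm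

lemma jumpAfter_le {a t : ℝ≥0} (hat : a ≤ t) (h : x t ≠ x a) : jumpAfter a x ≤ t := by
  refine le_of_forall_gt_imp_ge_of_dense fun c hc => ?_
  obtain ⟨u, hu, h4⟩ := exists_Ioo_right (hx.right t)
  obtain ⟨r, hr1, hr2⟩ := ENNReal.lt_iff_exists_nnreal_btwn.1 hc
  obtain ⟨k, h5, h6⟩ := exists_denseSeq_between (lt_min hu (ENNReal.coe_lt_coe.1 hr1))
  refine (iInf_le _ k).trans ?_
  rw [if_pos ⟨hat.trans h5.le, by rwa [h4 _ h5 (h6.trans_le (min_le_left _ _))]⟩]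
  exact (ENNReal.coe_le_coe.2 (h6.trans_le (min_le_right _ _)).le).trans hr2.le

/-- The left limit at t persists on an interval before t, and any dense time in that interval
serves. All switching times are thus enumerated by countably many measurable functions. -/
lemma exists_jumpAfter_eq {t : ℝ≥0} (h : Switches x t) :
    ∃ k, jumpAfter (denseSeq ℝ≥0 k) x = t := by
  have ht : 0 < t := by
    rcases eq_or_lt_of_le (zero_le (a := t)) with rfl | ht
    · exact absurd h (not_switches_zero x)
    · exact ht
  obtain ⟨b, hb⟩ := hx.left t
  obtain ⟨l, hl, h1⟩ := exists_Ioo_left ht hb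
  have hbt : b ≠ x t := by
    obtain ⟨s, h2, h3⟩ := (h.and_eventually hb).exists
    rwa [h3] at h2
  obtain ⟨k, h2, h3⟩ := exists_denseSeq_between hl
  have hk := h1 _ h2 h3
  refine ⟨k, le_antisymm (hx.jumpAfter_le h3.le (by rw [hk]; exact hbt.symm)) ?_⟩
  refine le_iInf fun j => ?_
  split_ifs with hj
  · refine ENNReal.coe_le_coe.2 ?_
    by_contra! h4
    exact hj.2 (by rw [hk, h1 _ (h2.trans_le hj.1) h4])
  · exact le_top

/-- Between grid points that are fine enough, a switching path takes different values. -/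
lemma exists_grid_ne {t : ℝ≥0} (h : Switches x t) :
    ∃ δ > 0, ∀ s u : ℝ≥0, s < t → t ≤ u → u ≤ s + δ → x s ≠ x u := by
  have ht : 0 < t := by
    rcases eq_or_lt_of_le (zero_le (a := t)) with rfl | ht
    · exact absurd h (not_switches_zero x)
    · exact ht
  obtain ⟨b, hb⟩ := hx.left t
  obtain ⟨l, hl, h1⟩ := exists_Ioo_left ht hb
  obtain ⟨r, hr, h2⟩ := exists_Ioo_right (hx.right t)
  have hbt : b ≠ x t := by
    obtain ⟨s, h2, h3⟩ := (h.and_eventually hb).exists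
    rwa [h3] at h2
  obtain ⟨n, hn⟩ := exists_lt_add_inv hl
  obtain ⟨n', hn'⟩ := exists_lt_add_inv hr
  refine ⟨min (1 / (n + 1)) (1 / (n' + 1)), lt_min (by positivity) (by positivity),
    fun s u hs hu hsu => ?_⟩
  have h3 : x s = b := by
    refine h1 s ?_ hs
    have : u ≤ s + 1 / (n + 1) := hsu.trans (by gcongr; exact min_le_left _ _)
    exact lt_of_add_lt_add_right (hn.trans_le (hu.trans this))
  have h4 : x u = x t := by
    rcases hu.eq_or_lt with rfl | hu
    · rfl
    refine h2 u hu ?_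
    have : u ≤ s + 1 / (n' + 1) := hsu.trans (by gcongr; exact min_le_right _ _)
    refine this.trans_lt (lt_of_le_of_lt ?_ hn')
    gcongr
  rw [h3, h4]
  exact hbt

end IsCadlag

lemma measurableSet_rightOpen_or_leftOpen :
    MeasurableSet {z : ℝ≥0 × (ℝ≥0 → Bool) | RightOpen z.1 z.2 ∨ LeftOpen z.1 z.2} := by
  have hev : ∀ k, Measurable fun z : ℝ≥0 × (ℝ≥0 → Bool) => z.2 (denseSeq ℝ≥0 k) = true :=
    fun k => measurableSet_setOfPred.1 (measurableSet_eq_fun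
      ((measurable_pi_apply (denseSeq ℝ≥0 k)).comp measurable_snd) measurable_const)
  have hlt : ∀ {f g : ℝ≥0 × (ℝ≥0 → Bool) → ℝ≥0}, Measurable f → Measurable g →
      Measurable fun z => f z < g z := fun hf hg =>
    measurableSet_setOfPred.1 (measurableSet_lt hf hg)
  refine measurableSet_setOfPred.2 (Measurable.or ?_ (Measurable.and ?_ ?_))
  · exact Measurable.exists fun n => Measurable.forall fun k =>
      (hlt measurable_fst measurable_const).imp
        ((hlt measurable_const (measurable_fst.add_const _)).imp (hev k))
  · exact hlt measurable_const measurable_fst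
  · exact Measurable.exists fun n => Measurable.forall fun k =>
      (hlt measurable_const measurable_fst).imp
        ((hlt measurable_fst measurable_const).imp (hev k))

lemma measurable_jumpAfter (a : ℝ≥0) : Measurable (jumpAfter a) := by
  refine Measurable.iInf fun j => Measurable.ite ?_ measurable_const measurable_const
  refine MeasurableSet.inter (MeasurableSet.const _) ?_
  exact (measurableSet_eq_fun (measurable_pi_apply (denseSeq ℝ≥0 j))
    (measurable_pi_apply a)).compl

end Paths

/-! ### Estimates for one stationary two-state chain. -/

/-- A stationary two-state chain with càdlàg paths, open with probability `p`. -/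
structure IsTwoStateChain {Ω : Type*} [MeasurableSpace Ω] (p : ℝ) (x : Ω → ℝ≥0 → Bool)
    (P : Measure Ω) : Prop where
  measurable : Measurable x
  markov : ∀ (n : ℕ) (t : Fin (n + 1) → ℝ≥0) (a : Fin (n + 1) → Bool), Monotone t →
    P.real {ω | ∀ i, x ω (t i) = a i} = stationary p (a 0) *
      ∏ i : Fin n, transition p ((t i.succ : ℝ) - t i.castSucc) (a i.castSucc) (a i.succ)
  cadlag : ∀ᵐ ω ∂P, IsCadlag (x ω)

namespace IsTwoStateChain

variable {Ω : Type*} [MeasurableSpace Ω] {P : Measure Ω} [IsProbabilityMeasure P] {p : ℝ}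
  {x : Ω → ℝ≥0 → Bool} (h : IsTwoStateChain p x P)
include h

omit [IsProbabilityMeasure P] in
lemma measurable_eval (t : ℝ≥0) : Measurable fun ω => x ω t :=
  (measurable_pi_apply t).comp h.measurable

omit [IsProbabilityMeasure P] in
lemma real_open (t : ℝ≥0) : P.real {ω | x ω t = true} = p := by
  have := h.markov 0 (fun _ => t) (fun _ => true) monotone_const
  simpa [stationary] using this

omit [IsProbabilityMeasure P] in
lemma real_pair {s t : ℝ≥0} (hst : s ≤ t) (a b : Bool) :
    P.real {ω | x ω s = a ∧ x ω t = b} = stationary p a * transition p ((t : ℝ) - s) a b := by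
  have hmono : Monotone ![s, t] := by
    intro i j hij
    fin_cases i <;> fin_cases j <;> simp_all
  have := h.markov 1 ![s, t] ![a, b] hmono
  simpa [Fin.forall_fin_two] using this

omit [IsProbabilityMeasure P] in
lemma real_both_open {s t : ℝ≥0} (hst : s ≤ t) :
    P.real {ω | x ω s = true ∧ x ω t = true} =
      p * (1 - (1 - Real.exp (-((t : ℝ) - s))) * (1 - p)) := by
  rw [h.real_pair hst]
  simp [stationary, transition, generator, Matrix.add_apply, Matrix.smul_apply]
  ring_nf
  tauto

lemma real_ne {s t : ℝ≥0} (hst : s ≤ t) :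
    P.real {ω | x ω s ≠ x ω t} = 2 * (p * (1 - p)) * (1 - Real.exp (-((t : ℝ) - s))) := by
  have e : {ω | x ω s ≠ x ω t} = {ω | x ω s = true ∧ x ω t = false} ∪
      {ω | x ω s = false ∧ x ω t = true} := by
    ext ω
    simp only [Set.mem_ofPred_eq, Set.mem_union]
    cases x ω s <;> cases x ω t <;> simp
  have hmeas : MeasurableSet {ω | x ω s = false ∧ x ω t = true} :=
    (h.measurable_eval s (measurableSet_singleton false)).inter
      (h.measurable_eval t (measurableSet_singleton true))
  rw [e, measureReal_union (Set.disjoint_left.2 fun ω h1 h2 => by simp_all) hmeas,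
    h.real_pair hst, h.real_pair hst]
  simp [stationary, transition, generator, Matrix.add_apply, Matrix.smul_apply]
  ring

variable {ε : ℝ} (hε : 0 < ε) (hp : ε ≤ p ∧ p ≤ 1 - ε)

include hε hp in
lemma real_ne_le {s t : ℝ≥0} (hst : s ≤ t) : P.real {ω | x ω s ≠ x ω t} ≤ (t : ℝ) - s := by
  rw [h.real_ne hst]
  have h1 : 1 - Real.exp (-((t : ℝ) - s)) ≤ (t : ℝ) - s := by
    linarith [Real.add_one_le_exp (-((t : ℝ) - s))]
  have h2 : (0 : ℝ) ≤ (t : ℝ) - s := sub_nonneg.2 (by exact_mod_cast hst)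
  have h3 : 2 * (p * (1 - p)) ≤ 1 := by nlinarith [sq_nonneg (p - 1 / 2)]
  have h4 : 0 ≤ 2 * (p * (1 - p)) := by
    have : 0 ≤ p * (1 - p) := mul_nonneg (by linarith) (by linarith)
    linarith
  calc _ ≤ 2 * (p * (1 - p)) * ((t : ℝ) - s) := by gcongr
    _ ≤ 1 * ((t : ℝ) - s) := by gcongr
    _ = _ := one_mul _

include hε hp in
/-- The probability of a switch in `(a, b]` is at most `b - a`. -/
lemma measure_exists_switch_le {a b : ℝ≥0} (hab : a ≤ b) :
    P {ω | ∃ t, a < t ∧ t ≤ b ∧ Switches (x ω) t} ≤ ENNReal.ofReal ((b : ℝ) - a) := by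
  set g : ℕ → ℕ → ℝ≥0 := fun M i => a + i * ((b - a) / (M + 1)) with hg
  have hgsucc : ∀ M i, g M (i + 1) = g M i + (b - a) / (M + 1) := fun M i => by
    simp only [hg]; push_cast; ring
  have hglast : ∀ M, g M (M + 1) = b := fun M => by
    simp only [hg]
    push_cast
    rw [mul_div_cancel₀ _ (by positivity), add_tsub_cancel_of_le hab]
  set A : ℕ → Set Ω := fun M => ⋃ i ∈ Finset.range (M + 1), {ω | x ω (g M i) ≠ x ω (g M (i + 1))}
    with hA
  have hAle : ∀ M, P (A M) ≤ ENNReal.ofReal ((b : ℝ) - a) := by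
    intro M
    have h1 : P.real (A M) ≤ (b : ℝ) - a := by
      refine (measureReal_biUnion_finset_le _ _).trans ?_
      refine (Finset.sum_le_sum (g := fun _ => ((b : ℝ) - a) / (M + 1)) fun i _ => ?_).trans ?_
      · refine (h.real_ne_le hε hp (by rw [hgsucc]; exact le_self_add)).trans (le_of_eq ?_)
        rw [hgsucc]
        push_cast [NNReal.coe_sub hab]
        ring
      · rw [Finset.sum_const, Finset.card_range, nsmul_eq_mul]
        push_cast
        rw [mul_div_cancel₀ _ (by positivity)]
    rw [← ofReal_measureReal (measure_ne_top _ _)]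
    exact ENNReal.ofReal_le_ofReal h1
  -- A switch is detected by every fine enough grid, so it lies in the increasing union of these
  -- intersections. The union bound over each grid gives b - a whatever the mesh, and continuity
  -- from below keeps the bound.
  have hmono : Monotone fun k => ⋂ M ≥ k, A M := fun k l hkl =>
    Set.biInter_subset_biInter_left fun M hM => le_trans hkl hM
  have hsub : {ω | ∃ t, a < t ∧ t ≤ b ∧ Switches (x ω) t} ≤ᵐ[P] ⋃ k, ⋂ M ≥ k, A M := by
    filter_upwards [h.cadlag] with ω hω
    rintro ⟨t, hat, htb, hsw⟩
    obtain ⟨δ, hδ, h1⟩ := hω.exists_grid_ne hsw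
    obtain ⟨k, hk⟩ := exists_nat_gt ((b - a) / δ)
    refine Set.mem_iUnion.2 ⟨k, Set.mem_iInter₂.2 fun M hM => ?_⟩
    have hstep : (b - a) / (M + 1) ≤ δ := by
      rw [div_le_iff₀ (by positivity)]
      rw [div_lt_iff₀ hδ] at hk
      refine hk.le.trans ?_
      rw [mul_comm]
      gcongr
      have : (k : ℝ≥0) ≤ M := by exact_mod_cast hM
      exact this.trans le_self_add
    classical
    have hex : ∃ i, t ≤ g M i := ⟨M + 1, by rw [hglast]; exact htb⟩
    -- The first grid point at or after the switch; the preceding one lies strictly before it.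
    set i := Nat.find hex with hi
    have hi0 : i ≠ 0 := by
      intro h0
      have := Nat.find_spec hex
      rw [← hi, h0] at this
      simp [hg] at this
      exact absurd this (not_le.2 hat)
    obtain ⟨j, hj⟩ := Nat.exists_eq_succ_of_ne_zero hi0
    have h2 : t ≤ g M (j + 1) := by
      have := Nat.find_spec hex
      rwa [← hi, hj] at this
    have h3 : g M j < t := not_le.1 (Nat.find_min hex (by omega))
    have h4 : i ≤ M + 1 := Nat.find_min' hex (by rw [hglast]; exact htb)
    refine Set.mem_biUnion (x := j) (by simp; omega) ?_
    refine h1 _ _ h3 h2 ?_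
    rw [hgsucc]
    gcongr
  refine (measure_mono_ae hsub).trans ?_
  rw [hmono.measure_iUnion]
  refine iSup_le fun k => (measure_mono ?_).trans (hAle k)
  exact Set.biInter_subset_of_mem (le_refl k)

-- The switch would lie in (t - δ, t], of probability at most δ for every δ. Thus at a fixed time
-- the convention about switching edges almost surely has no effect.
include hε hp in
lemma ae_not_switches (t : ℝ≥0) : ∀ᵐ ω ∂P, ¬ Switches (x ω) t := by
  rw [ae_iff]
  simp only [not_not]
  rcases eq_or_lt_of_le (zero_le (a := t)) with rfl | ht
  · simp [not_switches_zero]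
  refine le_antisymm (ENNReal.le_of_forall_pos_le_add fun δ hδ _ => ?_) zero_le
  have h1 := h.measure_exists_switch_le hε hp (a := t - δ) (b := t) tsub_le_self
  rw [zero_add]
  refine (measure_mono fun ω hω => ?_).trans (h1.trans ?_)
  · exact ⟨t, tsub_lt_self ht hδ, le_rfl, hω⟩
  · rw [← ENNReal.ofReal_coe_nnreal]
    refine ENNReal.ofReal_le_ofReal ?_
    have : t ≤ (t - δ) + δ := le_tsub_add
    have : (t : ℝ) ≤ ((t - δ : ℝ≥0) : ℝ) + δ := by exact_mod_cast this
    linarith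

include hε hp in
lemma ae_open_iff (t : ℝ≥0) :
    ∀ᵐ ω ∂P, (RightOpen t (x ω) ∨ LeftOpen t (x ω)) ↔ x ω t = true := by
  filter_upwards [h.cadlag, h.ae_not_switches hε hp t] with ω h1 h2
  rw [h1.open_iff]
  simp [h2]

include hε hp in
lemma real_open' (t : ℝ≥0) : P.real {ω | RightOpen t (x ω) ∨ LeftOpen t (x ω)} = p := by
  rw [← h.real_open t]
  refine measureReal_congr ?_
  filter_upwards [h.ae_open_iff hε hp t] with ω h1
  exact propext h1

-- The exact value is p (1 - (1 - e^(-u)) (1 - p)) with u = |s - t|. On [0, 1] one has 1 - e^(-u) ≥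
-- u/2, and 1 - p ≥ ε; then 1 - y ≤ e^(-y). Up to time 1 this exponential form makes products over
-- edges easy to integrate.
include hε hp in
lemma real_both_open_le {s t : ℝ≥0} (hs : s ≤ 1) (ht : t ≤ 1) :
    P.real {ω | (RightOpen s (x ω) ∨ LeftOpen s (x ω)) ∧ (RightOpen t (x ω) ∨ LeftOpen t (x ω))} ≤
      p * Real.exp (-(ε / 2 * dist s t)) := by
  wlog hst : s ≤ t generalizing s t
  · have := this ht hs (le_of_not_ge hst)
    rw [dist_comm]
    simpa only [and_comm] using this
  have e : P.real {ω | (RightOpen s (x ω) ∨ LeftOpen s (x ω)) ∧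
      (RightOpen t (x ω) ∨ LeftOpen t (x ω))} = P.real {ω | x ω s = true ∧ x ω t = true} := by
    refine measureReal_congr ?_
    filter_upwards [h.ae_open_iff hε hp t, h.ae_open_iff hε hp s] with ω h1 h2
    exact propext (and_congr h2 h1)
  rw [e, h.real_both_open hst]
  have hst' : (s : ℝ) ≤ t := by exact_mod_cast hst
  have hd : dist s t = (t : ℝ) - s := by
    rw [NNReal.dist_eq, abs_sub_comm, abs_of_nonneg (by linarith)]
  have hu : (t : ℝ) - s ≤ 1 := by
    have : (t : ℝ) ≤ 1 := by exact_mod_cast ht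
    linarith [s.coe_nonneg]
  rw [hd]
  set u := (t : ℝ) - s
  have hu0 : 0 ≤ u := by simp only [u]; linarith
  have h1 : u / 2 ≤ 1 - Real.exp (-u) := by
    have h2 : Real.exp (-u) ≤ 1 / (1 + u) := by
      rw [Real.exp_neg, ← one_div]
      exact one_div_le_one_div_of_le (by linarith) (by linarith [Real.add_one_le_exp u])
    have h3 : 1 / (1 + u) ≤ 1 - u / 2 := by
      rw [div_le_iff₀ (by linarith)]
      nlinarith
    linarith
  refine mul_le_mul_of_nonneg_left ?_ (by linarith)
  refine le_trans ?_ (Real.one_sub_le_exp_neg _)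
  have : u / 2 * ε ≤ (1 - Real.exp (-u)) * (1 - p) := by
    apply mul_le_mul h1 (by linarith) hε.le (by linarith)
  linarith

-- Switch probabilities are controlled on half-open intervals; enlarging [a, b] to (a - (b - a), b]
-- covers the left endpoint and accounts for the factor 2. For a = 0 the truncated subtraction is
-- harmless, because a first switch occurs strictly after 0.
include hε hp in
lemma measure_jumpAfter_mem_Icc_le {a b : ℝ≥0} (hab : a < b) :
    P {ω | (a : ENNReal) ≤ jumpAfter 0 (x ω) ∧ jumpAfter 0 (x ω) ≤ b} ≤
      ENNReal.ofReal (2 * ((b : ℝ) - a)) := by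
  have h1 := h.measure_exists_switch_le hε hp (a := a - (b - a)) (b := b)
    (tsub_le_self.trans hab.le)
  refine (measure_mono_ae ?_).trans (h1.trans (ENNReal.ofReal_le_ofReal ?_))
  · filter_upwards [h.cadlag] with ω hω
    rintro ⟨h2, h3⟩
    lift jumpAfter 0 (x ω) to ℝ≥0 using ne_top_of_le_ne_top ENNReal.coe_ne_top h3 with t ht
    obtain ⟨h4, h5, -⟩ := hω.jumpAfter_spec ht.symm
    refine ⟨t, ?_, ENNReal.coe_le_coe.1 h3, h5⟩
    rcases eq_or_lt_of_le (zero_le (a := a)) with rfl | ha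
    · simpa using h4
    · exact (tsub_lt_self ha (tsub_pos_of_lt hab)).trans_le (ENNReal.coe_le_coe.1 h2)
  · have h2 : a ≤ (a - (b - a)) + (b - a) := le_tsub_add
    have h3 : (a : ℝ) ≤ ((a - (b - a) : ℝ≥0) : ℝ) + ((b : ℝ) - a) := by
      rw [← NNReal.coe_sub hab.le]
      exact_mod_cast h2
    linarith

-- A path with different values at 0 and 1 has switched, and this has probability 2p(1 - p)(1 - 1/e)
-- ≥ p(1 - p) ≥ ε^2.
include hε hp in
lemma real_jumpAfter_le_one : ε ^ 2 ≤ P.real {ω | jumpAfter 0 (x ω) ≤ 1} := by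
  have h1 := h.real_ne (s := 0) (t := 1) zero_le_one
  have h2 : P.real {ω | x ω 0 ≠ x ω 1} ≤ P.real {ω | jumpAfter 0 (x ω) ≤ 1} := by
    refine ENNReal.toReal_mono (measure_ne_top _ _) (measure_mono_ae ?_)
    filter_upwards [h.cadlag] with ω hω h3
    exact hω.jumpAfter_le zero_le (Ne.symm h3)
  refine le_trans ?_ h2
  rw [h1]
  have h3 : Real.exp (-(((1 : ℝ≥0) : ℝ) - ((0 : ℝ≥0) : ℝ))) ≤ 1 / 2 := by
    have := Real.exp_one_gt_d9
    simp only [NNReal.coe_one, NNReal.coe_zero, sub_zero]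
    rw [Real.exp_neg, inv_le_comm₀ (Real.exp_pos 1) (by norm_num)]
    linarith
  have h4 : ε ^ 2 ≤ p * (1 - p) := by nlinarith
  nlinarith [sq_nonneg ε]

end IsTwoStateChain

/-! ### Conditioning on switching times. -/

section Fubini

lemma measurable_of_blk {V Ω β : Type*} [MeasurableSpace β] {m : V → MeasurableSpace Ω}
    {mΩ : MeasurableSpace Ω} (hle : ∀ v, m v ≤ mΩ) {A : Set V} {f : Ω → β}
    (hf : Measurable[blk m A] f) : Measurable f :=
  hf.mono (blk_le hle A) le_rfl

variable {V Ω : Type*} [MeasurableSpace Ω] {P : Measure Ω} [IsProbabilityMeasure P]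
  {x : V → Ω → ℝ≥0 → Bool}

/-- Fubini for an event depending on a random variable `τ` determined by the coordinates in `F` and
on the coordinates outside `F`. -/
lemma measure_eq_lintegral_of_indep (hx : ∀ v, Measurable (x v)) (hind : iIndepFun x P)
    {β : Type*} [MeasurableSpace β] {F : Set V} {τ : Ω → β}
    (hτ : Measurable[blk (fun v => MeasurableSpace.comap (x v) MeasurableSpace.pi) F] τ)
    {G : Set (β × (V → ℝ≥0 → Bool))} (hG : MeasurableSet G)
    (hGF : ∀ b y y', (∀ u ∉ F, y u = y' u) → ((b, y) ∈ G ↔ (b, y') ∈ G)) :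
    P {ω | (τ ω, fun v => x v ω) ∈ G} =
      ∫⁻ b, P {ω | (b, fun v => x v ω) ∈ G} ∂(P.map τ) := by
  classical
  set m : V → MeasurableSpace Ω := fun v => MeasurableSpace.comap (x v) MeasurableSpace.pi with hm
  have hle : ∀ v, m v ≤ ‹MeasurableSpace Ω› := fun v => (hx v).comap_le
  -- The coordinates in F are frozen to a constant path. The event does not notice, and the frozen
  -- family is independent of τ.
  set x' : Ω → V → ℝ≥0 → Bool := fun ω v => if v ∈ F then fun _ => true else x v ω with hx'
  have hx'm : Measurable[blk m Fᶜ] x' := by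
    refine @measurable_pi_lambda _ _ _ (blk m Fᶜ) _ _ fun v => ?_
    by_cases hv : v ∈ F
    · simp only [hx', hv, if_true]; exact measurable_const
    · simp only [hx', hv, if_false]
      exact (comap_measurable (x v)).mono (le_blk (m := m) (show v ∈ Fᶜ from hv)) le_rfl
  have hG' : ∀ b ω, (b, fun v => x v ω) ∈ G ↔ (b, x' ω) ∈ G := fun b ω =>
    hGF b _ _ fun u hu => by simp [hx', hu]
  have hI : IndepFun τ x' P := by
    rw [IndepFun_iff_Indep]
    exact indep_of_indep_of_le (indep_iSup_of_disjoint hle ((iIndepFun_iff_iIndep _ _ _).1 hind)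
      disjoint_compl_right) hτ.comap_le hx'm.comap_le
  have hτ' := measurable_of_blk hle hτ
  have hx'' := measurable_of_blk hle hx'm
  have h1 := (indepFun_iff_map_prod_eq_prod_map_map hτ'.aemeasurable hx''.aemeasurable).1 hI
  calc P {ω | (τ ω, fun v => x v ω) ∈ G} = P ((fun ω => (τ ω, x' ω)) ⁻¹' G) := by
        congr 1; ext ω; exact hG' _ _
    _ = (P.map fun ω => (τ ω, x' ω)) G := (Measure.map_apply (hτ'.prodMk hx'') hG).symm
    _ = ∫⁻ b, (P.map x') (Prod.mk b ⁻¹' G) ∂(P.map τ) := by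
        rw [h1, Measure.prod_apply hG]
    _ = _ := by
        refine lintegral_congr fun b => ?_
        rw [Measure.map_apply hx'' (measurable_prodMk_left hG)]
        congr 1; ext ω; exact (hG' _ _).symm

end Fubini

/-! ### The integral of the decorrelation factor over switching times. -/

section Kernel

/-- The integral over `[0, 1]` of `exp (-(ε / 2) |s - t|) ^ e` against a measure giving intervals at most
twice their length is `O(1 / (e + 1))`. -/
lemma exists_lintegral_exp_le {ε : ℝ} (hε : 0 < ε) : ∃ K > 0, ∀ (ν : Measure ENNReal),
    (∀ a b : ℝ≥0, a < b → ν (Set.Icc (a : ENNReal) b) ≤ ENNReal.ofReal (2 * ((b : ℝ) - a))) →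
    ∀ (e : ℕ) (s : ℝ≥0), s ≤ 1 → ∫⁻ b in Set.Iic 1, ENNReal.ofReal
      (Real.exp (-(ε / 2 * dist s b.toNNReal)) ^ e) ∂ν ≤ ENNReal.ofReal (K / (e + 1)) := by
  have hsum : Summable fun i : ℕ => ((i : ℝ) + 1) * Real.exp (-i) := by
    have h1 := Real.summable_pow_mul_exp_neg_nat_mul 1 one_pos
    have h0 := Real.summable_pow_mul_exp_neg_nat_mul 0 one_pos
    refine (h1.add h0).congr fun i => ?_
    simp; ring
  set K0 := ∑' i : ℕ, ((i : ℝ) + 1) * Real.exp (-i) with hK0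
  have hK0pos : 0 < K0 := hsum.tsum_pos (fun i => by positivity) 0 (by positivity)
  refine ⟨Real.exp (ε / 2) * (8 / ε * K0), by positivity, fun ν hν e s hs => ?_⟩
  -- Shells of width 1/l around s: at distance u with ⌊l u⌋ = i the integrand is at most e^(ε/2)
  -- e^(-i), the factor e^(ε/2) paying for the exponent e + 1 in place of e, and such points lie in
  -- an interval of measure at most 4(i + 1)/l.
  set l : ℝ := ε / 2 * (e + 1) with hl
  have hlpos : 0 < l := by positivity
  set r : ℕ → ℝ≥0 := fun i => Real.toNNReal ((i + 1) / l) with hr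
  have hrc : ∀ i, (r i : ℝ) = (i + 1) / l := fun i => Real.coe_toNNReal _ (by positivity)
  have hrpos : ∀ i, 0 < r i := fun i => by
    rw [← NNReal.coe_pos, hrc]; positivity
  have hbound : ∀ b ∈ Set.Iic (1 : ENNReal), ENNReal.ofReal
      (Real.exp (-(ε / 2 * dist s b.toNNReal)) ^ e) ≤
      ∑' i : ℕ, (Set.Icc ((s - r i : ℝ≥0) : ENNReal) ((s + r i : ℝ≥0) : ENNReal)).indicator
        (fun _ => ENNReal.ofReal (Real.exp (ε / 2) * Real.exp (-i))) b := by
    intro b hb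
    lift b to ℝ≥0 using ne_top_of_le_ne_top ENNReal.one_ne_top hb
    rw [ENNReal.toNNReal_coe]
    have hb1 : b ≤ 1 := by
      have : (b : ENNReal) ≤ 1 := hb
      exact_mod_cast this
    set u := dist s b with hu
    have hu1 : u ≤ 1 := by
      rw [hu, NNReal.dist_eq, abs_le]
      have h1 : (s : ℝ) ≤ 1 := by exact_mod_cast hs
      have h2 : (b : ℝ) ≤ 1 := by exact_mod_cast hb1
      constructor <;> linarith [s.coe_nonneg, b.coe_nonneg]
    have hu0 : 0 ≤ u := dist_nonneg
    set i := ⌊l * u⌋₊ with hi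
    have h1 : l * u < i + 1 := Nat.lt_floor_add_one _
    have h2 : (i : ℝ) ≤ l * u := Nat.floor_le (by positivity)
    have hur : u ≤ r i := by
      rw [hrc, le_div_iff₀ hlpos]; linarith
    refine le_trans ?_ (ENNReal.le_tsum i)
    have hmem : (b : ENNReal) ∈ Set.Icc ((s - r i : ℝ≥0) : ENNReal) ((s + r i : ℝ≥0) : ENNReal) := by
      rw [hu, NNReal.dist_eq, abs_le] at hur
      refine ⟨ENNReal.coe_le_coe.2 (tsub_le_iff_right.2 ?_), ENNReal.coe_le_coe.2 ?_⟩
      · rw [← NNReal.coe_le_coe]; push_cast; linarith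
      · rw [← NNReal.coe_le_coe]; push_cast; linarith
    rw [Set.indicator_of_mem hmem]
    refine ENNReal.ofReal_le_ofReal ?_
    rw [← Real.exp_nat_mul, ← Real.exp_add]
    refine Real.exp_le_exp.2 ?_
    have h3 : ε / 2 * u ≤ ε / 2 := by nlinarith
    have h4 : l * u = e * (ε / 2 * u) + ε / 2 * u := by rw [hl]; ring
    have : i ≤ e * (ε / 2 * u) + ε / 2 * u := by linarith
    linarith
  calc ∫⁻ b in Set.Iic 1, ENNReal.ofReal (Real.exp (-(ε / 2 * dist s b.toNNReal)) ^ e) ∂ν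
      ≤ ∫⁻ b in Set.Iic 1, ∑' i : ℕ,
        (Set.Icc ((s - r i : ℝ≥0) : ENNReal) ((s + r i : ℝ≥0) : ENNReal)).indicator
        (fun _ => ENNReal.ofReal (Real.exp (ε / 2) * Real.exp (-i))) b ∂ν :=
        setLIntegral_mono' measurableSet_Iic hbound
    _ ≤ ∫⁻ b, ∑' i : ℕ,
        (Set.Icc ((s - r i : ℝ≥0) : ENNReal) ((s + r i : ℝ≥0) : ENNReal)).indicator
        (fun _ => ENNReal.ofReal (Real.exp (ε / 2) * Real.exp (-i))) b ∂ν :=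
        setLIntegral_le_lintegral _ _
    _ = ∑' i : ℕ, ENNReal.ofReal (Real.exp (ε / 2) * Real.exp (-i)) *
        ν (Set.Icc ((s - r i : ℝ≥0) : ENNReal) ((s + r i : ℝ≥0) : ENNReal)) := by
        rw [lintegral_tsum fun i => (measurable_const.indicator measurableSet_Icc).aemeasurable]
        refine tsum_congr fun i => ?_
        rw [lintegral_indicator measurableSet_Icc, setLIntegral_const]
    _ ≤ ∑' i : ℕ, ENNReal.ofReal (Real.exp (ε / 2) * (4 / l) * (((i : ℝ) + 1) * Real.exp (-i))) := by
        refine ENNReal.tsum_le_tsum fun i => ?_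
        have h1 : s - r i < s + r i := tsub_le_self.trans_lt (lt_add_of_pos_right _ (hrpos i))
        have h2 : ν (Set.Icc ((s - r i : ℝ≥0) : ENNReal) ((s + r i : ℝ≥0) : ENNReal)) ≤
            ENNReal.ofReal (4 * ((i + 1) / l)) := by
          refine (hν _ _ h1).trans (ENNReal.ofReal_le_ofReal ?_)
          have h3 : s ≤ (s - r i) + r i := le_tsub_add
          have h4 : (s : ℝ) ≤ ((s - r i : ℝ≥0) : ℝ) + (i + 1) / l := by
            rw [← hrc]; exact_mod_cast h3
          have h5 : ((s + r i : ℝ≥0) : ℝ) = s + (i + 1) / l := by rw [NNReal.coe_add, hrc]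
          rw [h5]
          linarith
        refine (mul_le_mul_right h2 _).trans (le_of_eq ?_)
        rw [← ENNReal.ofReal_mul (by positivity)]
        congr 1; ring
    _ = ENNReal.ofReal (Real.exp (ε / 2) * (4 / l) * K0) := by
        rw [← ENNReal.ofReal_tsum_of_nonneg (fun i => by positivity) (hsum.mul_left _),
          tsum_mul_left]
    _ = _ := by
        congr 1
        rw [hl]
        field_simp
        ring

end Kernel

/-! ### Dynamics on the tree and the probability of a flip event. -/

section Dynamics

variable {V Ω : Type*} {d : ℕ → ℕ} {p : ℕ → ℝ} {ε : ℝ} {D : ℕ}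

/-- The set of open vertices (that is, edges above them) at time `t`. -/
def cfg (t : ℝ≥0) (y : V → ℝ≥0 → Bool) : Set V := {v | RightOpen t (y v) ∨ LeftOpen t (y v)}

lemma measurable_cfg : Measurable fun z : ℝ≥0 × (V → ℝ≥0 → Bool) => cfg z.1 z.2 := by
  refine measurable_set_iff.2 fun v => measurableSet_setOfPred.1 ?_
  have h : Measurable fun z : ℝ≥0 × (V → ℝ≥0 → Bool) => (z.1, z.2 v) :=
    measurable_fst.prodMk ((measurable_pi_apply v).comp measurable_snd)
  exact h measurableSet_rightOpen_or_leftOpen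

/-- Independent stationary two-state chains attached to the non-root vertices of a tree. -/
structure IsTreeDynamics [MeasurableSpace Ω] (T : RootedTree V d) (p : ℕ → ℝ) (x : V → Ω → ℝ≥0 → Bool)
    (P : Measure Ω) : Prop where
  indep : iIndepFun x P
  chain : ∀ v ≠ T.root, IsTwoStateChain (p (T.lev v)) (x v) P
  root : x T.root = fun _ _ => true

/-- The first switching time of `v`. -/
noncomputable def firstJump (x : V → Ω → ℝ≥0 → Bool) (v : V) (ω : Ω) : ENNReal :=
  jumpAfter 0 (x v ω)

/-- The first switching time of `v` comes before time `1`, and at this time `v` decides whether the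
root percolates. -/
def flipEvent (T : RootedTree V d) (x : V → Ω → ℝ≥0 → Bool) (v : V) : Set Ω :=
  {ω | firstJump x v ω ≤ 1 ∧ cfg (firstJump x v ω).toNNReal (fun u => x u ω) ∈ T.pivot v}

lemma adapted_cfg (x : V → Ω → ℝ≥0 → Bool) (t : ℝ≥0) :
    Adapted (fun v => MeasurableSpace.comap (x v) MeasurableSpace.pi)
      fun ω => cfg t fun v => x v ω :=
  fun _ => ⟨{z | RightOpen t z ∨ LeftOpen t z},
    measurable_prodMk_left measurableSet_rightOpen_or_leftOpen, rfl⟩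

lemma measurable_blk_firstJump (x : V → Ω → ℝ≥0 → Bool) {v : V} {A : Set V} (hv : v ∈ A) :
    Measurable[blk (fun v => MeasurableSpace.comap (x v) MeasurableSpace.pi) A] (firstJump x v) :=
  ((measurable_jumpAfter 0).comp (comap_measurable (x v))).mono
    (le_blk (m := fun v => MeasurableSpace.comap (x v) MeasurableSpace.pi) hv) le_rfl

namespace IsTreeDynamics

variable [MeasurableSpace Ω] {T : RootedTree V d} {x : V → Ω → ℝ≥0 → Bool} {P : Measure Ω} [IsProbabilityMeasure P]
  (hX : IsTreeDynamics T p x P)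
include hX

omit [IsProbabilityMeasure P] in
lemma measurable (v : V) : Measurable (x v) := by
  by_cases hv : v = T.root
  · rw [hv, hX.root]; exact measurable_const
  · exact (hX.chain v hv).measurable

omit [IsProbabilityMeasure P] in
lemma measurable_all : Measurable fun ω v => x v ω :=
  measurable_pi_lambda _ hX.measurable

omit [IsProbabilityMeasure P] in
lemma measurable_firstJump (v : V) : Measurable (firstJump x v) :=
  (measurable_jumpAfter 0).comp (hX.measurable v)

variable (h : GoodParams d p ε D) (hp0 : p 0 = 1)

include h hp0 in
lemma real_mem_cfg (t : ℝ≥0) (v : V) :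
    P.real {ω | v ∈ cfg t fun v => x v ω} = p (T.lev v) := by
  by_cases hv : v = T.root
  · subst hv
    rw [T.lev_root, hp0]
    have : {ω | T.root ∈ cfg t fun v => x v ω} = Set.univ := by
      ext ω
      simp only [cfg, hX.root, Set.mem_ofPred_eq, Set.mem_univ, iff_true]
      exact Or.inl ⟨0, fun _ _ _ => rfl⟩
    rw [this, probReal_univ]
  · refine (hX.chain v hv).real_open' h.eps_pos (h.prob _ ?_) t
    rw [T.lev_par hv]; omega

include h in
lemma real_mem_cfg_both {s t : ℝ≥0} (hs : s ≤ 1) (ht : t ≤ 1) (v : V) (hv : v ≠ T.root) :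
    P.real {ω | (v ∈ cfg s fun v => x v ω) ∧ v ∈ cfg t fun v => x v ω} ≤
      p (T.lev v) * Real.exp (-(ε / 2 * dist s t)) := by
  refine (hX.chain v hv).real_both_open_le h.eps_pos (h.prob _ ?_) hs ht
  rw [T.lev_par hv]; omega

omit [IsProbabilityMeasure P] in
lemma comap_le (v : V) : MeasurableSpace.comap (x v) MeasurableSpace.pi ≤ ‹MeasurableSpace Ω› :=
  (hX.measurable v).comap_le

include h hp0 in
lemma real_pivot_cfg (t : ℝ≥0) (v : V) :
    P.real {ω | cfg t (fun v => x v ω) ∈ T.pivot v} = pivotProb d p (T.lev v) :=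
  T.real_pivot hX.comap_le ((iIndepFun_iff_iIndep _ _ _).1 hX.indep) (adapted_cfg x t)
    (hX.real_mem_cfg h hp0 t) h.prob_nonneg v

omit [IsProbabilityMeasure P] in
lemma measurableSet_flipEvent (v : V) : MeasurableSet (flipEvent T x v) := by
  refine (measurableSet_le (hX.measurable_firstJump v) measurable_const).inter ?_
  have : Measurable fun ω => ((firstJump x v ω).toNNReal, fun u => x u ω) :=
    (hX.measurable_firstJump v).ennreal_toNNReal.prodMk hX.measurable_all
  exact (measurable_cfg.comp this) (T.measurableSet_pivot v)

-- Conditionally on the first switching time of v, the configuration away from v keeps its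
-- stationary law, so the pivot probability is the same at each value of that time.
include h hp0 in
lemma real_flipEvent (v : V) : P.real (flipEvent T x v) =
    P.real {ω | firstJump x v ω ≤ 1} * pivotProb d p (T.lev v) := by
  have h1 := measure_eq_lintegral_of_indep hX.measurable hX.indep (F := {v})
    (measurable_blk_firstJump x (Set.mem_singleton v))
    (G := {z | z.1 ≤ 1 ∧ cfg z.1.toNNReal z.2 ∈ T.pivot v})
    (by
      refine (measurableSet_le measurable_fst measurable_const).inter ?_
      exact (measurable_cfg.comp (measurable_fst.ennreal_toNNReal.prodMk measurable_snd))
        (T.measurableSet_pivot v))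
    (fun b y y' hy => and_congr_right fun _ => T.pivot_congr fun u hu => by
      simp only [cfg, Set.mem_ofPred_eq, hy u hu])
  have h2 : ∀ b : ENNReal, P {ω | (b, fun v => x v ω) ∈
      {z : ENNReal × (V → ℝ≥0 → Bool) | z.1 ≤ 1 ∧ cfg z.1.toNNReal z.2 ∈ T.pivot v}} =
      (Set.Iic (1 : ENNReal)).indicator (fun _ => ENNReal.ofReal (pivotProb d p (T.lev v))) b := by
    intro b
    by_cases hb : b ≤ 1
    · rw [Set.indicator_of_mem (show b ∈ Set.Iic (1 : ENNReal) from hb),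
        ← hX.real_pivot_cfg h hp0 b.toNNReal v, ofReal_measureReal (measure_ne_top _ _)]
      simp [hb]
    · rw [Set.indicator_of_notMem (show b ∉ Set.Iic (1 : ENNReal) from hb)]
      simp [hb]
  rw [lintegral_congr h2, lintegral_indicator measurableSet_Iic, setLIntegral_const,
    Measure.map_apply (hX.measurable_firstJump v) measurableSet_Iic] at h1
  have h3 : P.real (flipEvent T x v) = (P {ω | firstJump x v ω ≤ 1 ∧
    cfg (firstJump x v ω).toNNReal (fun u => x u ω) ∈ T.pivot v}).toReal := rfl
  have hf : 0 ≤ pivotProb d p (T.lev v) := by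
    rw [← hX.real_pivot_cfg h hp0 0 v]; exact measureReal_nonneg
  rw [h3]
  refine (congrArg ENNReal.toReal h1).trans ?_
  rw [ENNReal.toReal_mul, ENNReal.toReal_ofReal hf, mul_comm]
  rfl

end IsTreeDynamics

end Dynamics

/-- `K / (e + 1)` bounds the integral of `exp (-(ε / 2) |s - t|) ^ e` over `t ∈ [0, 1]` against any
measure giving intervals at most twice their length. -/
def KernelBound (ε K : ℝ) : Prop := ∀ (ν : Measure ENNReal),
    (∀ a b : ℝ≥0, a < b → ν (Set.Icc (a : ENNReal) b) ≤ ENNReal.ofReal (2 * ((b : ℝ) - a))) →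
    ∀ (e : ℕ) (s : ℝ≥0), s ≤ 1 → ∫⁻ b in Set.Iic 1, ENNReal.ofReal
      (Real.exp (-(ε / 2 * dist s b.toNNReal)) ^ e) ∂ν ≤ ENNReal.ofReal (K / (e + 1))

lemma GoodParams.pivotProb_pos {d : ℕ → ℕ} {p : ℕ → ℝ} {ε : ℝ} {D : ℕ} (h : GoodParams d p ε D)
    (hp0 : p 0 = 1) (n : ℕ) : 0 < pivotProb d p n := by
  refine mul_pos (h.survLim_pos _) (mul_pos (h.isoProb_pos _) (Finset.prod_pos fun j _ => ?_))
  rcases Nat.eq_zero_or_pos j with rfl | hj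
  · rw [hp0]; exact one_pos
  · exact (h.prob_pos j hj).1

/-! ### Joint probabilities of two flip events. -/

namespace IsTreeDynamics

variable {V Ω : Type*} [MeasurableSpace Ω] {d : ℕ → ℕ} {p : ℕ → ℝ} {ε K : ℝ} {D : ℕ}
  {T : RootedTree V d} {x : V → Ω → ℝ≥0 → Bool} {P : Measure Ω} [IsProbabilityMeasure P]
  (hX : IsTreeDynamics T p x P) (h : GoodParams d p ε D) (hp0 : p 0 = 1)
  (hK0 : 0 < K) (hK : KernelBound ε K)
include hX h

lemma map_firstJump_Icc_le {v : V} (hv : v ≠ T.root) (a b : ℝ≥0) (hab : a < b) :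
    (P.map (firstJump x v)) (Set.Icc (a : ENNReal) b) ≤ ENNReal.ofReal (2 * ((b : ℝ) - a)) := by
  rw [Measure.map_apply (hX.measurable_firstJump v) measurableSet_Icc]
  refine (hX.chain v hv).measure_jumpAfter_mem_Icc_le h.eps_pos (h.prob _ ?_) hab
  rw [T.lev_par hv]; omega

-- The two switching times are independent of each other, and jointly independent of the coordinates
-- that H sees. For fixed s the kernel bound handles the integral over t, and the remaining integral
-- over s has total mass 1.
include hK0 hK in
lemma real_pair_le {u v : V} (huv : u ≠ v) (hv : v ≠ T.root) {H : Set (Set V × Set V)}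
    (hH : MeasurableSet H)
    (hcongr : ∀ z z' : Set V × Set V, (∀ y, y ≠ u → y ≠ v → (y ∈ z.1 ↔ y ∈ z'.1)) →
      (∀ y, y ≠ u → y ≠ v → (y ∈ z.2 ↔ y ∈ z'.2)) → (z ∈ H ↔ z' ∈ H))
    {B : ℝ} (hB : 0 ≤ B) {e : ℕ}
    (hbound : ∀ s t : ℝ≥0, s ≤ 1 → t ≤ 1 →
      P.real {ω | (cfg s (fun v => x v ω), cfg t (fun v => x v ω)) ∈ H} ≤
        B * Real.exp (-(ε / 2 * dist s t)) ^ e) :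
    P.real {ω | (firstJump x u ω ≤ 1 ∧ firstJump x v ω ≤ 1) ∧
      (cfg (firstJump x u ω).toNNReal (fun v => x v ω),
        cfg (firstJump x v ω).toNNReal (fun v => x v ω)) ∈ H} ≤ B * (K / (e + 1)) := by
  have hI : IndepFun (firstJump x u) (firstJump x v) P :=
    (hX.indep.indepFun huv).comp (measurable_jumpAfter 0) (measurable_jumpAfter 0)
  have hmu := hX.measurable_firstJump u
  have hmv := hX.measurable_firstJump v
  have hmap := (indepFun_iff_map_prod_eq_prod_map_map hmu.aemeasurable hmv.aemeasurable).1 hI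
  have hmu' : Measurable[blk (fun v => MeasurableSpace.comap (x v) MeasurableSpace.pi) {u, v}]
      (firstJump x u) := measurable_blk_firstJump x (by simp)
  have hmv' : Measurable[blk (fun v => MeasurableSpace.comap (x v) MeasurableSpace.pi) {u, v}]
      (firstJump x v) := measurable_blk_firstJump x (by simp)
  set G : Set ((ENNReal × ENNReal) × (V → ℝ≥0 → Bool)) := {z | (z.1.1 ≤ 1 ∧ z.1.2 ≤ 1) ∧
    (cfg z.1.1.toNNReal z.2, cfg z.1.2.toNNReal z.2) ∈ H} with hG
  have hGm : MeasurableSet G := by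
    have h1 : Measurable fun z : (ENNReal × ENNReal) × (V → ℝ≥0 → Bool) =>
        (cfg z.1.1.toNNReal z.2, cfg z.1.2.toNNReal z.2) :=
      (measurable_cfg.comp (measurable_fst.fst.ennreal_toNNReal.prodMk measurable_snd)).prodMk
        (measurable_cfg.comp (measurable_fst.snd.ennreal_toNNReal.prodMk measurable_snd))
    exact ((measurableSet_le measurable_fst.fst measurable_const).inter
      (measurableSet_le measurable_fst.snd measurable_const)).inter (h1 hH)
  have h1 := measure_eq_lintegral_of_indep hX.measurable hX.indep (F := {u, v})
    (hmu'.prodMk hmv') hGm (fun b y y' hy => and_congr_right fun _ => hcongr _ _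
      (fun w h1 h2 => by
        simp only [cfg, Set.mem_ofPred_eq]
        rw [hy w (by simp [h1, h2])])
      (fun w h1 h2 => by
        simp only [cfg, Set.mem_ofPred_eq]
        rw [hy w (by simp [h1, h2])]))
  set g : ENNReal → ENNReal → ENNReal := fun a b => ENNReal.ofReal B *
    ENNReal.ofReal (Real.exp (-(ε / 2 * dist a.toNNReal b.toNNReal)) ^ e) with hg
  have hgm : Measurable fun z : ENNReal × ENNReal => g z.1 z.2 := by
    have : Measurable fun z : ENNReal × ENNReal => dist z.1.toNNReal z.2.toNNReal :=
      measurable_fst.ennreal_toNNReal.dist measurable_snd.ennreal_toNNReal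
    exact ((((this.const_mul _).neg.exp).pow_const e).ennreal_ofReal).const_mul _
  have hle : ∀ b : ENNReal × ENNReal, P {ω | (b, fun v => x v ω) ∈ G} ≤
      (Set.Iic (1 : ENNReal) ×ˢ Set.Iic (1 : ENNReal)).indicator (fun z => g z.1 z.2) b := by
    rintro ⟨a, b⟩
    by_cases hab : a ≤ 1 ∧ b ≤ 1
    · rw [Set.indicator_of_mem (Set.mk_mem_prod (show a ∈ Set.Iic (1 : ENNReal) from hab.1)
          (show b ∈ Set.Iic (1 : ENNReal) from hab.2))]
      have ha : a.toNNReal ≤ 1 := by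
        have := ENNReal.toNNReal_mono ENNReal.one_ne_top hab.1
        simpa using this
      have hb : b.toNNReal ≤ 1 := by
        have := ENNReal.toNNReal_mono ENNReal.one_ne_top hab.2
        simpa using this
      simp only [hg]
      rw [← ENNReal.ofReal_mul hB]
      refine le_trans (measure_mono fun ω hω => hω.2) ?_
      refine le_trans (le_of_eq (ofReal_measureReal (measure_ne_top _ _)).symm)
        (ENNReal.ofReal_le_ofReal (hbound _ _ ha hb))
    · have : {ω | ((a, b), fun v => x v ω) ∈ G} = ∅ := by
        ext ω; simp only [hG, Set.mem_ofPred_eq, Set.mem_empty_iff_false, iff_false]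
        exact fun h => hab h.1
      rw [this, measure_empty]
      exact zero_le
  have h2 : P {ω | ((firstJump x u ω, firstJump x v ω), fun v => x v ω) ∈ G} ≤
      ENNReal.ofReal (B * (K / (e + 1))) := by
    rw [h1]
    refine (lintegral_mono hle).trans ?_
    rw [hmap, lintegral_prod _ (hgm.indicator (measurableSet_Iic.prod
      measurableSet_Iic)).aemeasurable]
    have h3 : ∀ a : ENNReal, ∫⁻ b, (Set.Iic (1 : ENNReal) ×ˢ Set.Iic (1 : ENNReal)).indicator
        (fun z => g z.1 z.2) (a, b) ∂(P.map (firstJump x v)) ≤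
        ENNReal.ofReal (B * (K / (e + 1))) := by
      intro a
      by_cases ha : a ≤ 1
      · have ha' : a.toNNReal ≤ 1 := by
          have := ENNReal.toNNReal_mono ENNReal.one_ne_top ha
          simpa using this
        have e1 : (fun b => (Set.Iic (1 : ENNReal) ×ˢ Set.Iic (1 : ENNReal)).indicator
            (fun z => g z.1 z.2) (a, b)) = (Set.Iic (1 : ENNReal)).indicator (g a) := by
          ext b
          by_cases hb : b ≤ 1
          · rw [Set.indicator_of_mem (Set.mk_mem_prod (show a ∈ Set.Iic (1 : ENNReal) from ha)
              (show b ∈ Set.Iic (1 : ENNReal) from hb)),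
              Set.indicator_of_mem (show b ∈ Set.Iic (1 : ENNReal) from hb)]
          · rw [Set.indicator_of_notMem (fun hh => hb hh.2),
              Set.indicator_of_notMem (show b ∉ Set.Iic (1 : ENNReal) from hb)]
        rw [e1, lintegral_indicator measurableSet_Iic, lintegral_const_mul',
          ENNReal.ofReal_mul hB]
        · gcongr
          exact hK _ (hX.map_firstJump_Icc_le h hv) e _ ha'
        · exact ENNReal.ofReal_ne_top
      · have e1 : (fun b => (Set.Iic (1 : ENNReal) ×ˢ Set.Iic (1 : ENNReal)).indicator
            (fun z => g z.1 z.2) (a, b)) = fun _ => 0 := by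
          ext b
          rw [Set.indicator_of_notMem (fun hh => ha hh.1)]
        rw [e1, lintegral_zero]
        exact zero_le
    refine (lintegral_mono h3).trans ?_
    rw [lintegral_const, Measure.map_apply hmu MeasurableSet.univ, Set.preimage_univ, measure_univ,
      mul_one]
  exact ENNReal.toReal_le_of_le_ofReal (by positivity) h2

include hp0 hK0 hK

lemma real_flipEvent_meet_le {u v : V} {k : ℕ} (hku : k < T.lev u) (hkv : k < T.lev v)
    (hk : T.anc u k = T.anc v k) (hk1 : T.anc u (k + 1) ≠ T.anc v (k + 1)) :
    P.real (flipEvent T x u ∩ flipEvent T x v) ≤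
      (1 / ε ^ D) ^ 2 * pivotProb d p (T.lev u) * pivotProb d p (T.lev v) /
      (isoProb d p k * ∏ j ∈ Finset.range (k + 1), p j) * (K / (k + 1)) := by
  have hm := (iIndepFun_iff_iIndep _ _ _).1 hX.indep
  have hroot : ∀ {a : V}, k < T.lev a → a ≠ T.root := fun hka hne => by
    rw [hne, T.lev_root] at hka; omega
  have huv : u ≠ v := by rintro rfl; exact hk1 rfl
  refine (measureReal_mono ?_ (measure_ne_top _ _)).trans (hX.real_pair_le h hK0 hK huv (hroot hkv)
    (T.measurableSet_meetEvent u v k) (fun z z' h1 h2 => T.meetEvent_congr hku hkv hk hk1 h1 h2)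
    ?_ ?_)
  · rintro ω ⟨h1, h2⟩
    exact ⟨⟨h1.1, h2.1⟩, T.mem_meetEvent hku hkv hk h1.2 h2.2⟩
  · have h1 := (h.pivotProb_pos hp0 (T.lev u)).le
    have h2 := (h.pivotProb_pos hp0 (T.lev v)).le
    have h3 := h.isoProb_pos k
    have h4 := h.eps_pos
    have h5 : 0 ≤ ∏ j ∈ Finset.range (k + 1), p j := Finset.prod_nonneg fun j _ => by
      rcases Nat.eq_zero_or_pos j with rfl | hj
      · rw [hp0]; exact zero_le_one
      · exact (h.prob_pos j hj).1.le
    positivity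
  · intro s t hs ht
    refine (T.real_meetEvent_le (ρ := Real.exp (-(ε / 2 * dist s t))) h hp0 hX.comap_le hm
      (adapted_cfg x s) (adapted_cfg x t) (hX.real_mem_cfg h hp0 s) (hX.real_mem_cfg h hp0 t)
      (Real.exp_pos _).le (fun v hv => hX.real_mem_cfg_both h hs ht v hv) hku hkv hk hk1).trans
      (le_of_eq ?_)
    ring

/-- Union bound over the level r at which the infinite path below the ancestor leaves the path to v.
The term 2/`T.lev v` is the case where it never leaves above v. -/
lemma real_flipEvent_anc_le {v : V} {i : ℕ} (hi0 : 1 ≤ i) (hi : i < T.lev v) :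
    P.real (flipEvent T x (T.anc v i) ∩ flipEvent T x v) ≤
      K * (1 + D / ε ^ D) / ε * pivotProb d p (T.lev v) * (2 / T.lev v +
        ∑ r ∈ Finset.Ico i (T.lev v), linkProb d p r / r) := by
  have hm := (iIndepFun_iff_iIndep _ _ _).1 hX.indep
  have hε := h.eps_pos
  have hf := h.pivotProb_pos hp0 (T.lev v)
  have huv : T.anc v i ≠ v := by
    have := T.anc_ne_of_lt hi le_rfl hi.ne
    rwa [T.anc_lev] at this
  have hvr : v ≠ T.root := fun hne => by rw [hne, T.lev_root] at hi; omega
  set c : ℕ → ℝ := fun r => pivotProb d p (T.lev v) *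
    ((1 / ε) * (if r < T.lev v then D / ε ^ D * linkProb d p r else 1)) with hc
  have hc0 : ∀ r, 0 ≤ c r := fun r => by
    have := h.linkProb_pos r
    simp only [hc]
    split_ifs <;> positivity
  have hlev : ∀ r ∈ Finset.Icc i (T.lev v), P.real {ω | (firstJump x (T.anc v i) ω ≤ 1 ∧
      firstJump x v ω ≤ 1) ∧ (cfg (firstJump x (T.anc v i) ω).toNNReal (fun v => x v ω),
        cfg (firstJump x v ω).toNNReal (fun v => x v ω)) ∈ T.leaveEvent v i r} ≤
      c r * (K / ((min r (T.lev v - 1) - 1 : ℕ) + 1)) := by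
    intro r hr
    refine hX.real_pair_le h hK0 hK huv hvr (T.measurableSet_leaveEvent v i r)
      (fun z z' h1 h2 => T.leaveEvent_congr hi h1 h2) (hc0 r) fun s t hs ht => ?_
    refine (T.real_leaveEvent_le (ρ := Real.exp (-(ε / 2 * dist s t))) h hp0 hX.comap_le hm
      (adapted_cfg x s) (adapted_cfg x t) (hX.real_mem_cfg h hp0 s) (hX.real_mem_cfg h hp0 t)
      (Real.exp_pos _).le (Real.exp_le_one_iff.2 ?_)
      (fun v hv => hX.real_mem_cfg_both h hs ht v hv) hi0 (Finset.mem_Icc.1 hr).1).trans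
      (le_of_eq ?_)
    · have : 0 ≤ ε / 2 * dist s t := by positivity
      linarith
    · simp only [hc]; ring
  have hsub : flipEvent T x (T.anc v i) ∩ flipEvent T x v ⊆ ⋃ r ∈ Finset.Icc i (T.lev v),
      {ω | (firstJump x (T.anc v i) ω ≤ 1 ∧
      firstJump x v ω ≤ 1) ∧ (cfg (firstJump x (T.anc v i) ω).toNNReal (fun v => x v ω),
        cfg (firstJump x v ω).toNNReal (fun v => x v ω)) ∈ T.leaveEvent v i r} := by
    rintro ω ⟨h1, h2⟩
    obtain ⟨r, hr, h3⟩ := T.exists_level_of_pivot_of_pivot hi h1.2 h2.2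
    exact Set.mem_biUnion hr ⟨⟨h1.1, h2.1⟩, h3⟩
  refine (measureReal_mono hsub (measure_ne_top _ _)).trans
    ((measureReal_biUnion_finset_le _ _).trans ?_)
  refine (Finset.sum_le_sum hlev).trans ?_
  have e : Finset.Icc i (T.lev v) = insert (T.lev v) (Finset.Ico i (T.lev v)) := by
    ext j; simp; omega
  have hK' : 0 ≤ (D : ℝ) / ε ^ D := by positivity
  rw [e, Finset.sum_insert (by simp), mul_add, Finset.mul_sum]
  refine add_le_add ?_ (Finset.sum_le_sum fun r hr => ?_)
  -- Case r = `T.lev v` = n: there are at least n - 2 doubly open levels, so the kernel gives K/(n -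
  -- 1) ≤ 2K/n, as n ≥ 2.
  · have e2 : min (T.lev v) (T.lev v - 1) - 1 + 1 = T.lev v - 1 := by omega
    have e3 : (((min (T.lev v) (T.lev v - 1) - 1 : ℕ) : ℝ) + 1) = (T.lev v : ℝ) - 1 := by
      rw [← Nat.cast_succ, Nat.succ_eq_add_one, e2, Nat.cast_sub (by omega)]; simp
    have h2 : (2 : ℝ) ≤ T.lev v := by exact_mod_cast (by omega : 2 ≤ T.lev v)
    rw [e3]
    simp only [hc, lt_irrefl, if_false, mul_one]
    have h3 : K / ((T.lev v : ℝ) - 1) ≤ K * (2 / T.lev v) := by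
      rw [mul_div_assoc', div_le_div_iff₀ (by linarith) (by linarith)]
      nlinarith
    calc pivotProb d p (T.lev v) * (1 / ε) * (K / ((T.lev v : ℝ) - 1))
        ≤ pivotProb d p (T.lev v) * ((1 + D / ε ^ D) / ε) * (K * (2 / T.lev v)) := by
          have : 0 ≤ K / ((T.lev v : ℝ) - 1) := div_nonneg hK0.le (by linarith)
          gcongr; linarith
      _ = _ := by ring
  · have hr' := Finset.mem_Ico.1 hr
    have e2 : min r (T.lev v - 1) - 1 + 1 = r := by omega
    have e3 : (((min r (T.lev v - 1) - 1 : ℕ) : ℝ) + 1) = r := by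
      rw [← Nat.cast_succ, Nat.succ_eq_add_one, e2]
    rw [e3]
    simp only [hc, hr'.2, if_true]
    have h4 := h.linkProb_pos r
    calc pivotProb d p (T.lev v) * (1 / ε * (D / ε ^ D * linkProb d p r)) * (K / r)
        = K * (D / ε ^ D) / ε * pivotProb d p (T.lev v) * (linkProb d p r / r) := by ring
      _ ≤ _ := by gcongr; linarith

end IsTreeDynamics

/-! ### The second moment method. -/

section SecondMoment

variable {V Ω : Type*} [MeasurableSpace Ω] {P : Measure Ω} [IsProbabilityMeasure P]

/-- Paley–Zygmund inequality for a sum of indicators. -/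
lemma le_real_sum_indicator_gt {A : V → Set Ω} (hA : ∀ v, MeasurableSet (A v)) (B : Finset V)
    {k : ℝ} (hk : 0 ≤ k) {l : ℝ} (hl : 0 < l) :
    ∑ v ∈ B, P.real (A v) ≤ k + l / 2 * (∑ u ∈ B, ∑ v ∈ B, P.real (A u ∩ A v)) +
      P.real {ω | k < ∑ v ∈ B, (A v).indicator (fun _ => (1 : ℝ)) ω} / (2 * l) := by
  set Z : Ω → ℝ := fun ω => ∑ v ∈ B, (A v).indicator (fun _ => (1 : ℝ)) ω with hZ
  have hi : ∀ E : Set Ω, MeasurableSet E → Integrable (E.indicator fun _ => (1 : ℝ)) P :=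
    fun E hE => (integrable_const 1).indicator hE
  have hie : ∀ E : Set Ω, MeasurableSet E → ∫ ω, E.indicator (fun _ => (1 : ℝ)) ω ∂P = P.real E :=
    fun E hE => by rw [integral_indicator_const _ hE, smul_eq_mul, mul_one]
  have hZm : Measurable Z := Finset.measurable_sum _ fun v _ => measurable_const.indicator (hA v)
  have hF : MeasurableSet {ω | k < Z ω} := measurableSet_lt measurable_const hZm
  have hsq : ∀ ω, Z ω ^ 2 =
      ∑ u ∈ B, ∑ v ∈ B, (A u ∩ A v).indicator (fun _ => (1 : ℝ)) ω := fun ω => by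
    rw [sq, hZ, Finset.sum_mul_sum]
    refine Finset.sum_congr rfl fun u _ => Finset.sum_congr rfl fun v _ => ?_
    rw [← Set.inter_indicator_mul]
    simp
  have hZi : Integrable Z P := integrable_finsetSum _ fun v _ => hi _ (hA v)
  have hS : Integrable (fun ω => Z ω ^ 2) P := by
    simp only [hsq]
    exact integrable_finsetSum _ fun u _ => integrable_finsetSum _ fun v _ =>
      hi _ ((hA u).inter (hA v))
  have hpt : ∀ ω, Z ω ≤ k + l / 2 * Z ω ^ 2 +
      1 / (2 * l) * {ω | k < Z ω}.indicator (fun _ => (1 : ℝ)) ω := by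
    intro ω
    by_cases hω : k < Z ω
    · rw [Set.indicator_of_mem (show ω ∈ {ω | k < Z ω} from hω)]
      -- The inequality Z ≤ l Z^2/2 + 1/(2l) with a free parameter l replaces Cauchy–Schwarz.
      have : Z ω ≤ l / 2 * Z ω ^ 2 + 1 / (2 * l) := by
        have h1 : l / 2 * Z ω ^ 2 + 1 / (2 * l) - Z ω = (l * Z ω - 1) ^ 2 / (2 * l) := by
          field_simp; ring
        have h2 : 0 ≤ (l * Z ω - 1) ^ 2 / (2 * l) := by positivity
        linarith
      linarith
    · rw [Set.indicator_of_notMem (show ω ∉ {ω | k < Z ω} from hω)]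
      have : 0 ≤ l / 2 * Z ω ^ 2 := by positivity
      linarith [not_lt.1 hω]
  have h := integral_mono hZi (((integrable_const k).add (hS.const_mul (l / 2))).add
    ((hi _ hF).const_mul (1 / (2 * l)))) hpt
  have e1 : ∫ ω, Z ω ∂P = ∑ v ∈ B, P.real (A v) := by
    rw [hZ, integral_finsetSum _ fun v _ => hi _ (hA v)]
    exact Finset.sum_congr rfl fun v _ => hie _ (hA v)
  have e2 : ∫ ω, Z ω ^ 2 ∂P = ∑ u ∈ B, ∑ v ∈ B, P.real (A u ∩ A v) := by
    simp only [hsq]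
    rw [integral_finsetSum _ fun u _ => integrable_finsetSum _ fun v _ =>
      hi _ ((hA u).inter (hA v))]
    refine Finset.sum_congr rfl fun u _ => ?_
    rw [integral_finsetSum _ fun v _ => hi _ ((hA u).inter (hA v))]
    exact Finset.sum_congr rfl fun v _ => hie _ ((hA u).inter (hA v))
  have e3 : ∫ ω, (k + l / 2 * Z ω ^ 2 + 1 / (2 * l) * {ω | k < Z ω}.indicator
      (fun _ => (1 : ℝ)) ω) ∂P = k + l / 2 * (∑ u ∈ B, ∑ v ∈ B, P.real (A u ∩ A v)) +
      P.real {ω | k < Z ω} / (2 * l) := by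
    have hi1 : Integrable (fun ω => k + l / 2 * Z ω ^ 2) P :=
      (integrable_const k).add (hS.const_mul (l / 2))
    rw [integral_add hi1 ((hi _ hF).const_mul (1 / (2 * l))), integral_add (integrable_const k) (hS.const_mul _),
      integral_const_mul, integral_const_mul, e2, hie _ hF]
    simp
    ring
  rw [← e1, ← e3]
  exact h

/-- A version of the Kochen–Stone lemma. -/
theorem measure_infinite_pos_of_second_moment {A : V → Set Ω} (hA : ∀ v, MeasurableSet (A v))
    {B : ℕ → Finset V} {M : ℕ → ℝ} (hM : Tendsto M atTop atTop) {b C : ℝ} (hb : 0 < b) (hC : 0 < C)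
    (h1 : ∀ N, b * M N ≤ ∑ v ∈ B N, P.real (A v))
    (h2 : ∀ N, 0 ≤ M N → ∑ u ∈ B N, ∑ v ∈ B N, P.real (A u ∩ A v) ≤ C * (1 + M N) ^ 2) :
    0 < P {ω | {v | ω ∈ A v}.Infinite} := by
  set Z : ℕ → Ω → ℝ := fun N ω => ∑ v ∈ B N, (A v).indicator (fun _ => (1 : ℝ)) ω with hZ
  have hZm : ∀ N, Measurable (Z N) := fun N =>
    Finset.measurable_sum _ fun v _ => measurable_const.indicator (hA v)
  set E : ℕ → Set Ω := fun k => {ω | ∀ N, Z N ω ≤ k} with hE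
  have hEm : ∀ k, MeasurableSet (E k) := fun k => by
    have : E k = ⋂ N, {ω | Z N ω ≤ k} := by ext; simp [hE]
    rw [this]
    exact MeasurableSet.iInter fun N => measurableSet_le (hZm N) measurable_const
  have hEmono : Monotone E := fun k l hkl ω hω N =>
    (hω N).trans (by exact_mod_cast hkl)
  have hbound : ∀ k, P (E k) ≤ ENNReal.ofReal (1 - b ^ 2 / (8 * C)) := by
    intro k
    obtain ⟨N, hN1, hN2⟩ := ((hM.eventually_ge_atTop 1).and
      (hM.eventually_ge_atTop (4 * k / b))).exists
    have hM0 : 0 < M N := by linarith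
    -- This l makes the second moment term at most b M/4; M is also taken so large that k ≤ b M/4.
    -- Half of the first moment remains, which bounds the probability of exceeding k below by
    -- b^2/(8C), uniformly in k.
    have h3 := le_real_sum_indicator_gt (P := P) hA (B N) (Nat.cast_nonneg k)
      (show 0 < b / (8 * C * M N) by positivity)
    have h4 := (h1 N).trans h3
    have h5 : ∑ u ∈ B N, ∑ v ∈ B N, P.real (A u ∩ A v) ≤ C * (2 * M N) ^ 2 :=
      (h2 N hM0.le).trans (by gcongr; linarith)
    have h6 : b / (8 * C * M N) / 2 * (∑ u ∈ B N, ∑ v ∈ B N, P.real (A u ∩ A v)) ≤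
        b * M N / 4 := by
      refine (mul_le_mul_of_nonneg_left h5 (by positivity)).trans (le_of_eq ?_)
      field_simp; ring
    have h7 : (k : ℝ) ≤ b * M N / 4 := by
      rw [div_le_iff₀ hb] at hN2; linarith
    set q := P.real {ω | (k : ℝ) < Z N ω} with hq
    have h8 : b * M N / 2 ≤ q * (4 * C * M N / b) := by
      have : q / (2 * (b / (8 * C * M N))) = q * (4 * C * M N / b) := by field_simp; ring
      rw [← this]; linarith
    have h9 : b ^ 2 / (8 * C) ≤ q := by
      rw [div_le_iff₀ (by positivity)]
      have h10 : q * (4 * C * M N / b) * b = q * (4 * C) * M N := by field_simp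
      have h11 : b * M N / 2 * b ≤ q * (4 * C) * M N := by
        rw [← h10]; exact mul_le_mul_of_nonneg_right h8 hb.le
      have : b ^ 2 / 2 ≤ q * (4 * C) := by
        refine le_of_mul_le_mul_right ?_ hM0
        calc _ = b * M N / 2 * b := by ring
          _ ≤ _ := h11
      linarith
    have h12 : P.real (E k) ≤ 1 - q := by
      rw [hq, ← probReal_compl_eq_one_sub (measurableSet_lt measurable_const (hZm N))]
      exact measureReal_mono (fun ω hω => not_lt.2 (hω N)) (measure_ne_top _ _)
    rw [← ofReal_measureReal (measure_ne_top _ _)]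
    exact ENNReal.ofReal_le_ofReal (by linarith)
  have hU : P (⋃ k, E k) < 1 := by
    rw [hEmono.measure_iUnion]
    refine (iSup_le hbound).trans_lt ?_
    have : 0 < b ^ 2 / (8 * C) := by positivity
    rw [← ENNReal.ofReal_one]
    exact (ENNReal.ofReal_lt_ofReal_iff one_pos).2 (by linarith)
  have hc : 0 < P (⋃ k, E k)ᶜ := by
    rw [prob_compl_eq_one_sub (MeasurableSet.iUnion hEm)]
    exact tsub_pos_of_lt hU
  refine hc.trans_le (measure_mono fun ω hω => ?_)
  intro hfin
  -- If only finitely many events occurred, their number would bound all the partial counts.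
  refine hω (Set.mem_iUnion.2 ⟨hfin.toFinset.card, fun N => ?_⟩)
  classical
  simp only [hZ, Set.indicator_apply]
  rw [Finset.sum_boole]
  exact_mod_cast Finset.card_le_card fun v hv => by
    simpa using (Finset.mem_filter.1 hv).2

end SecondMoment

/-! ### Counting vertices and pairs by level. -/

namespace RootedTree

variable {V : Type*} {d : ℕ → ℕ} (T : RootedTree V d)

open Classical in
/-- The descendants of `c` which are `n` levels below `c`. -/
noncomputable def below (c : V) : ℕ → Finset V
  | 0 => {c}
  | n + 1 => (below c n).biUnion T.ch

lemma mem_below {c y : V} {n : ℕ} :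
    y ∈ T.below c n ↔ T.lev y = T.lev c + n ∧ T.anc y (T.lev c) = c := by
  induction n generalizing y with
  | zero =>
    simp only [below, Finset.mem_singleton, add_zero]
    refine ⟨fun h => by simp [h], fun ⟨h1, h2⟩ => ?_⟩
    rw [← h1, T.anc_lev] at h2; exact h2
  | succ n ih =>
    simp only [below, Finset.mem_biUnion]
    constructor
    · rintro ⟨z, hz, hy⟩
      obtain ⟨h1, h2⟩ := ih.1 hz
      obtain ⟨-, rfl⟩ := T.mem_ch.1 hy
      have h3 := T.lev_of_mem_ch hy
      exact ⟨by omega, by rw [← T.anc_par (by omega), h2]⟩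
    · rintro ⟨h1, h2⟩
      have hy : y ≠ T.root := fun h => by rw [h, T.lev_root] at h1; omega
      have h3 := T.lev_par hy
      exact ⟨T.par y, ih.2 ⟨by omega, by rw [T.anc_par (by omega), h2]⟩, T.mem_ch.2 ⟨hy, rfl⟩⟩

lemma card_below (c : V) (n : ℕ) :
    (T.below c n).card = ∏ j ∈ Finset.range n, d (T.lev c + j) := by
  induction n with
  | zero => simp [below]
  | succ n ih =>
    classical
    rw [below, Finset.card_biUnion, Finset.prod_range_succ, ← ih, ← smul_eq_mul,
      ← Finset.sum_const]
    · exact Finset.sum_congr rfl fun z hz => by rw [T.card_ch, (T.mem_below.1 hz).1]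
    · intro y _ z _ hyz
      refine Finset.disjoint_left.2 fun a ha hb => hyz ?_
      rw [← (T.mem_ch.1 ha).2, (T.mem_ch.1 hb).2]

/-- The set of vertices at level `n`. -/
noncomputable def level (n : ℕ) : Finset V := T.below T.root n

lemma mem_level {y : V} {n : ℕ} : y ∈ T.level n ↔ T.lev y = n := by
  rw [level, mem_below, T.lev_root]; simp

lemma card_level (n : ℕ) : (T.level n).card = ∏ j ∈ Finset.range n, d j := by
  rw [level, card_below, T.lev_root]; simp

open Classical in
/-- The set of vertices at levels `1, …, N`. -/
noncomputable def ball (N : ℕ) : Finset V := (Finset.Icc 1 N).biUnion T.level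

lemma mem_ball {y : V} {N : ℕ} : y ∈ T.ball N ↔ 1 ≤ T.lev y ∧ T.lev y ≤ N := by
  simp [ball, mem_level]

lemma sum_ball {N : ℕ} (g : V → ℝ) :
    ∑ v ∈ T.ball N, g v = ∑ n ∈ Finset.Icc 1 N, ∑ v ∈ T.level n, g v := by
  classical
  rw [ball, Finset.sum_biUnion]
  intro m _ n _ hmn
  refine Finset.disjoint_left.2 fun a ha hb => hmn ?_
  rw [← T.mem_level.1 ha, T.mem_level.1 hb]

lemma sum_ball_lev {N : ℕ} (g : ℕ → ℝ) :
    ∑ v ∈ T.ball N, g (T.lev v) = ∑ n ∈ Finset.Icc 1 N, (T.level n).card * g n := by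
  rw [sum_ball]
  refine Finset.sum_congr rfl fun n _ => ?_
  rw [← nsmul_eq_mul, ← Finset.sum_const]
  exact Finset.sum_congr rfl fun v hv => by rw [T.mem_level.1 hv]

-- Spherical symmetry: all vertices of level k have equally many descendants at level n.
open Classical in
lemma card_level_mul_card_below {c : V} {k n : ℕ} (hc : T.lev c = k) (hkn : k ≤ n) :
    (T.level k).card * ((T.level n).filter fun v => T.anc v k = c).card = (T.level n).card := by
  have e : ((T.level n).filter fun v => T.anc v k = c) = T.below c (n - k) := by
    ext v
    rw [Finset.mem_filter, T.mem_level, T.mem_below, hc, Nat.add_sub_cancel' hkn]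
  rw [e, card_below, card_level, card_level, hc, ← Finset.prod_range_add, Nat.add_sub_cancel' hkn]

-- The descendants of one vertex of level k carry the fraction 1/|level k| of the mass of each lower
-- level.
open Classical in
lemma sum_ball_anc_le {c : V} {k N : ℕ} (hc : T.lev c = k) {g : ℕ → ℝ} (hg : ∀ n, 0 ≤ g n) :
    ∑ v ∈ T.ball N, (if k < T.lev v ∧ T.anc v k = c then g (T.lev v) else 0) ≤
      (∑ v ∈ T.ball N, g (T.lev v)) / (T.level k).card := by
  have hpos : 0 < (T.level k).card := Finset.card_pos.2 ⟨c, T.mem_level.2 hc⟩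
  rw [sum_ball, sum_ball_lev, Finset.sum_div]
  refine Finset.sum_le_sum fun n _ => ?_
  have e : ∀ v ∈ T.level n, (if k < T.lev v ∧ T.anc v k = c then g (T.lev v) else 0) =
      if k < n ∧ T.anc v k = c then g n else 0 := fun v hv => by rw [T.mem_level.1 hv]
  rw [Finset.sum_congr rfl e]
  by_cases hkn : k < n
  · simp only [hkn, true_and]
    rw [← Finset.sum_filter, Finset.sum_const, nsmul_eq_mul,
      ← T.card_level_mul_card_below hc hkn.le]
    push_cast
    refine le_of_eq ?_
    have : ((T.level k).card : ℝ) ≠ 0 := by exact_mod_cast hpos.ne'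
    field_simp
  · simp only [hkn, false_and, if_false, Finset.sum_const_zero]
    have := hg n
    positivity

/-- The paths agree at level 0 and differ by the smaller of the two levels, since neither vertex is
an ancestor of the other; take the last level before the first disagreement. -/
lemma exists_meet_level {u v : V} (h1 : ∀ i < T.lev v, u ≠ T.anc v i)
    (h2 : ∀ i < T.lev u, v ≠ T.anc u i) (huv : u ≠ v) :
    ∃ k, k < T.lev u ∧ k < T.lev v ∧ T.anc u k = T.anc v k ∧
      T.anc u (k + 1) ≠ T.anc v (k + 1) := by
  classical
  have hne : T.anc u (min (T.lev u) (T.lev v)) ≠ T.anc v (min (T.lev u) (T.lev v)) := by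
    rcases lt_trichotomy (T.lev u) (T.lev v) with h | h | h
    · rw [min_eq_left h.le, T.anc_lev]; exact h1 _ h
    · rw [min_eq_left h.le, T.anc_lev, h, T.anc_lev]; exact huv
    · rw [min_eq_right h.le, T.anc_lev]; exact (h2 _ h).symm
  have hex : ∃ j, T.anc u j ≠ T.anc v j := ⟨_, hne⟩
  have h3 := Nat.find_spec hex
  have h4 := Nat.find_min' hex hne
  have h5 : Nat.find hex ≠ 0 := fun h0 => by rw [h0] at h3; simp at h3
  obtain ⟨k, hk⟩ := Nat.exists_eq_succ_of_ne_zero h5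
  rw [hk] at h3 h4
  have h6 := Nat.find_min hex (m := k) (by omega)
  have := le_min_iff.1 h4
  exact ⟨k, by omega, by omega, not_not.1 h6, h3⟩

end RootedTree

/-! ### First moment, and the sums over pairs of vertices. -/

section Sums

variable {V : Type*} {d : ℕ → ℕ} {p : ℕ → ℝ} {ε : ℝ} {D : ℕ} (T : RootedTree V d)
  (h : GoodParams d p ε D) (hp0 : p 0 = 1)

include hp0 in
lemma card_level_mul_prod (n : ℕ) :
    ((T.level n).card : ℝ) * ∏ j ∈ Finset.range (n + 1), p j = meanCount d p n := by
  rw [T.card_level, Finset.prod_range_succ', hp0, mul_one, meanCount, Finset.prod_mul_distrib]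
  push_cast
  rfl

include h hp0

lemma GoodParams.mean_le_card_mul_pivotProb {n : ℕ} (hn : 1 ≤ n) :
    meanCount d p n * (isoProb d p n * survLim d p n) ≤
      ((T.level n).card : ℝ) * pivotProb d p n := by
  have h1 := h.isoProb_pos n
  have h2 := h.survLim_pos n
  have h3 := (h.prob_pos n hn)
  have h4 : 0 ≤ ∏ j ∈ Finset.range n, p j := Finset.prod_nonneg fun j _ => by
    rcases Nat.eq_zero_or_pos j with rfl | hj
    · rw [hp0]; exact zero_le_one
    · exact (h.prob_pos j hj).1.le
  rw [← card_level_mul_prod T hp0, Finset.prod_range_succ, pivotProb]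
  calc _ = (T.level n).card * (survLim d p n * (isoProb d p n * ∏ j ∈ Finset.range n, p j)) * p n := by
        ring
    _ ≤ _ := mul_le_of_le_one_right (by positivity) h3.2

/-- The expected number of flips (up to constants). -/
noncomputable def totalPivot (T : RootedTree V d) (p : ℕ → ℝ) (N : ℕ) : ℝ :=
  ∑ v ∈ T.ball N, pivotProb d p (T.lev v)

lemma GoodParams.totalPivot_nonneg (N : ℕ) : 0 ≤ totalPivot T p N :=
  Finset.sum_nonneg fun _ _ => (h.pivotProb_pos hp0 _).le

lemma GoodParams.exists_sum_invTail_le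
    (hbb : Summable fun n => ((meanCount d p n * invTail (meanCount d p) (n + 1)) ^ 2)⁻¹) :
    ∃ c > 0, ∀ N, c * ∑ n ∈ Finset.Icc 1 N, invTail (meanCount d p) n ≤ totalPivot T p N := by
  obtain ⟨c, hc, hcn⟩ := h.exists_expected_lower hbb
  refine ⟨c, hc, fun N => ?_⟩
  rw [totalPivot, T.sum_ball_lev, Finset.mul_sum]
  exact Finset.sum_le_sum fun n hn => (hcn n).trans
    (h.mean_le_card_mul_pivotProb T hp0 (Finset.mem_Icc.1 hn).1)

-- For fixed u the admissible v descend from a single vertex of level k, so `sum_ball_anc_le`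
-- applies; summing over u gives a second factor of the total.
open Classical in
lemma GoodParams.sum_meet_le (N k : ℕ) :
    ∑ u ∈ T.ball N, ∑ v ∈ T.ball N,
      (if k < T.lev u ∧ k < T.lev v ∧ T.anc u k = T.anc v k then
        pivotProb d p (T.lev u) * pivotProb d p (T.lev v) else 0) ≤
      totalPivot T p N ^ 2 / (T.level k).card := by
  have hf := fun n => (h.pivotProb_pos hp0 n).le
  have hM := h.totalPivot_nonneg T hp0 N
  have h1 : ∀ u ∈ T.ball N, ∑ v ∈ T.ball N,
      (if k < T.lev u ∧ k < T.lev v ∧ T.anc u k = T.anc v k then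
        pivotProb d p (T.lev u) * pivotProb d p (T.lev v) else 0) ≤
      pivotProb d p (T.lev u) * (totalPivot T p N / (T.level k).card) := by
    intro u hu
    have h0 : 0 ≤ totalPivot T p N / (T.level k).card := by positivity
    by_cases hk : k < T.lev u
    · refine le_trans (le_of_eq ?_) (mul_le_mul_of_nonneg_left
        (T.sum_ball_anc_le (N := N) (T.lev_anc (v := u) hk.le) hf) (hf _))
      rw [Finset.mul_sum]
      refine Finset.sum_congr rfl fun v _ => ?_
      simp only [hk, true_and, mul_ite, mul_zero, eq_comm (a := T.anc u k)]
    · simp only [hk, false_and, if_false, Finset.sum_const_zero]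
      exact mul_nonneg (hf _) h0
  refine (Finset.sum_le_sum h1).trans (le_of_eq ?_)
  rw [← Finset.sum_mul, sq, mul_div_assoc]
  rfl

-- After exchanging the sums, the term a_r/r is counted once for each i from 1 to r, which cancels
-- the denominator.
omit hp0 in
lemma GoodParams.sum_leave_le (n : ℕ) :
    ∑ i ∈ Finset.Ico 1 n, (2 / (n : ℝ) + ∑ r ∈ Finset.Ico i n, linkProb d p r / r) ≤
      2 + ∑ r ∈ Finset.range n, linkProb d p r := by
  rw [Finset.sum_add_distrib]
  refine add_le_add ?_ ?_
  · rcases Nat.eq_zero_or_pos n with rfl | hn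
    · simp
    · rw [Finset.sum_const, nsmul_eq_mul, Nat.card_Ico, mul_div_assoc',
        div_le_iff₀ (by exact_mod_cast hn)]
      have : ((n - 1 : ℕ) : ℝ) ≤ n := by exact_mod_cast Nat.sub_le _ _
      linarith
  · have e : ∑ i ∈ Finset.Ico 1 n, ∑ r ∈ Finset.Ico i n, linkProb d p r / r =
        ∑ r ∈ Finset.Ico 1 n, ∑ i ∈ Finset.Ico 1 (r + 1), linkProb d p r / r := by
      refine Finset.sum_comm' fun i r => ?_
      simp only [Finset.mem_Ico]; omega
    rw [e]
    refine (Finset.sum_le_sum (f := fun r => ∑ i ∈ Finset.Ico 1 (r + 1), linkProb d p r / r)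
      (g := fun r => linkProb d p r) fun r hr => ?_).trans
      (Finset.sum_le_sum_of_subset_of_nonneg (fun r hr => ?_) fun r _ _ => (h.linkProb_pos r).le)
    · have hr1 := (Finset.mem_Ico.1 hr).1
      have : (r : ℝ) ≠ 0 := by exact_mod_cast (by omega : r ≠ 0)
      rw [Finset.sum_const, Nat.card_Ico, nsmul_eq_mul, Nat.add_sub_cancel]
      exact le_of_eq (by field_simp)
    · simp only [Finset.mem_Ico, Finset.mem_range] at hr ⊢; omega

end Sums

/-! ### The second moment bound and its consequence. -/

namespace IsTreeDynamics

variable {V Ω : Type*} [MeasurableSpace Ω] {d : ℕ → ℕ} {p : ℕ → ℝ} {ε K : ℝ} {D : ℕ}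
  {T : RootedTree V d} {x : V → Ω → ℝ≥0 → Bool} {P : Measure Ω} [IsProbabilityMeasure P]
  (hX : IsTreeDynamics T p x P) (h : GoodParams d p ε D) (hp0 : p 0 = 1)
include hX h hp0

lemma real_flipEvent_le (v : V) :
    P.real (flipEvent T x v) ≤ pivotProb d p (T.lev v) := by
  rw [hX.real_flipEvent h hp0]
  exact mul_le_of_le_one_left (h.pivotProb_pos hp0 _).le measureReal_le_one

lemma le_real_flipEvent {v : V} (hv : v ≠ T.root) :
    ε ^ 2 * pivotProb d p (T.lev v) ≤ P.real (flipEvent T x v) := by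
  rw [hX.real_flipEvent h hp0]
  refine mul_le_mul_of_nonneg_right ((hX.chain v hv).real_jumpAfter_le_one h.eps_pos (h.prob _ ?_))
    (h.pivotProb_pos hp0 _).le
  rw [T.lev_par hv]; omega

-- Trades the product of edge probabilities for |level k|/w_k, so that the cardinality cancels
-- against the one in `sum_meet_le`.
omit hX in
lemma meet_bound_eq (u v : V) (k : ℕ) :
    (1 / ε ^ D) ^ 2 * pivotProb d p (T.lev u) * pivotProb d p (T.lev v) /
      (isoProb d p k * ∏ j ∈ Finset.range (k + 1), p j) * (K / (k + 1)) =
    (pivotProb d p (T.lev u) * pivotProb d p (T.lev v)) *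
      ((1 / ε ^ D) ^ 2 * K * ((T.level k).card / ((k + 1) * meanCount d p k * isoProb d p k))) := by
  have h1 := h.count_pos k
  have h2 := h.isoProb_pos k
  rw [← card_level_mul_prod T hp0] at h1 ⊢
  have h3 : ((T.level k).card : ℝ) ≠ 0 := fun h0 => by rw [h0, zero_mul] at h1; exact h1.false
  have h4 : (∏ j ∈ Finset.range (k + 1), p j) ≠ 0 :=
    fun h0 => by rw [h0, mul_zero] at h1; exact h1.false
  have h5 := h.eps_pos
  have h6 : (k : ℝ) + 1 ≠ 0 := by positivity
  field_simp

variable (hK0 : 0 < K) (hK : KernelBound ε K)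
include hK0 hK

-- Each pair is either equal, nested one way or the other, or separated at some level k < N. The
-- bound is written as a sum of nonnegative indicator terms, one group for each case, so that it can
-- be summed over all pairs without a case distinction.
open Classical in
lemma real_flipEvent_inter_le {N : ℕ} {u v : V} (hu : u ∈ T.ball N) (hv : v ∈ T.ball N) :
    P.real (flipEvent T x u ∩ flipEvent T x v) ≤
      (if u = v then pivotProb d p (T.lev v) else 0) +
      ∑ i ∈ Finset.Ico 1 (T.lev v), (if u = T.anc v i then K * (1 + D / ε ^ D) / ε *
        pivotProb d p (T.lev v) * (2 / T.lev v +
          ∑ r ∈ Finset.Ico i (T.lev v), linkProb d p r / r) else 0) +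
      ∑ i ∈ Finset.Ico 1 (T.lev u), (if v = T.anc u i then K * (1 + D / ε ^ D) / ε *
        pivotProb d p (T.lev u) * (2 / T.lev u +
          ∑ r ∈ Finset.Ico i (T.lev u), linkProb d p r / r) else 0) +
      ∑ k ∈ Finset.range N, (if k < T.lev u ∧ k < T.lev v ∧ T.anc u k = T.anc v k then
        pivotProb d p (T.lev u) * pivotProb d p (T.lev v) else 0) * ((1 / ε ^ D) ^ 2 * K *
          ((T.level k).card / ((k + 1) * meanCount d p k * isoProb d p k))) := by
  have hε := h.eps_pos
  have hf := fun n => (h.pivotProb_pos hp0 n).le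
  have hg : ∀ v i, 0 ≤ K * (1 + D / ε ^ D) / ε * pivotProb d p (T.lev v) * (2 / T.lev v +
      ∑ r ∈ Finset.Ico i (T.lev v), linkProb d p r / r) := fun v i => by
    have h1 := hf (T.lev v)
    have h2 : 0 ≤ ∑ r ∈ Finset.Ico i (T.lev v), linkProb d p r / r :=
      Finset.sum_nonneg fun r _ => div_nonneg (h.linkProb_pos r).le (Nat.cast_nonneg r)
    positivity
  have hq : ∀ k : ℕ, 0 ≤ (1 / ε ^ D) ^ 2 * K *
      ((T.level k).card / ((k + 1) * meanCount d p k * isoProb d p k)) := fun k => by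
    have h1 := h.count_pos k
    have h2 := h.isoProb_pos k
    positivity
  have n1 : 0 ≤ (if u = v then pivotProb d p (T.lev v) else 0) := by
    split_ifs; exacts [hf _, le_rfl]
  have n2 : ∀ u v, 0 ≤ ∑ i ∈ Finset.Ico 1 (T.lev v), (if u = T.anc v i then
      K * (1 + D / ε ^ D) / ε * pivotProb d p (T.lev v) * (2 / T.lev v +
        ∑ r ∈ Finset.Ico i (T.lev v), linkProb d p r / r) else 0) := fun u v =>
    Finset.sum_nonneg fun i _ => by split_ifs; exacts [hg _ _, le_rfl]
  have n4 : ∀ k ∈ Finset.range N,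
      0 ≤ (if k < T.lev u ∧ k < T.lev v ∧ T.anc u k = T.anc v k then
        pivotProb d p (T.lev u) * pivotProb d p (T.lev v) else 0) * ((1 / ε ^ D) ^ 2 * K *
          ((T.level k).card / ((k + 1) * meanCount d p k * isoProb d p k))) := fun k _ => by
    refine mul_nonneg ?_ (hq k)
    split_ifs; exacts [mul_nonneg (hf _) (hf _), le_rfl]
  have n4' := Finset.sum_nonneg n4
  have hlev0 : ∀ {a b : V}, a ∈ T.ball N → ∀ i < T.lev b, a = T.anc b i → 1 ≤ i := by
    intro a b ha i hi hab
    have := (T.mem_ball.1 ha).1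
    rwa [hab, T.lev_anc hi.le] at this
  by_cases huv : u = v
  · subst huv
    have := hX.real_flipEvent_le h hp0 u
    rw [Set.inter_self]
    rw [if_pos rfl] at n1 ⊢
    linarith [n2 u u]
  by_cases h1 : ∃ i < T.lev v, u = T.anc v i
  · obtain ⟨i, hi, hui⟩ := h1
    have hi0 := hlev0 hu i hi hui
    have h2 := hX.real_flipEvent_anc_le h hp0 hK0 hK hi0 hi
    rw [← hui] at h2
    have h3 := Finset.single_le_sum (f := fun i => if u = T.anc v i then K * (1 + D / ε ^ D) / ε *
        pivotProb d p (T.lev v) * (2 / T.lev v +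
          ∑ r ∈ Finset.Ico i (T.lev v), linkProb d p r / r) else 0)
      (fun i _ => by split_ifs; exacts [hg _ _, le_rfl]) (Finset.mem_Ico.2 ⟨hi0, hi⟩)
    simp only [if_pos hui] at h3
    linarith [n2 v u]
  by_cases h1' : ∃ i < T.lev u, v = T.anc u i
  · obtain ⟨i, hi, hui⟩ := h1'
    have hi0 := hlev0 hv i hi hui
    have h2 := hX.real_flipEvent_anc_le h hp0 hK0 hK hi0 hi
    rw [← hui, Set.inter_comm] at h2
    have h3 := Finset.single_le_sum (f := fun i => if v = T.anc u i then K * (1 + D / ε ^ D) / ε *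
        pivotProb d p (T.lev u) * (2 / T.lev u +
          ∑ r ∈ Finset.Ico i (T.lev u), linkProb d p r / r) else 0)
      (fun i _ => by split_ifs; exacts [hg _ _, le_rfl]) (Finset.mem_Ico.2 ⟨hi0, hi⟩)
    simp only [if_pos hui] at h3
    linarith [n2 u v]
  push Not at h1 h1'
  obtain ⟨k, hku, hkv, hk, hk1⟩ := T.exists_meet_level h1 h1' huv
  have h2 := hX.real_flipEvent_meet_le h hp0 hK0 hK hku hkv hk hk1
  rw [meet_bound_eq h hp0] at h2
  have h3 := Finset.single_le_sum n4
    (Finset.mem_range.2 (hku.trans_le (T.mem_ball.1 hu).2))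
  rw [if_pos ⟨hku, hkv, hk⟩] at h3
  linarith [n2 u v, n2 v u]

lemma sum_real_flipEvent_inter_le (N : ℕ) :
    ∑ u ∈ T.ball N, ∑ v ∈ T.ball N, P.real (flipEvent T x u ∩ flipEvent T x v) ≤
      totalPivot T p N + 2 * (K * (1 + D / ε ^ D) / ε * totalPivot T p N *
        (2 + ∑ r ∈ Finset.range N, linkProb d p r)) +
      (1 / ε ^ D) ^ 2 * K * totalPivot T p N ^ 2 *
        ∑ k ∈ Finset.range N, 1 / ((k + 1) * meanCount d p k * isoProb d p k) := by
  classical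
  have hε := h.eps_pos
  have hf := fun n => (h.pivotProb_pos hp0 n).le
  have hcmp : ∑ v ∈ T.ball N, ∑ u ∈ T.ball N, ∑ i ∈ Finset.Ico 1 (T.lev v),
      (if u = T.anc v i then K * (1 + D / ε ^ D) / ε * pivotProb d p (T.lev v) * (2 / T.lev v +
        ∑ r ∈ Finset.Ico i (T.lev v), linkProb d p r / r) else 0) ≤
      K * (1 + D / ε ^ D) / ε * totalPivot T p N *
        (2 + ∑ r ∈ Finset.range N, linkProb d p r) := by
    rw [totalPivot, Finset.mul_sum, Finset.sum_mul]
    refine Finset.sum_le_sum fun v hv => ?_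
    have hc : 0 ≤ K * (1 + D / ε ^ D) / ε * pivotProb d p (T.lev v) := by
      have := hf (T.lev v); positivity
    rw [Finset.sum_comm]
    calc _ ≤ ∑ i ∈ Finset.Ico 1 (T.lev v), K * (1 + D / ε ^ D) / ε * pivotProb d p (T.lev v) *
          (2 / T.lev v + ∑ r ∈ Finset.Ico i (T.lev v), linkProb d p r / r) := by
          refine Finset.sum_le_sum fun i _ => ?_
          rw [Finset.sum_ite_eq']
          split_ifs
          · exact le_rfl
          · refine mul_nonneg hc (add_nonneg (by positivity) (Finset.sum_nonneg fun r _ =>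
              div_nonneg (h.linkProb_pos r).le (Nat.cast_nonneg r)))
      _ ≤ _ := by
          rw [← Finset.mul_sum]
          refine mul_le_mul_of_nonneg_left ((h.sum_leave_le (T.lev v)).trans ?_) hc
          gcongr
          · exact fun r _ _ => (h.linkProb_pos r).le
          · exact (T.mem_ball.1 hv).2
  have hdiag : ∑ u ∈ T.ball N, ∑ v ∈ T.ball N, (if u = v then pivotProb d p (T.lev v) else 0) =
      totalPivot T p N := by
    rw [totalPivot]
    refine Finset.sum_congr rfl fun u hu => ?_
    rw [Finset.sum_ite_eq, if_pos hu]
  have hmeet : ∑ u ∈ T.ball N, ∑ v ∈ T.ball N, ∑ k ∈ Finset.range N,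
      (if k < T.lev u ∧ k < T.lev v ∧ T.anc u k = T.anc v k then
        pivotProb d p (T.lev u) * pivotProb d p (T.lev v) else 0) * ((1 / ε ^ D) ^ 2 * K *
          ((T.level k).card / ((k + 1) * meanCount d p k * isoProb d p k))) ≤
      (1 / ε ^ D) ^ 2 * K * totalPivot T p N ^ 2 *
        ∑ k ∈ Finset.range N, 1 / ((k + 1) * meanCount d p k * isoProb d p k) := by
    rw [Finset.sum_congr rfl fun u _ => Finset.sum_comm, Finset.sum_comm, Finset.mul_sum]
    refine Finset.sum_le_sum fun k _ => ?_
    have h1 := h.count_pos k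
    have h2 := h.isoProb_pos k
    have h3 : ((T.level k).card : ℝ) ≠ 0 := fun h0 => by
      rw [← card_level_mul_prod T hp0, h0, zero_mul] at h1; exact h1.false
    simp_rw [← Finset.sum_mul]
    refine (mul_le_mul_of_nonneg_right (h.sum_meet_le T hp0 N k)
      (by positivity)).trans (le_of_eq ?_)
    generalize totalPivot T p N = M
    generalize (1 / ε ^ D) ^ 2 = E
    field_simp
  refine (Finset.sum_le_sum fun u hu => Finset.sum_le_sum fun v hv =>
    hX.real_flipEvent_inter_le h hp0 hK0 hK hu hv).trans ?_
  simp only [Finset.sum_add_distrib]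
  rw [hdiag]
  have hcmp' := hcmp
  rw [Finset.sum_comm] at hcmp'
  linarith

omit hK0 hK in
theorem measure_infinite_flipEvent_pos
    (hfm : Tendsto (fun N => ∑ n ∈ Finset.Icc 1 N, invTail (meanCount d p) n) atTop atTop)
    (hbb : Summable fun n => ((meanCount d p n * invTail (meanCount d p) (n + 1)) ^ 2)⁻¹)
    (hf : Summable fun k : ℕ =>
      (((k : ℝ) + 1) * meanCount d p k * invTail (meanCount d p) k ^ 2)⁻¹) :
    0 < P {ω | {v | v ≠ T.root ∧ ω ∈ flipEvent T x v}.Infinite} := by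
  have hε := h.eps_pos
  obtain ⟨K, hK0, hK⟩ : ∃ K > 0, KernelBound ε K := exists_lintegral_exp_le hε
  obtain ⟨c, hc, hcM⟩ := h.exists_sum_invTail_le T hp0 hbb
  obtain ⟨K1, hK1, hlink⟩ := h.exists_sum_linkProb_le hf
  obtain ⟨c2, hc2, hiso⟩ := h.exists_isoProb_ge_sq_invTail hbb
  set Q := ∑' k : ℕ, (((k : ℝ) + 1) * meanCount d p k * invTail (meanCount d p) k ^ 2)⁻¹ with hQ
  have hQ0 : 0 ≤ Q := tsum_nonneg fun k => by have := (h.count_pos k).le; positivity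
  have hM : Tendsto (totalPivot T p) atTop atTop :=
    tendsto_atTop_mono hcM (hfm.const_mul_atTop hc)
  set S0 := invTail (meanCount d p) 0 with hS0
  have hS0' : 0 ≤ S0 := h.invTail_nonneg 0
  set R := K * (1 + D / ε ^ D) / ε with hR
  have hR0 : 0 ≤ R := by positivity
  -- The third condition enters here, through the lower bound of order S_k^2 on `isoProb`.
  have hsumQ : ∀ N, ∑ k ∈ Finset.range N, 1 / ((k + 1) * meanCount d p k * isoProb d p k) ≤
      1 / c2 * Q := by
    intro N
    have hs : ∑ k ∈ Finset.range N, 1 / ((k + 1) * meanCount d p k * isoProb d p k) ≤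
        ∑ k ∈ Finset.range N, 1 / c2 *
          (((k : ℝ) + 1) * meanCount d p k * invTail (meanCount d p) k ^ 2)⁻¹ := by
      refine Finset.sum_le_sum fun k _ => ?_
      have h1 := h.count_pos k
      have h2 := h.invTail_pos k
      rw [← one_div, one_div_mul_one_div]
      refine one_div_le_one_div_of_le (by positivity) ?_
      calc c2 * (((k : ℝ) + 1) * meanCount d p k * invTail (meanCount d p) k ^ 2)
          = ((k : ℝ) + 1) * meanCount d p k * (c2 * invTail (meanCount d p) k ^ 2) := by ring
        _ ≤ _ := by gcongr; exact hiso k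
    refine hs.trans ?_
    rw [← Finset.mul_sum]
    refine mul_le_mul_of_nonneg_left (hf.sum_le_tsum _ fun k _ => ?_) (by positivity)
    have := (h.count_pos k).le; positivity
  -- The sums of S_m are at most of the order of the first moment, so the contribution of ancestors
  -- grows at most quadratically in 1 + M. The extra S_0 appears because the ball omits the root.
  have hsumA : ∀ N, ∑ r ∈ Finset.range N, linkProb d p r ≤
      K1 * (1 + S0 + totalPivot T p N / c) := by
    intro N
    refine (hlink N).trans (mul_le_mul_of_nonneg_left ?_ hK1.le)
    have h1 : ∑ m ∈ Finset.range N, invTail (meanCount d p) m ≤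
        S0 + ∑ n ∈ Finset.Icc 1 N, invTail (meanCount d p) n := by
      have : S0 + ∑ n ∈ Finset.Icc 1 N, invTail (meanCount d p) n =
          ∑ m ∈ Finset.range (N + 1), invTail (meanCount d p) m := by
        rw [Finset.range_eq_Ico, Finset.sum_eq_sum_Ico_succ_bot (by omega)]
        rfl
      rw [this]
      exact Finset.sum_le_sum_of_subset_of_nonneg (Finset.range_mono (by omega))
        fun m _ _ => h.invTail_nonneg m
    have h2 : ∑ n ∈ Finset.Icc 1 N, invTail (meanCount d p) n ≤ totalPivot T p N / c := by
      rw [le_div_iff₀ hc, mul_comm]; exact hcM N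
    linarith
  classical
  have key : 0 < P {ω | {v | ω ∈ (if v = T.root then ∅ else flipEvent T x v)}.Infinite} := by
    classical
    refine measure_infinite_pos_of_second_moment (B := T.ball) (M := totalPivot T p)
      (A := fun v => if v = T.root then ∅ else flipEvent T x v) (b := ε ^ 2)
      (C := 1 + 2 * (R * (2 + K1 * (1 + S0 + 1 / c))) + (1 / ε ^ D) ^ 2 * K * (1 / c2 * Q)) ?_ hM
      (by positivity) (by positivity) ?_ ?_
    · intro v
      split_ifs
      exacts [MeasurableSet.empty, hX.measurableSet_flipEvent v]
    · intro N
      rw [totalPivot, Finset.mul_sum]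
      refine Finset.sum_le_sum fun v hv => ?_
      have hv' : v ≠ T.root := fun h0 => by
        have := (T.mem_ball.1 hv).1; rw [h0, T.lev_root] at this; omega
      rw [if_neg hv']
      exact hX.le_real_flipEvent h hp0 hv'
    · intro N hM0
      have h1 : ∑ u ∈ T.ball N, ∑ v ∈ T.ball N,
          P.real ((if u = T.root then ∅ else flipEvent T x u) ∩
            (if v = T.root then ∅ else flipEvent T x v)) ≤
          ∑ u ∈ T.ball N, ∑ v ∈ T.ball N, P.real (flipEvent T x u ∩ flipEvent T x v) := by
        refine Finset.sum_le_sum fun u _ => Finset.sum_le_sum fun v _ =>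
          measureReal_mono (Set.inter_subset_inter ?_ ?_) (measure_ne_top _ _)
        all_goals split_ifs
        exacts [Set.empty_subset _, subset_rfl, Set.empty_subset _, subset_rfl]
      refine (h1.trans (hX.sum_real_flipEvent_inter_le h hp0 hK0 hK N)).trans ?_
      set M := totalPivot T p N with hMdef
      have hA := hsumA N
      have hB := hsumQ N
      rw [← hR]
      have e1 : R * M * (2 + ∑ r ∈ Finset.range N, linkProb d p r) ≤
          R * (2 + K1 * (1 + S0 + 1 / c)) * (1 + M) ^ 2 := by
        have : (2 + ∑ r ∈ Finset.range N, linkProb d p r) ≤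
            (2 + K1 * (1 + S0 + 1 / c)) * (1 + M) := by
          have e : (2 + K1 * (1 + S0 + 1 / c)) * (1 + M) = 2 + K1 * (1 + S0 + M / c) +
            (2 * M + K1 * (1 / c) + K1 * (1 + S0) * M) := by ring
          rw [e]
          have : 0 ≤ 2 * M + K1 * (1 / c) + K1 * (1 + S0) * M := by positivity
          linarith
        calc _ ≤ R * (1 + M) * ((2 + K1 * (1 + S0 + 1 / c)) * (1 + M)) := by
              gcongr
              · refine add_nonneg (by norm_num) (Finset.sum_nonneg fun r _ =>
                  (h.linkProb_pos r).le)
              · linarith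
          _ = _ := by ring
      have e2 : (1 / ε ^ D) ^ 2 * K * M ^ 2 *
          ∑ k ∈ Finset.range N, 1 / ((k + 1) * meanCount d p k * isoProb d p k) ≤
          (1 / ε ^ D) ^ 2 * K * (1 / c2 * Q) * (1 + M) ^ 2 := by
        calc _ ≤ (1 / ε ^ D) ^ 2 * K * (1 + M) ^ 2 * (1 / c2 * Q) := by
              refine mul_le_mul (by gcongr; linarith) hB (Finset.sum_nonneg fun k _ => ?_)
                (by positivity)
              have h1 := h.count_pos k
              have h2 := h.isoProb_pos k
              positivity
          _ = _ := by ring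
      have e3 : M ≤ (1 + M) ^ 2 := by nlinarith
      nlinarith
  refine key.trans_le (measure_mono fun ω hω => ?_)
  refine hω.mono fun v hv => ?_
  by_cases h0 : v = T.root
  · simp only [h0, if_true, Set.mem_ofPred_eq] at hv
    exact hv.elim
  · exact ⟨h0, by simpa [h0] using hv⟩

omit hp0 hK0 hK in
/-- The first jump times of different vertices are different. -/
lemma ae_firstJump_ne [Countable V] : ∀ᵐ ω ∂P, ∀ u v, u ≠ v → v ≠ T.root →
    firstJump x u ω ≤ 1 → firstJump x u ω ≠ firstJump x v ω := by
  rw [ae_all_iff]; intro u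
  rw [ae_all_iff]; intro v
  by_cases huv : u = v
  · simp [huv]
  by_cases hv : v = T.root
  · simp [hv]
  have hmu := hX.measurable_firstJump u
  have hmv := hX.measurable_firstJump v
  have hI : IndepFun (firstJump x u) (firstJump x v) P :=
    (hX.indep.indepFun huv).comp (measurable_jumpAfter 0) (measurable_jumpAfter 0)
  have hmap := (indepFun_iff_map_prod_eq_prod_map_map hmu.aemeasurable hmv.aemeasurable).1 hI
  -- The law of a first switch has no atom in [0, 1], by the bound on short intervals; independence
  -- then excludes ties.
  have hatom : ∀ t : ENNReal, t ≤ 1 → (P.map (firstJump x v)) {t} = 0 := by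
    intro t ht
    lift t to ℝ≥0 using (ht.trans_lt ENNReal.one_lt_top).ne
    refine le_antisymm (le_of_forall_pos_le_add fun δ hδ => ?_) zero_le
    rw [zero_add]
    by_cases hδt : δ = ⊤
    · rw [hδt]; exact le_top
    lift δ to ℝ≥0 using hδt
    have hδ' : (0 : ℝ) < δ := by exact_mod_cast hδ
    refine (measure_mono (t := Set.Icc (t : ENNReal) ((t + δ / 2 : ℝ≥0) : ENNReal)) ?_).trans
      ((hX.map_firstJump_Icc_le h hv t (t + δ / 2) ?_).trans (le_of_eq ?_))
    · rw [Set.singleton_subset_iff]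
      exact ⟨le_rfl, ENNReal.coe_le_coe.2 (le_self_add)⟩
    · rw [← NNReal.coe_lt_coe]; push_cast; linarith
    · push_cast
      rw [add_sub_cancel_left, mul_div_cancel₀ _ two_ne_zero, ENNReal.ofReal_coe_nnreal]
  have hG : MeasurableSet {z : ENNReal × ENNReal | z.1 ≤ 1 ∧ z.1 = z.2} :=
    (measurableSet_le measurable_fst measurable_const).inter
      (measurableSet_eq_fun measurable_fst measurable_snd)
  have h0 : P ((fun ω => (firstJump x u ω, firstJump x v ω)) ⁻¹'
      {z : ENNReal × ENNReal | z.1 ≤ 1 ∧ z.1 = z.2}) = 0 := by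
    rw [← Measure.map_apply (hmu.prodMk hmv) hG, hmap, Measure.prod_apply hG]
    refine lintegral_eq_zero_of_ae_eq_zero (Eventually.of_forall fun a => ?_)
    by_cases ha : a ≤ 1
    · refine measure_mono_null (fun b hb => ?_) (hatom a ha)
      exact hb.2.symm
    · refine measure_mono_null (fun b hb => ?_) measure_empty
      exact ha hb.1
  have := measure_eq_zero_iff_ae_notMem.1 h0
  filter_upwards [this] with ω hω _ _ hle heq
  exact hω ⟨hle, heq⟩

end IsTreeDynamics

/-! ### Percolation of the root as infiniteness of its cluster. -/

namespace RootedTree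

variable {V : Type*} {d : ℕ → ℕ} (T : RootedTree V d)

/-- The vertices joined to the root by a path of vertices of `S`. -/
def joined (S : Set V) : Set V := {y | ∀ j, 1 ≤ j → j ≤ T.lev y → T.anc y j ∈ S}

lemma anc_mem_joined {S : Set V} {y : V} (hy : y ∈ T.joined S) {n : ℕ} (hn : n ≤ T.lev y) :
    T.anc y n ∈ T.joined S := fun j h1 h2 => by
  rw [T.lev_anc hn] at h2
  rw [T.anc_anc h2 hn]
  exact hy j h1 (h2.trans hn)

lemma root_mem_joined (S : Set V) : T.root ∈ T.joined S := fun j h1 h2 => by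
  rw [T.lev_root] at h2; omega

lemma mem_joined_iff {S : Set V} {y : V} (hy : y ≠ T.root) :
    y ∈ T.joined S ↔ y ∈ S ∧ T.par y ∈ T.joined S := by
  have h1 := T.lev_par hy
  constructor
  · intro h
    refine ⟨by simpa using h (T.lev y) (by omega) le_rfl, ?_⟩
    have := T.anc_mem_joined h (n := T.lev (T.par y)) (by omega)
    rwa [← T.anc_par (by omega), T.anc_lev] at this
  · rintro ⟨h2, h3⟩ j hj1 hj2
    rcases hj2.eq_or_lt with rfl | hj
    · simpa using h2
    · rw [← T.anc_par hj]; exact h3 j hj1 (by omega)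

lemma mem_conn_iff {S : Set V} {n : ℕ} {c : V} : S ∈ T.conn n c ↔
    ∃ y ∈ T.below c n, ∀ j, T.lev c < j → j ≤ T.lev y → T.anc y j ∈ S := by
  induction n generalizing c with
  | zero =>
    refine ⟨fun _ => ⟨c, by simp [below], fun j h1 h2 => by omega⟩, fun _ => trivial⟩
  | succ n ih =>
    simp only [conn, Set.mem_ofPred_eq]
    constructor
    · rintro ⟨c', hc', h1, h2⟩
      obtain ⟨y, hy, h3⟩ := ih.1 h2
      obtain ⟨h4, h5⟩ := T.mem_below.1 hy
      have h6 := T.lev_of_mem_ch hc'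
      have h7 := (T.mem_ch.1 hc').2
      refine ⟨y, T.mem_below.2 ⟨by omega, ?_⟩, fun j hj1 hj2 => ?_⟩
      · rw [← T.par_anc_succ (by omega), ← h6, h5, h7]
      · rcases (Nat.succ_le_of_lt hj1).eq_or_lt with hj | hj
        · rw [← hj, Nat.succ_eq_add_one, ← h6, h5]; exact h1
        · exact h3 j (by omega) hj2
    · rintro ⟨y, hy, h3⟩
      obtain ⟨h4, h5⟩ := T.mem_below.1 hy
      have h6 : T.lev (T.anc y (T.lev c + 1)) = T.lev c + 1 := T.lev_anc (by omega)
      refine ⟨T.anc y (T.lev c + 1), ?_, h3 _ (by omega) (by omega), ih.2 ⟨y, T.mem_below.2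
        ⟨by omega, by rw [h6]⟩, fun j hj1 hj2 => h3 j (by omega) hj2⟩⟩
      have := T.anc_mem_ch (v := y) (j := T.lev c) (by omega)
      rwa [h5] at this

/-- Clusters are closed under ancestors and levels are finite: an infinite cluster reaches
arbitrarily deep levels and hence meets every level. -/
lemma perc_root_iff {S : Set V} : S ∈ T.perc T.root ↔ (T.joined S).Infinite := by
  have h0 : S ∈ T.perc T.root ↔ ∀ n, ∃ y ∈ T.joined S, T.lev y = n := by
    refine forall_congr' fun n => ?_
    rw [T.mem_conn_iff]
    refine exists_congr fun y => ?_
    change y ∈ T.level n ∧ _ ↔ _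
    rw [T.mem_level, and_comm, T.lev_root]
    rfl
  rw [h0]
  constructor
  · intro h hfin
    obtain ⟨b, hb⟩ := (hfin.image T.lev).bddAbove
    obtain ⟨y, hy, hlev⟩ := h (b + 1)
    have := hb ⟨y, hy, hlev⟩
    omega
  · intro hinf n
    classical
    by_contra! hc
    refine hinf (Set.Finite.subset (Finset.finite_toSet (insert T.root (T.ball n))) fun y hy => ?_)
    rw [Finset.mem_coe, Finset.mem_insert, T.mem_ball]
    by_cases hyn : T.lev y ≤ n
    · rcases Nat.eq_zero_or_pos (T.lev y) with h1 | h1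
      · exact Or.inl (T.lev_eq_zero.1 h1)
      · exact Or.inr ⟨h1, hyn⟩
    · exact absurd (T.lev_anc (by omega)) (hc _ (T.anc_mem_joined hy (by omega : n ≤ T.lev y)))

include T in
lemma countable : Countable V := by
  have : (Set.univ : Set V) = ⋃ n, (T.level n : Set V) := by
    ext y; simp [T.mem_level]
  rw [← Set.countable_univ_iff, this]
  exact Set.countable_iUnion fun n => (T.level n).countable_toSet

end RootedTree

/-! ### From the graph to the rooted tree: parents, edges and clusters. -/

namespace IsSphericallySymmetricTree

variable {V : Type*} {G : SimpleGraph V} {ρ : V} {d : ℕ → ℕ}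
  (hG : IsSphericallySymmetricTree G ρ d)
include hG

lemma exists_parent {v : V} (hv : v ≠ ρ) : ∃ u, G.Adj u v ∧ G.dist ρ v = G.dist ρ u + 1 := by
  obtain ⟨w, hw⟩ := hG.isTree.connected.exists_walk_length_eq_dist ρ v
  have hnil : ¬ w.Nil := fun h => hv h.eq.symm
  refine ⟨w.penultimate, w.adj_penultimate hnil, ?_⟩
  have h1 := SimpleGraph.dist_le w.dropLast
  have h2 := hG.isTree.dist_eq_dist_add_one_of_adj ρ (w.adj_penultimate hnil)
  have h3 : w.dropLast.length + 1 = w.length := by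
    rw [← SimpleGraph.Walk.length_concat w.dropLast (w.adj_penultimate hnil),
      SimpleGraph.Walk.concat_dropLast]
  omega

/-- A geodesic to either parent, extended by v, is again a geodesic, hence a path; uniqueness of
paths in a tree forces the penultimate vertices to agree. -/
lemma parent_unique {u u' v : V} (h : G.Adj u v ∧ G.dist ρ v = G.dist ρ u + 1)
    (h' : G.Adj u' v ∧ G.dist ρ v = G.dist ρ u' + 1) : u = u' := by
  obtain ⟨w, hw⟩ := hG.isTree.connected.exists_walk_length_eq_dist ρ u
  obtain ⟨w', hw'⟩ := hG.isTree.connected.exists_walk_length_eq_dist ρ u'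
  have h1 : (w.concat h.1).IsPath := SimpleGraph.Walk.isPath_of_length_eq_dist _ (by
    rw [SimpleGraph.Walk.length_concat, hw, h.2])
  have h2 : (w'.concat h'.1).IsPath := SimpleGraph.Walk.isPath_of_length_eq_dist _ (by
    rw [SimpleGraph.Walk.length_concat, hw', h'.2])
  have h3 := (hG.isTree.existsUnique_path ρ v).unique h1 h2
  rw [← SimpleGraph.Walk.penultimate_concat w h.1, h3, SimpleGraph.Walk.penultimate_concat]

open Classical in
/-- The parent of a vertex. -/
noncomputable def parent (v : V) : V :=
  if hv : v = ρ then ρ else (hG.exists_parent hv).choose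

lemma parent_spec {v : V} (hv : v ≠ ρ) :
    G.Adj (hG.parent v) v ∧ G.dist ρ v = G.dist ρ (hG.parent v) + 1 := by
  rw [parent, dif_neg hv]
  exact (hG.exists_parent hv).choose_spec

lemma parent_eq_iff {u v : V} :
    (G.Adj v u ∧ G.dist ρ u = G.dist ρ v + 1) ↔ u ≠ ρ ∧ hG.parent u = v := by
  constructor
  · intro h
    have hu : u ≠ ρ := by
      rintro rfl
      have := h.2
      rw [SimpleGraph.dist_self] at this
      omega
    exact ⟨hu, hG.parent_unique (hG.parent_spec hu) h⟩
  · rintro ⟨hu, rfl⟩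
    exact hG.parent_spec hu

lemma finite_children (v : V) : {u | G.Adj v u ∧ G.dist ρ u = G.dist ρ v + 1}.Finite :=
  Set.finite_of_encard_eq_coe (hG.children v)

/-- A spherically symmetric tree as a `RootedTree`. -/
noncomputable def toRootedTree : RootedTree V d where
  root := ρ
  par := hG.parent
  lev := G.dist ρ
  ch v := (hG.finite_children v).toFinset
  mem_ch := by
    intro u v
    rw [Set.Finite.mem_toFinset]
    exact hG.parent_eq_iff
  par_root := by rw [parent, dif_pos rfl]
  lev_root := SimpleGraph.dist_self
  lev_par hu := (hG.parent_spec hu).2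
  card_ch v := by
    have := hG.children v
    rw [(hG.finite_children v).encard_eq_coe_toFinset_card] at this
    exact_mod_cast this

/-- The edge joining a non-root vertex to its parent. -/
noncomputable def upEdge (v : {v // v ≠ ρ}) : G.edgeSet :=
  ⟨s(hG.parent v, v), (hG.parent_spec v.2).1⟩

/-- Adjacent vertices of a tree differ by exactly one level, so every edge joins a vertex to its
parent, and its lower endpoint is determined. -/
lemma upEdge_bijective : Function.Bijective hG.upEdge := by
  constructor
  · rintro ⟨u, hu⟩ ⟨v, hv⟩ h
    have h1 := Subtype.ext_iff.1 h
    simp only [upEdge, Sym2.eq_iff] at h1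
    rcases h1 with h1 | h1
    · exact Subtype.ext h1.2
    · exfalso
      have h2 := (hG.parent_spec hu).2
      have h3 := (hG.parent_spec hv).2
      rw [h1.1] at h2
      rw [← h1.2] at h3
      omega
  · rintro ⟨e, he⟩
    induction e using Sym2.ind with
    | _ a b =>
      have hab : G.Adj a b := he
      rcases hG.isTree.dist_eq_dist_add_one_of_adj ρ hab with h | h
      · obtain ⟨h1, h2⟩ := hG.parent_eq_iff.1 ⟨hab.symm, h⟩
        refine ⟨⟨a, h1⟩, Subtype.ext ?_⟩
        simp only [upEdge, h2]
        exact Sym2.eq_swap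
      · obtain ⟨h1, h2⟩ := hG.parent_eq_iff.1 ⟨hab, h⟩
        refine ⟨⟨b, h1⟩, Subtype.ext ?_⟩
        simp only [upEdge, h2]

lemma edgeLevel_upEdge (v : {v // v ≠ ρ}) : edgeLevel G ρ (hG.upEdge v) = G.dist ρ v := by
  have := (hG.parent_spec v.2).2
  simp only [edgeLevel, upEdge, Sym2.map_mk, Sym2.sup_mk]
  rw [this]
  exact max_eq_right (by omega)

/-- The vertex configuration corresponding to an edge configuration. -/
def toVertices (S : Set G.edgeSet) : Set V := {v | ∀ hv : v ≠ ρ, hG.upEdge ⟨v, hv⟩ ∈ S}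

lemma toVertices_insert (v : {v // v ≠ ρ}) (S : Set G.edgeSet) :
    hG.toVertices (insert (hG.upEdge v) S) = insert v.1 (hG.toVertices S) := by
  ext u
  simp only [toVertices, Set.mem_ofPred_eq, Set.mem_insert_iff, hG.upEdge_bijective.1.eq_iff]
  constructor
  · intro h
    by_cases huv : u = v
    · exact Or.inl huv
    · exact Or.inr fun hu => (h hu).resolve_left fun h' => huv (Subtype.ext_iff.1 h')
  · rintro (rfl | h) hu
    · exact Or.inl rfl
    · exact Or.inr (h hu)

lemma toVertices_sdiff (v : {v // v ≠ ρ}) (S : Set G.edgeSet) :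
    hG.toVertices (S \ {hG.upEdge v}) = hG.toVertices S \ {v.1} := by
  ext u
  simp only [toVertices, Set.mem_ofPred_eq, Set.mem_sdiff, Set.mem_singleton_iff,
    hG.upEdge_bijective.1.eq_iff]
  constructor
  · intro h
    refine ⟨fun hu => (h hu).1, fun huv => ?_⟩
    have hu : u ≠ ρ := huv ▸ v.2
    exact (h hu).2 (Subtype.ext huv)
  · rintro ⟨h1, h2⟩ hu
    exact ⟨h1 hu, fun h' => h2 (Subtype.ext_iff.1 h')⟩

lemma openGraph_adj_iff {S : Set G.edgeSet} {u v : V} : (openGraph G S).Adj u v ↔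
    (u ≠ ρ ∧ u ∈ hG.toVertices S ∧ hG.parent u = v) ∨
    (v ≠ ρ ∧ v ∈ hG.toVertices S ∧ hG.parent v = u) := by
  rw [openGraph, SimpleGraph.fromEdgeSet_adj]
  constructor
  · rintro ⟨⟨e, he, heq⟩, -⟩
    obtain ⟨w, rfl⟩ := hG.upEdge_bijective.2 e
    simp only [upEdge, Sym2.eq_iff] at heq
    rcases heq with ⟨h1, h2⟩ | ⟨h1, h2⟩
    · exact Or.inr ⟨h2 ▸ w.2, fun hv => by subst h2; exact he, by rw [← h2, h1]⟩
    · exact Or.inl ⟨h2 ▸ w.2, fun hv => by subst h2; exact he, by rw [← h2, h1]⟩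
  · rintro (⟨hu, h1, h2⟩ | ⟨hv, h1, h2⟩)
    · refine ⟨⟨_, h1 hu, ?_⟩, fun h => ?_⟩
      · simp only [upEdge, h2]; exact Sym2.eq_swap
      · have := (hG.parent_spec hu).1; rw [h2, h] at this; exact G.loopless.irrefl _ this
    · refine ⟨⟨_, h1 hv, ?_⟩, fun h => ?_⟩
      · simp only [upEdge, h2]
      · have := (hG.parent_spec hv).1; rw [h2, h] at this; exact G.loopless.irrefl _ this

lemma reachable_iff {S : Set G.edgeSet} {y : V} : (openGraph G S).Reachable ρ y ↔
    y ∈ hG.toRootedTree.joined (hG.toVertices S) := by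
  set T := hG.toRootedTree with hT
  have hroot : T.root = ρ := rfl
  have hpar : T.par = hG.parent := rfl
  constructor
  · intro h
    rw [SimpleGraph.reachable_iff_reflTransGen] at h
    induction h with
    | refl => exact T.root_mem_joined _
    | tail _ hab ih =>
      rcases hG.openGraph_adj_iff.1 hab with ⟨h1, h2, h3⟩ | ⟨h1, h2, h3⟩
      · rw [← h3, ← hpar]; exact ((T.mem_joined_iff h1).1 ih).2
      · exact (T.mem_joined_iff h1).2 ⟨h2, by rw [hpar, h3]; exact ih⟩
  · obtain ⟨n, hn⟩ : ∃ n, T.lev y = n := ⟨_, rfl⟩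
    induction n generalizing y with
    | zero =>
      intro _
      rw [T.lev_eq_zero] at hn
      rw [hn, hroot]
    | succ n ih =>
      intro h
      have hy : y ≠ T.root := fun h0 => by rw [h0, T.lev_root] at hn; omega
      have h1 := (T.mem_joined_iff hy).1 h
      have h2 := T.lev_par hy
      refine (ih (by omega) h1.2).trans (SimpleGraph.Adj.reachable ?_)
      exact hG.openGraph_adj_iff.2 (Or.inr ⟨hy, h1.1, rfl⟩)

lemma percolates_iff {S : Set G.edgeSet} :
    S ∈ percolates G ρ ↔ hG.toVertices S ∈ hG.toRootedTree.perc hG.toRootedTree.root := by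
  have : S ∈ percolates G ρ ↔ {y | (openGraph G S).Reachable ρ y}.Infinite := Iff.rfl
  rw [this, hG.toRootedTree.perc_root_iff]
  simp only [hG.reachable_iff]
  rfl

open Classical in
lemma levelCount_eq (S : Set G.edgeSet) (n : ℕ) : levelCount G ρ S n =
    ((hG.toRootedTree.level n).filter
      fun y => y ∈ hG.toRootedTree.joined (hG.toVertices S)).card := by
  rw [levelCount, ← Set.ncard_coe_finset]
  congr 1
  ext y
  rw [Finset.coe_filter, Set.mem_ofPred_eq, Set.mem_ofPred_eq, hG.reachable_iff,
    RootedTree.mem_level]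
  rfl

end IsSphericallySymmetricTree

/-! ### Auxiliary independence and measurability facts. -/

lemma iIndepFun_of_const {V Ω β : Type*} [MeasurableSpace Ω] [MeasurableSpace β] {P : Measure Ω}
    [IsProbabilityMeasure P] {f : V → Ω → β} {ρ : V} {c : β} (hρ : f ρ = fun _ => c)
    (h : iIndepFun (fun v : {v // v ≠ ρ} => f v) P) : iIndepFun f P := by
  classical
  rw [iIndepFun_iff_measure_inter_preimage_eq_mul]
  intro S sets H
  by_cases hc : ρ ∈ S → c ∈ sets ρ
  · have h1 := h.measure_inter_preimage_eq_mul (S.subtype (· ≠ ρ)) (sets := fun v => sets v)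
      fun i hi => H _ (Finset.mem_subtype.1 hi)
    have e1 : ⋂ i ∈ S, f i ⁻¹' sets i =
        ⋂ i ∈ S.subtype (· ≠ ρ), f i ⁻¹' sets i := by
      ext ω
      simp only [Set.mem_iInter, Finset.mem_subtype, Set.mem_preimage, Subtype.forall]
      refine ⟨fun h a _ ha => h a ha, fun h a ha => ?_⟩
      by_cases haρ : a = ρ
      · subst haρ; rw [hρ]; exact hc ha
      · exact h a haρ ha
    rw [e1, h1, Finset.prod_subtype_eq_prod_filter (s := S) (p := (· ≠ ρ))
      (f := fun v => P (f v ⁻¹' sets v))]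
    refine Finset.prod_filter_of_ne fun v hv hne hvρ => hne ?_
    subst hvρ
    rw [hρ, Set.preimage_const_of_mem (hc hv), measure_univ]
  · push Not at hc
    have h0 : f ρ ⁻¹' sets ρ = ∅ := by rw [hρ, Set.preimage_const_of_notMem hc.2]
    rw [Finset.prod_eq_zero hc.1 (by rw [h0, measure_empty])]
    refine measure_mono_null (Set.biInter_subset_of_mem hc.1) ?_
    rw [h0, measure_empty]

/-- A countable union of measurable random points is infinite on a measurable event. -/
lemma measurableSet_infinite_setOf_exists {ι Ω : Type*} [MeasurableSpace Ω] [Countable ι]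
    {B : ι → Set Ω} (hB : ∀ i, MeasurableSet (B i)) {τ : ι → Ω → ℝ≥0}
    (hτ : ∀ i, Measurable (τ i)) :
    MeasurableSet {ω | {t | ∃ i, ω ∈ B i ∧ τ i ω = t}.Infinite} := by
  classical
  -- Infinitely many points means that, for every finite set of indices, some active point avoids
  -- all of their times; restricting to active indices in the finite set is unnecessary.
  have e : {ω | {t | ∃ i, ω ∈ B i ∧ τ i ω = t}.Infinite} =
      ⋂ s : Finset ι, ⋃ i, (B i ∩ ⋂ j ∈ s, {ω | τ j ω = τ i ω}ᶜ) := by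
    ext ω
    simp only [Set.mem_ofPred_eq, Set.mem_iInter, Set.mem_iUnion, Set.mem_inter_iff,
      Set.mem_compl_iff]
    constructor
    · intro h s
      obtain ⟨t, ⟨i, hi, rfl⟩, ht⟩ := h.exists_notMem_finset (s.image fun j => τ j ω)
      exact ⟨i, hi, fun j hj hji => ht (Finset.mem_image.2 ⟨j, hj, hji⟩)⟩
    · intro h hfin
      have hsub : (hfin.toFinset : Set ℝ≥0) ⊆ (fun i => τ i ω) '' {i | ω ∈ B i} := by
        rw [hfin.coe_toFinset]; exact fun t ht => ht
      obtain ⟨s, -, hs⟩ := Finset.subset_set_image_iff.1 hsub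
      obtain ⟨i, hi, hne⟩ := h s
      have hmem : τ i ω ∈ hfin.toFinset := hfin.mem_toFinset.2 ⟨i, hi, rfl⟩
      rw [← hs] at hmem
      obtain ⟨j, hj, hji⟩ := Finset.mem_image.1 hmem
      exact hne j hj hji
  rw [e]
  exact MeasurableSet.iInter fun s => MeasurableSet.iUnion fun i => (hB i).inter
    (Finset.measurableSet_biInter _ fun j _ => (measurableSet_eq_fun (hτ j) (hτ i)).compl)

/-! ### Transfer of the dynamics and of flip times between edges and vertices. -/

namespace IsSphericallySymmetricTree

variable {V Ω : Type*} [MeasurableSpace Ω] {P : Measure Ω} [IsProbabilityMeasure P]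
  {G : SimpleGraph V} {ρ : V} {d : ℕ → ℕ} {p : ℕ → ℝ} {X : G.edgeSet → ℝ≥0 → Ω → Bool}
  (hG : IsSphericallySymmetricTree G ρ d)

open Classical in
/-- The dynamics of the edges, indexed by their lower endpoints; the root is always open. -/
noncomputable def vertexPath (X : G.edgeSet → ℝ≥0 → Ω → Bool) (v : V) (ω : Ω) (t : ℝ≥0) : Bool :=
  if hv : v ≠ ρ then X (hG.upEdge ⟨v, hv⟩) t ω else true

omit [MeasurableSpace Ω] in
lemma vertexPath_of_ne {v : V} (hv : v ≠ ρ) :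
    hG.vertexPath X v = fun ω t => X (hG.upEdge ⟨v, hv⟩) t ω := by
  funext ω t
  rw [vertexPath, dif_pos hv]

omit [MeasurableSpace Ω] in
lemma vertexPath_root : hG.vertexPath X ρ = fun _ _ => true := by
  funext ω t
  rw [vertexPath, dif_neg (by simp)]

variable (hX : IsDynamicalPercolation (fun e => p (edgeLevel G ρ e)) X P)
include hG hX

omit [IsProbabilityMeasure P] in
lemma ae_isCadlag : ∀ᵐ ω ∂P, ∀ v, IsCadlag (hG.vertexPath X v ω) := by
  filter_upwards [hX.rightCont, hX.leftLim] with ω h1 h2 v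
  by_cases hv : v = ρ
  · subst hv
    rw [hG.vertexPath_root]
    exact ⟨fun t => Eventually.of_forall fun _ => rfl,
      fun t => ⟨true, Eventually.of_forall fun _ => rfl⟩⟩
  · rw [hG.vertexPath_of_ne hv]
    exact ⟨fun t => h1 _ t, fun t => h2 _ t⟩

/-- The root carries no edge: it gets a constantly open path, and `p 0`, arbitrary in the given
parameters, is reset to 1 accordingly. -/
lemma isTreeDynamics : IsTreeDynamics hG.toRootedTree (Function.update p 0 1)
    (hG.vertexPath X) P where
  indep := by
    refine iIndepFun_of_const hG.vertexPath_root ?_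
    have := hX.indep.precomp hG.upEdge_bijective.1
    have e : (fun v : {v // v ≠ ρ} => hG.vertexPath X v) =
        fun v ω t => X (hG.upEdge v) t ω := by
      funext v; exact hG.vertexPath_of_ne v.2
    rw [e]
    exact this
  chain v hv := by
    have hv' : v ≠ ρ := hv
    have hlev : hG.toRootedTree.lev v ≠ 0 := fun h0 => hv (hG.toRootedTree.lev_eq_zero.1 h0)
    rw [Function.update_of_ne hlev]
    refine ⟨?_, ?_, ?_⟩
    · rw [hG.vertexPath_of_ne hv']
      exact measurable_pi_lambda _ fun t => hX.measurable _ t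
    · intro n t a ht
      have := hX.markov (hG.upEdge ⟨v, hv'⟩) n t a ht
      rw [hG.edgeLevel_upEdge] at this
      rw [hG.vertexPath_of_ne hv']
      exact this
    · filter_upwards [hG.ae_isCadlag hX] with ω hω using hω v
  root := hG.vertexPath_root

omit [MeasurableSpace Ω] hX in
lemma cfg_vertexPath {ω : Ω} (hω : ∀ v, IsCadlag (hG.vertexPath X v ω)) (t : ℝ≥0) :
    cfg t (fun v => hG.vertexPath X v ω) = hG.toVertices (openAt (fun e t => X e t ω) t) := by
  ext v
  simp only [cfg, toVertices, openAt, Set.mem_ofPred_eq]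
  rw [(hω v).open_iff]
  by_cases hv : v = ρ
  · subst hv
    rw [hG.vertexPath_root]
    simp
  · rw [hG.vertexPath_of_ne hv]
    simp [hv]

/-- A vertex of level n is connected when the n independent edges on its path are open; at time 0
the switching convention has no effect. -/
lemma expectedCount_eq {ε : ℝ} (hε : 0 < ε) (hp : ∀ n ≥ 1, ε ≤ p n ∧ p n ≤ 1 - ε) (n : ℕ) :
    expectedCount G ρ X P n = meanCount d p n := by
  classical
  set T := hG.toRootedTree with hT
  set x := hG.vertexPath X with hx
  have hD := hG.isTreeDynamics hX
  have hjm : ∀ y, MeasurableSet {ω | y ∈ T.joined (cfg 0 fun v => x v ω)} := fun y => by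
    have e : {ω | y ∈ T.joined (cfg 0 fun v => x v ω)} = ⋂ j, ⋂ (_ : 1 ≤ j), ⋂ (_ : j ≤ T.lev y),
        {ω | T.anc y j ∈ cfg 0 fun v => x v ω} := by
      ext ω; simp [RootedTree.joined]
    rw [e]
    refine MeasurableSet.iInter fun j => MeasurableSet.iInter fun _ => MeasurableSet.iInter fun _ =>
      measurableSet_setOfPred.2 (measurable_set_iff.1 ?_ _)
    exact measurable_cfg.comp (measurable_const.prodMk hD.measurable_all)
  have hj : ∀ y ∈ T.level n, P.real {ω | y ∈ T.joined (cfg 0 fun v => x v ω)} =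
      ∏ j ∈ Finset.range n, p (j + 1) := by
    intro y hy
    have hy' := T.mem_level.1 hy
    have hinj : Set.InjOn (T.anc y) (Finset.Icc 1 n : Finset ℕ) := by
      intro i hi j hj hij
      rw [Finset.mem_coe, Finset.mem_Icc] at hi hj
      rw [← T.lev_anc (v := y) (j := i) (by omega), hij, T.lev_anc (by omega)]
    have h1 := hD.indep.measure_inter_preimage_eq_mul ((Finset.Icc 1 n).image (T.anc y))
      (sets := fun _ => {z | RightOpen 0 z ∨ LeftOpen 0 z})
      fun _ _ => measurable_prodMk_left measurableSet_rightOpen_or_leftOpen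
    rw [Finset.prod_image hinj] at h1
    have e : {ω | y ∈ T.joined (cfg 0 fun v => x v ω)} =
        ⋂ i ∈ (Finset.Icc 1 n).image (T.anc y), x i ⁻¹' {z | RightOpen 0 z ∨ LeftOpen 0 z} := by
      ext ω
      simp only [RootedTree.joined, hy', cfg, Set.mem_ofPred_eq, Set.mem_iInter, Finset.mem_image,
        Finset.mem_Icc, Set.mem_preimage]
      constructor
      · rintro h _ ⟨j, hj, rfl⟩
        exact h j hj.1 hj.2
      · exact fun h j h1 h2 => h _ ⟨j, ⟨h1, h2⟩, rfl⟩
    have e2 : Finset.Icc 1 n = Finset.Ico (0 + 1) (n + 1) := by ext; simp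
    rw [e, measureReal_def, h1, ENNReal.toReal_prod, Finset.range_eq_Ico,
      Finset.prod_Ico_add' (fun j => p j), ← e2]
    refine Finset.prod_congr rfl fun j hj => ?_
    rw [Finset.mem_Icc] at hj
    have hlev : T.lev (T.anc y j) = j := T.lev_anc (by omega)
    have h2 := hD.chain _ (T.anc_ne_root (v := y) (j := j) (by omega) (by omega))
    rw [hlev, Function.update_of_ne (by omega)] at h2
    exact h2.real_open' hε (hp j hj.1) 0
  have h1 : expectedCount G ρ X P n =
      ∫ ω, ∑ y ∈ T.level n, {ω | y ∈ T.joined (cfg 0 fun v => x v ω)}.indicator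
        (fun _ => (1 : ℝ)) ω ∂P := by
    refine integral_congr_ae ?_
    filter_upwards [hG.ae_isCadlag hX] with ω hω
    rw [hG.levelCount_eq, ← hG.cfg_vertexPath hω, ← Finset.sum_boole]
    rfl
  rw [h1, integral_finsetSum _ fun y _ => (integrable_const 1).indicator (hjm y)]
  have h2 : ∀ y ∈ T.level n, ∫ ω, {ω | y ∈ T.joined (cfg 0 fun v => x v ω)}.indicator
      (fun _ => (1 : ℝ)) ω ∂P = ∏ j ∈ Finset.range n, p (j + 1) := fun y hy => by
    rw [integral_indicator_const _ (hjm y), smul_eq_mul, mul_one, hj y hy]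
  rw [Finset.sum_congr rfl h2, Finset.sum_const, nsmul_eq_mul, T.card_level, meanCount,
    Finset.prod_mul_distrib]
  push_cast
  rfl

omit [MeasurableSpace Ω] hX in
lemma mem_flipTimes_iff {ω : Ω} (hω : ∀ v, IsCadlag (hG.vertexPath X v ω)) {t : ℝ≥0} :
    t ∈ flipTimes G ρ (fun e t => X e t ω) ↔
      cfg t (fun v => hG.vertexPath X v ω) ∈ hG.toRootedTree.perc hG.toRootedTree.root ∧
      ∃ v ≠ ρ, ¬ (insert v (cfg t fun v => hG.vertexPath X v ω) ∈
          hG.toRootedTree.perc hG.toRootedTree.root ↔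
        (cfg t fun v => hG.vertexPath X v ω) \ {v} ∈
          hG.toRootedTree.perc hG.toRootedTree.root) ∧
        Switches (hG.vertexPath X v ω) t := by
  rw [hG.cfg_vertexPath hω]
  simp only [flipTimes, Set.mem_ofPred_eq, IsPivotal]
  rw [hG.percolates_iff]
  refine and_congr_right fun _ => ?_
  rw [hG.upEdge_bijective.2.exists, Subtype.exists]
  refine exists_congr fun v => ?_
  rw [← exists_prop]
  refine exists_congr fun hv => ?_
  rw [hG.percolates_iff, hG.percolates_iff, hG.toVertices_insert, hG.toVertices_sdiff,
    hG.vertexPath_of_ne hv]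


/-- The event that the root percolates at the first switching time of `v` after the `k`-th point of a
dense sequence, with `v` pivotal. -/
def pivotalSwitch (X : G.edgeSet → ℝ≥0 → Ω → Bool) (i : {v // v ≠ ρ} × ℕ) : Set Ω :=
  {ω | jumpAfter (TopologicalSpace.denseSeq ℝ≥0 i.2) (hG.vertexPath X i.1 ω) ≤ 1 ∧
    cfg (jumpAfter (TopologicalSpace.denseSeq ℝ≥0 i.2) (hG.vertexPath X i.1 ω)).toNNReal
      (fun v => hG.vertexPath X v ω) ∈ {S | S ∈ hG.toRootedTree.perc hG.toRootedTree.root ∧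
        ¬ (insert i.1.1 S ∈ hG.toRootedTree.perc hG.toRootedTree.root ↔
          S \ {i.1.1} ∈ hG.toRootedTree.perc hG.toRootedTree.root)}}

lemma measurable_jumpAfter_vertexPath (i : {v // v ≠ ρ} × ℕ) : Measurable fun ω =>
    jumpAfter (TopologicalSpace.denseSeq ℝ≥0 i.2) (hG.vertexPath X i.1 ω) :=
  (measurable_jumpAfter _).comp ((hG.isTreeDynamics hX).measurable i.1)

lemma measurableSet_pivotalSwitch (i : {v // v ≠ ρ} × ℕ) :
    MeasurableSet (hG.pivotalSwitch X i) := by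
  have hτ := hG.measurable_jumpAfter_vertexPath hX i
  refine (measurableSet_le hτ measurable_const).inter ?_
  have h1 := measurable_cfg.comp
    (hτ.ennreal_toNNReal.prodMk (hG.isTreeDynamics hX).measurable_all)
  have hperc := hG.toRootedTree.measurableSet_perc hG.toRootedTree.root
  have hmem : ∀ u : V, Measurable fun S : Set V => u ∈ S := fun u =>
    measurable_set_iff.1 measurable_id u
  have hins : Measurable fun S : Set V => insert i.1.1 S :=
    measurable_set_iff.2 fun u => by
      simp only [Set.mem_insert_iff]
      exact measurable_const.or (hmem u)
  have hdiff : Measurable fun S : Set V => S \ {i.1.1} :=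
    measurable_set_iff.2 fun u => by
      simp only [Set.mem_sdiff, Set.mem_singleton_iff]
      exact (hmem u).and measurable_const
  have h2 : MeasurableSet {S | S ∈ hG.toRootedTree.perc hG.toRootedTree.root ∧
        ¬ (insert i.1.1 S ∈ hG.toRootedTree.perc hG.toRootedTree.root ↔
          S \ {i.1.1} ∈ hG.toRootedTree.perc hG.toRootedTree.root)} :=
    measurableSet_setOfPred.2 ((measurableSet_setOfPred.1 hperc).and
      ((measurableSet_setOfPred.1 (hins hperc)).iff (measurableSet_setOfPred.1 (hdiff hperc))).not)
  exact h1 h2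

-- Every switching time is a first switch after some dense time, so the flip times are countably
-- many measurable random points. This is what yields measurability of the final event.
omit [MeasurableSpace Ω] hX in
lemma flipTimes_inter_Icc_eq {ω : Ω} (hω : ∀ v, IsCadlag (hG.vertexPath X v ω)) :
    flipTimes G ρ (fun e t => X e t ω) ∩ Set.Icc 0 1 = {t | ∃ i, ω ∈ hG.pivotalSwitch X i ∧
      (jumpAfter (TopologicalSpace.denseSeq ℝ≥0 i.2) (hG.vertexPath X i.1 ω)).toNNReal = t} := by
  ext t
  simp only [Set.mem_inter_iff, Set.mem_ofPred_eq, Set.mem_Icc, zero_le, true_and]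
  rw [hG.mem_flipTimes_iff hω]
  constructor
  · rintro ⟨⟨h1, v, hv, h2, h3⟩, h4⟩
    obtain ⟨k, hk⟩ := (hω v).exists_jumpAfter_eq h3
    refine ⟨(⟨v, hv⟩, k), ⟨?_, ?_⟩, by rw [hk]; rfl⟩
    · simp only [hk]; exact_mod_cast h4
    · simp only [hk, ENNReal.toNNReal_coe]; exact ⟨h1, h2⟩
  · rintro ⟨⟨v, k⟩, ⟨h1, h2⟩, rfl⟩
    have hfin := (h1.trans_lt ENNReal.one_lt_top).ne
    have hspec := (hω v).jumpAfter_spec (ENNReal.coe_toNNReal hfin).symm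
    refine ⟨⟨h2.1, v, v.2, h2.2, hspec.2.1⟩, ?_⟩
    have := ENNReal.toNNReal_mono ENNReal.one_ne_top h1
    simpa using this

theorem nullMeasurableSet_infinite_flipTimes : NullMeasurableSet
    {ω | (flipTimes G ρ (fun e t => X e t ω) ∩ Set.Icc 0 1).Infinite} P := by
  have := hG.toRootedTree.countable
  have hm := measurableSet_infinite_setOf_exists (hG.measurableSet_pivotalSwitch hX)
    (fun i => (hG.measurable_jumpAfter_vertexPath hX i).ennreal_toNNReal)
  refine hm.nullMeasurableSet.congr ?_
  filter_upwards [hG.ae_isCadlag hX] with ω hω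
  refine propext ?_
  change Set.Infinite _ ↔ Set.Infinite _
  rw [hG.flipTimes_inter_Icc_eq hω]

omit [MeasurableSpace Ω] hX in
lemma firstJump_mem_flipTimes {ω : Ω} (hω : ∀ v, IsCadlag (hG.vertexPath X v ω)) {v : V}
    (hv : v ≠ ρ) (h : ω ∈ flipEvent hG.toRootedTree (hG.vertexPath X) v) :
    (firstJump (hG.vertexPath X) v ω).toNNReal ∈
      flipTimes G ρ (fun e t => X e t ω) ∩ Set.Icc 0 1 := by
  obtain ⟨h1, h2⟩ := h
  have hfin := (h1.trans_lt ENNReal.one_lt_top).ne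
  have hspec := (hω v).jumpAfter_spec (ENNReal.coe_toNNReal hfin).symm
  have h3 := hG.toRootedTree.perc_root_insert_of_pivot h2
  have h4 := hG.toRootedTree.not_perc_root_diff_of_pivot h2 hv
  refine ⟨(hG.mem_flipTimes_iff hω).2 ⟨?_, v, hv, fun hiff => h4 (hiff.1 h3), hspec.2.1⟩, ?_⟩
  -- By convention v is open at the time it switches, so inserting it changes nothing and the root
  -- percolates at that very time.
  · rwa [Set.insert_eq_of_mem] at h3
    exact ((hω v).open_iff _).2 (Or.inr hspec.2.1)
  · have := ENNReal.toNNReal_mono ENNReal.one_ne_top h1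
    exact ⟨zero_le, by simpa using this⟩

lemma measure_infinite_flipTimes_pos {ε : ℝ} {D : ℕ}
    (h : GoodParams d (Function.update p 0 1) ε D)
    (hpos : 0 < P {ω | {v | v ≠ ρ ∧
      ω ∈ flipEvent hG.toRootedTree (hG.vertexPath X) v}.Infinite}) :
    0 < P {ω | (flipTimes G ρ (fun e t => X e t ω) ∩ Set.Icc 0 1).Infinite} := by
  have := hG.toRootedTree.countable
  refine hpos.trans_le (measure_mono_ae ?_)
  filter_upwards [hG.ae_isCadlag hX, (hG.isTreeDynamics hX).ae_firstJump_ne h] with ω hω hne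
  intro hinf
  have hinj : Set.InjOn (fun v => (firstJump (hG.vertexPath X) v ω).toNNReal)
      {v | v ≠ ρ ∧ ω ∈ flipEvent hG.toRootedTree (hG.vertexPath X) v} := by
    intro u hu v hv huv
    by_contra hne'
    refine hne u v hne' hv.1 hu.2.1 ?_
    exact (ENNReal.toNNReal_eq_toNNReal_iff' (hu.2.1.trans_lt ENNReal.one_lt_top).ne
      (hv.2.1.trans_lt ENNReal.one_lt_top).ne).1 huv
  refine (Set.Infinite.image hinj hinf).mono ?_
  rintro _ ⟨v, hv, rfl⟩
  exact hG.firstJump_mem_flipTimes hω hv.1 hv.2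

end IsSphericallySymmetricTree

end DynPerc

lemma DynPerc.meanCount_update (d : ℕ → ℕ) (p : ℕ → ℝ) :
    DynPerc.meanCount d (Function.update p 0 1) = DynPerc.meanCount d p := by
  funext n
  refine Finset.prod_congr rfl fun j _ => ?_
  rw [Function.update_of_ne (by omega)]

/-- The harmonic series diverges, and n = 1 forces C to be positive. -/
lemma DynPerc.tendsto_sum_of_harmonic_le {S : ℕ → ℝ} {C : ℝ} (hS : ∀ n, 0 ≤ S n)
    (h : ∀ n : ℕ, ∑ m ∈ Finset.Icc 1 n, 1 / (m : ℝ) ≤ C * ∑ m ∈ Finset.Icc 1 n, S m) :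
    Tendsto (fun n : ℕ => ∑ m ∈ Finset.Icc 1 n, S m) atTop atTop := by
  have hC : 0 < C := by
    have h1 := h 1
    have h2 := hS 1
    simp only [Finset.Icc_self, Finset.sum_singleton, Nat.cast_one, div_one] at h1
    by_contra hC
    nlinarith
  have h1 : Tendsto (fun n : ℕ => ∑ m ∈ Finset.Icc 1 n, 1 / (m : ℝ)) atTop atTop := by
    have := Real.tendsto_sum_range_one_div_nat_succ_atTop
    refine this.congr fun n => ?_
    have e : Finset.Icc 1 n = Finset.Ico (0 + 1) (n + 1) := by ext; simp
    rw [e, ← Finset.sum_Ico_add' (fun m : ℕ => 1 / (m : ℝ)), Finset.range_eq_Ico]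
    push_cast
    rfl
  refine tendsto_atTop_mono (fun n => ?_) (h1.atTop_div_const hC)
  rw [div_le_iff₀ hC, mul_comm]
  exact h n

theorem mainTheorem3 {V Ω : Type*} [MeasurableSpace Ω] (P : Measure Ω) [IsProbabilityMeasure P]
    (G : SimpleGraph V) (ρ : V) (d : ℕ → ℕ) (p : ℕ → ℝ)
    (X : G.edgeSet → ℝ≥0 → Ω → Bool) (w : ℕ → ℝ)
    -- an infinite spherically symmetric tree
    (hG : DynPerc.IsSphericallySymmetricTree G ρ d) (hd : ∀ j, 1 ≤ d j)
    -- spherically symmetric edge probabilities bounded away from 0 and 1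
    (hp : ∃ ε > 0, ∀ n ≥ 1, ε ≤ p n ∧ p n ≤ 1 - ε)
    (hX : DynPerc.IsDynamicalPercolation (fun e => p (DynPerc.edgeLevel G ρ e)) X P)
    (hw : ∀ n, w n = DynPerc.expectedCount G ρ X P n)
    (hbdd : BddAbove (Set.range d))
    (hperc : Summable fun n => 1 / w n)
    (hfm : ∃ C : ℝ, ∀ n : ℕ, ∑ m ∈ Finset.Icc 1 n, 1 / (m : ℝ) ≤
      C * ∑ m ∈ Finset.Icc 1 n, ∑' k : ℕ, 1 / w (m + k))
    (hbbsum : Summable fun n : ℕ => ((∑' k : ℕ, w n / w (n + 1 + k)) ^ 2)⁻¹)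
    (hfinsmp : Summable fun k : ℕ => (((k : ℝ) + 1) * w k * (∑' j : ℕ, (w (k + j))⁻¹) ^ 2)⁻¹) :
    NullMeasurableSet
        {ω | (DynPerc.flipTimes G ρ (fun e t => X e t ω) ∩ Set.Icc 0 1).Infinite} P ∧
      0 < P {ω | (DynPerc.flipTimes G ρ (fun e t => X e t ω) ∩ Set.Icc 0 1).Infinite} := by
  refine ⟨hG.nullMeasurableSet_infinite_flipTimes hX, ?_⟩
  obtain ⟨ε, hε, hp⟩ := hp
  obtain ⟨D, hD⟩ := hbdd
  obtain ⟨C, hC⟩ := hfm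
  -- The expected counts are the explicit products ∏ d_j p_{j+1}, which do not involve `p 0`.
  have hwm : w = DynPerc.meanCount d (Function.update p 0 1) := by
    funext n
    rw [hw, hG.expectedCount_eq hX hε hp, DynPerc.meanCount_update]
  subst hwm
  have h : DynPerc.GoodParams d (Function.update p 0 1) ε D :=
    { one_le_deg := hd
      deg_le := fun j => hD ⟨j, rfl⟩
      eps_pos := hε
      prob := fun n hn => by
        rw [Function.update_of_ne (by omega)]
        exact hp n hn
      summable := by simpa only [one_div] using hperc }
  refine hG.measure_infinite_flipTimes_pos hX h
    ((hG.isTreeDynamics hX).measure_infinite_flipEvent_pos h (Function.update_self _ _ _)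
      (DynPerc.tendsto_sum_of_harmonic_le h.invTail_nonneg (C := C) fun n => ?_) ?_ hfinsmp)
  · simpa only [one_div, DynPerc.invTail] using hC n
  · refine hbbsum.congr fun n => ?_
    simp only [div_eq_mul_inv]
    rw [tsum_mul_left]
    rfl
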